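/- **Setting.** Let $M>0$ and let $\mathcal M=\mathbb R\times[2M,\infty)\times S^2$ (a manifold with boundary, coordinates $(t^*,r,x)$), with the Schwarzschild metric $$g_M=\tilde g_M+\slashed g_M,\qquad \tilde g_M=-(1-\mu)\,dt^{*2}+2\mu\,dt^*dr+(1+\mu)\,dr^2,\qquad \slashed g_M=r^2\mathring g,\qquad \mu=\tfrac{2M}{r},$$ $\mathring g$ being the unit round metric on $S^2$. Write $\mathcal M=\mathcal Q\times S^2$, with indices $a,b,c$ on $\mathcal Q$ (coordinates $t^*,r$) and $A,B,C$ on $S^2$. All objects are smooth up to the boundary $r=2M$. Let $\tilde\nabla,\slashed\nabla$ be the Levi-Civita connections of $\tilde g_M,\slashed g_M$, where $\tilde\nabla$ acts on $S$-indices, and $\slashed\nabla$ on $\mathcal Q$-indices, by differentiating components in a frame lifted from the respective factor (in particular $\tilde\nabla_a\xi_A=\partial_a\xi_A$). Let $\tilde d$ be the exterior derivative along $\mathcal Q$, $\tilde\delta w=-\tilde\nabla^aw_a$, $(\tilde\delta T)_b=-\tilde\nabla^aT_{ab}$, $\tilde\Box=\tilde\nabla^a\tilde\nabla_a$, $\slashed\Delta=\slashed\nabla^A\slashed\nabla_A$,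 $\slashed{\mathrm{div}}=\slashed\nabla^A(\cdot)_{A\cdots}$, $\slashed{\mathrm{curl}}\,\xi=\slashed\epsilon^{AB}\slashed\nabla_A\xi_B$ and $(\tilde\star w)_b=\tilde\epsilon_{ab}w^a$, where $\slashed\epsilon,\tilde\epsilon$ are the volume forms ($S^2$ outward oriented, $\mathcal Q$ oriented by $dt^*\wedge dr$). Let $P=\tilde\nabla r$; a subscript $P$ denotes contraction with $P$. Put $$(u\,\hat\otimes\,v)_{ab}=u_av_b+u_bv_a-(\tilde g_M)_{ab}u^cv_c,\qquad (\tilde\nabla\hat\otimes w)_{ab}=\tilde\nabla_aw_b+\tilde\nabla_bw_a+(\tilde g_M)_{ab}\tilde\delta w,$$ $$(\slashed\nabla\hat\otimes\xi)_{AB}=\slashed\nabla_A\xi_B+\slashed\nabla_B\xi_A-(\slashed g_M)_{AB}\slashed{\mathrm{div}}\,\xi,$$ $((\tilde\nabla w)_P)_a=P^b\tilde\nabla_aw_b$, and let $(\tilde\nabla\hat\otimes T)_P$ be twice the symmetric trace-free part of $P^c\tilde\nabla_aT_{bc}$. Denote by $T_{l=0}$ the mean of the $(t^*,r)$-components of a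 $\mathcal Q$-tensor $T$ over the spheres of symmetry. **Linearised gravity.** A smooth solution of the equations of linearised gravity is a collection $\mathscr S=(\hat g,\mathrm{tr}\,\tilde g,m,\hat{\slashed g},\mathrm{tr}\,\slashed g)$ of a symmetric trace-free 2-covariant $\mathcal Q$-tensor $\hat g_{ab}$, a function $\mathrm{tr}\,\tilde g$, a $\mathcal Q\otimes S$ 1-form $m_{aA}$, a symmetric trace-free 2-covariant $S$-tensor $\hat{\slashed g}_{AB}$ and a function $\mathrm{tr}\,\slashed g$, all smooth on $\mathcal M$, such that, with $k:=(\hat g_{l=0})_P$, $$\tilde\Box\hat g+\slashed\Delta\hat g+\tfrac2r\tilde\nabla_P\hat g-\tfrac2r(\tilde\nabla\hat\otimes\hat g)_P-\tfrac{4\mu}{r^2}\hat g=\tfrac1r dr\hat\otimes\tilde d\,\mathrm{tr}\,\tilde g+\tfrac2r dr\hat\otimes\slashed{\mathrm{div}}\,m-\tfrac1r dr\hat\otimes\tilde d\,\mathrm{tr}\,\slashed g-\tilde\nabla\hat\otimes(r^{-1}k),$$ $$\tilde\Box\,\mathrm{tr}\,\tilde g+\slashed\Delta\,\mathrm{tr}\,\tilde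 g=\tfrac2r\tilde\delta k-\tfrac2{r^2}k_P,$$ $$\tilde\Box m+\slashed\Delta m-\tfrac2r(\tilde\nabla m)_P-\tfrac1{r^2}m+\tfrac2{r^2}dr\,m_P=\tfrac2r dr\,\slashed{\mathrm{div}}\,\hat{\slashed g},$$ $$\tilde\Box\hat{\slashed g}+\slashed\Delta\hat{\slashed g}-\tfrac2r\tilde\nabla_P\hat{\slashed g}-\tfrac{4\mu}{r^2}\hat{\slashed g}=0,$$ $$\tilde\Box\,\mathrm{tr}\,\slashed g+\slashed\Delta\,\mathrm{tr}\,\slashed g+\tfrac2r\tilde\nabla_P\mathrm{tr}\,\slashed g+\tfrac2{r^2}\mathrm{tr}\,\slashed g=\tfrac4{r^2}\hat g_{PP}+\tfrac2{r^2}\mathrm{tr}\,\tilde g-\tfrac4{r^2}k_P,$$ $$-\tilde\delta\hat g+\slashed{\mathrm{div}}\,m-\tfrac12\tilde d\,\mathrm{tr}\,\slashed g=-\tfrac1rk,\qquad -\tilde\delta m-\tfrac12\slashed\nabla\mathrm{tr}\,\tilde g+\slashed{\mathrm{div}}\,\hat{\slashed g}=0.$$ **Gauge-invariant quantities.** With $\slashed\Pi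 f:=r^4\slashed{\mathrm{div}}\,\slashed{\mathrm{div}}\,\slashed\nabla\hat\otimes\slashed\nabla f$ (acting componentwise on $\mathcal Q$-tensors) and $$h:=r^4\slashed{\mathrm{div}}\,\slashed{\mathrm{div}}\,\slashed\nabla\hat\otimes m-r^2\tilde d\big(r^2\slashed{\mathrm{div}}\,\slashed{\mathrm{div}}\,\hat{\slashed g}\big),$$ define $$\hat\tau:=\slashed\Pi\hat g-\tilde\nabla\hat\otimes h,\qquad \mathrm{tr}\,\tau:=\slashed\Pi\,\mathrm{tr}\,\tilde g+2\tilde\delta h,$$ $$\eta:=r^4\slashed{\mathrm{curl}}\,\slashed{\mathrm{div}}\,\slashed\nabla\hat\otimes m-r^2\tilde d\big(r^2\slashed{\mathrm{curl}}\,\slashed{\mathrm{div}}\,\hat{\slashed g}\big),\qquad \sigma:=\slashed\Pi\,\mathrm{tr}\,\slashed g-\tfrac4rh_P-2r^4\slashed\Delta\,\slashed{\mathrm{div}}\,\slashed{\mathrm{div}}\,\hat{\slashed g}.$$ Let $\Lambda$ be the space of smooth functions on $\mathcal M$ which are $L^2(S^2)$-orthogonal, on every sphere of symmetry, to the spherical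 harmonics with $l=0,1$, and let $\zeta:\Lambda\to\Lambda$ be the inverse of $r^2\slashed\Delta+2-\tfrac{6M}r:\Lambda\to\Lambda$, acting componentwise on $\mathcal Q$ 1-forms with components in $\Lambda$. **Theorem.** For every smooth solution $\mathscr S$ of the equations of linearised gravity, $\mathrm{tr}\,\tau=0$. There is a unique $\Phi\in\Lambda$ which satisfies the Regge–Wheeler equation $$\tilde\Box\Phi+\slashed\Delta\Phi=-\frac6{r^2}\frac Mr\Phi$$ and $$\eta=-\tilde\star\tilde d(r\Phi).$$ There is a unique $\Psi\in\Lambda$ which satisfies the Zerilli equation $$\tilde\Box\Psi+\slashed\Delta\Psi=-\frac6{r^2}\frac Mr\Psi+\frac{24}{r^3}\frac Mr(r-3M)\zeta\Psi+\frac{72}{r^3}\frac{M^2}{r^2}(r-2M)\zeta^2\Psi$$ and $$\hat\tau=\tilde\nabla\hat\otimes\tilde d(r\Psi)+6\mu\,dr\,\hat\otimes\,\zeta\tilde d\Psi,$$ $$\sigma=-2r\slashed\Delta\Psi+4\tilde\nabla_P\Psi+\frac{12\mu}r(1-\mu)\zeta\Psi.$$ -/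

import Mathlib

open scoped ContDiff

namespace LinGrav

noncomputable section

/-! ### The Schwarzschild exterior as a manifold with boundary -/

/-- Euclidean three-space, in which the unit sphere is embedded. -/
abbrev E3 : Type := EuclideanSpace ℝ (Fin 3)

/-- The round unit sphere. -/
abbrev S2 : Type := Metric.sphere (0 : E3) 1

/-- The Schwarzschild exterior `ℝ × [2M, ∞) × S²`, with points `(t*, r, x)`. -/
abbrev Ext (M : ℝ) : Type := ℝ × Set.Ici (2 * M) × S2

/-- Scalar fields on the exterior. -/
abbrev Scal (M : ℝ) : Type := Ext M → ℝ

/-- The cone `{(t*, r, x) : 2M ≤ r, x ≠ 0}` over the exterior in `ℝ × ℝ × ℝ³`. -/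
def region (M : ℝ) : Set (ℝ × ℝ × E3) := {p | 2 * M ≤ p.2.1 ∧ p.2.2 ≠ 0}

theorem normalize_mem {x : E3} (hx : x ≠ 0) :
    ‖x‖⁻¹ • x ∈ Metric.sphere (0 : E3) 1 := by
  rw [mem_sphere_zero_iff_norm, norm_smul, norm_inv, norm_norm]
  exact inv_mul_cancel₀ (norm_ne_zero_iff.mpr hx)

open Classical in
/-- The extension of a scalar field to the cone `region M`, constant along the rays of `ℝ³`. -/
def lift {M : ℝ} (f : Scal M) : ℝ × ℝ × E3 → ℝ := fun p =>
  if h : 2 * M ≤ p.2.1 ∧ p.2.2 ≠ 0 then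
    f (p.1, ⟨p.2.1, Set.mem_Ici.mpr h.1⟩, ⟨‖p.2.2‖⁻¹ • p.2.2, normalize_mem h.2⟩)
  else 0

/-- The inclusion of the exterior into `ℝ × ℝ × ℝ³`. -/
def incl {M : ℝ} (p : Ext M) : ℝ × ℝ × E3 := (p.1, (p.2.1 : ℝ), (p.2.2 : E3))

/-- Smoothness of a scalar field on the manifold with boundary `Ext M`, up to and including the
boundary `r = 2M` (the radial retraction onto the sphere is a smooth submersion). -/
def Smooth {M : ℝ} (f : Scal M) : Prop := ContDiffOn ℝ ∞ (lift f) (region M)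

/-- The derivative of a scalar field in the direction `v` (one-sided at the boundary `r = 2M`). -/
def dirDeriv {M : ℝ} (v : ℝ × ℝ × E3) (f : Scal M) : Scal M := fun p =>
  fderivWithin ℝ (lift f) (region M) (incl p) v

/-- The coordinate derivatives `∂/∂t*` (index `0`) and `∂/∂r` (index `1`). -/
def dQ {M : ℝ} (a : Fin 2) (f : Scal M) : Scal M :=
  dirDeriv ((![(1, 0, 0), (0, 1, 0)] : Fin 2 → ℝ × ℝ × E3) a) f

/-- The `i`-th Cartesian component of the tangential gradient along the unit sphere. -/
def dS {M : ℝ} (i : Fin 3) (f : Scal M) : Scal M :=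
  dirDeriv (0, 0, EuclideanSpace.single i 1) f

/-- The area radius `r`. -/
def rad {M : ℝ} : Scal M := fun p => (p.2.1 : ℝ)

/-- The mass, as a constant function. -/
def mass {M : ℝ} : Scal M := fun _ => M

/-- The mass aspect function `μ = 2M/r`. -/
def mu {M : ℝ} : Scal M := 2 * mass / rad

/-- The Cartesian coordinate functions on the unit sphere. -/
def pos {M : ℝ} (i : Fin 3) : Scal M := fun p => (p.2.2 : E3) i

/-! ### Tensor fields

`𝒬`-indices refer to the coordinates `(t*, r)`. An `S`-tensor is given by its Cartesian components
on the unit sphere: a 1-form `ξ` on `S²` is identified with the tangential vector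
`(ξ₀, ξ₁, ξ₂)` for which `ξ(v) = ∑ ξᵢ vᵢ` for all `v` tangent to the unit sphere, and similarly for
2-tensors. Thus `S`-components of a field are components in a frame which does not depend on
`(t*, r)`. -/

/-- `𝒬` 1-forms. -/
abbrev QForm (M : ℝ) : Type := Fin 2 → Scal M
/-- 2-covariant `𝒬`-tensors. -/
abbrev QTens (M : ℝ) : Type := Fin 2 → Fin 2 → Scal M
/-- Cartesian components of `S` 1-forms (tangentiality is imposed where it is used). -/
abbrev SForm (M : ℝ) : Type := Fin 3 → Scal M
/-- Cartesian components of 2-covariant `S`-tensors (likewise). -/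
abbrev STens (M : ℝ) : Type := Fin 3 → Fin 3 → Scal M
/-- Components of `𝒬 ⊗ S` 1-forms. -/
abbrev QSForm (M : ℝ) : Type := Fin 2 → Fin 3 → Scal M

/-! ### The `𝒬`-metric and its calculus -/

/-- The `𝒬`-metric `-(1-μ) dt*² + 2μ dt* dr + (1+μ) dr²`. -/
def gQ {M : ℝ} : QTens M := !![-(1 - mu), mu; mu, 1 + mu]

/-- The inverse of the `𝒬`-metric. -/
def gQinv {M : ℝ} : QTens M := !![-(1 + mu), mu; mu, 1 - mu]

theorem gQ_mul_gQinv {M : ℝ} (a c : Fin 2) :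
    ∑ b, (gQ a b * gQinv b c : Scal M) = if a = c then 1 else 0 := by
  fin_cases a <;> fin_cases c <;> simp [gQ, gQinv, Fin.sum_univ_two] <;> ring

/-- The volume form of the `𝒬`-metric, which has determinant `-1`, oriented by `dt* ∧ dr`. -/
def epsQ {M : ℝ} : QTens M := !![0, 1; -1, 0]

/-- The Christoffel symbols `Γᶜ_{ab}` of the `𝒬`-metric. -/
def christoffel {M : ℝ} (c a b : Fin 2) : Scal M :=
  ∑ d, gQinv c d * (dQ a (gQ b d) + dQ b (gQ a d) - dQ d (gQ a b)) / 2

/-- The 1-form `dr`. -/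
def dr {M : ℝ} : QForm M := ![0, 1]

/-- The vector field `P` metrically dual to `dr`. -/
def vecP {M : ℝ} (a : Fin 2) : Scal M := ∑ b, gQinv a b * dr b

/-- `∇̃f = d̃f` on functions. -/
def qGrad {M : ℝ} (f : Scal M) : QForm M := fun a => dQ a f

/-- `∇̃_a w_b`. -/
def qNabla1 {M : ℝ} (w : QForm M) : Fin 2 → Fin 2 → Scal M := fun a b =>
  dQ a (w b) - ∑ c, christoffel c a b * w c

/-- `∇̃_a T_{bc}`. -/
def qNabla2 {M : ℝ} (T : QTens M) : Fin 2 → Fin 2 → Fin 2 → Scal M := fun a b c =>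
  dQ a (T b c) - ∑ d, (christoffel d a b * T d c + christoffel d a c * T b d)

/-- `∇̃_a U_{bce}`. -/
def qNabla3 {M : ℝ} (U : Fin 2 → Fin 2 → Fin 2 → Scal M) :
    Fin 2 → Fin 2 → Fin 2 → Fin 2 → Scal M := fun a b c e =>
  dQ a (U b c e) - ∑ d, (christoffel d a b * U d c e + christoffel d a c * U b d e
    + christoffel d a e * U b c d)

/-- The trace with respect to the `𝒬`-metric. -/
def qTr {M : ℝ} (T : QTens M) : Scal M := ∑ a, ∑ b, gQinv a b * T a b

/-- The codifferential `δ̃w = -∇̃ᵃw_a`. -/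
def qDelta1 {M : ℝ} (w : QForm M) : Scal M := -qTr (qNabla1 w)

/-- The codifferential `(δ̃T)_c = -∇̃ᵃT_{ac}`. -/
def qDelta2 {M : ℝ} (T : QTens M) : QForm M := fun c => -qTr (fun a b => qNabla2 T a b c)

/-- The wave operator of the `𝒬`-metric on functions. -/
def qBox0 {M : ℝ} (f : Scal M) : Scal M := qTr (qNabla1 (qGrad f))

/-- The wave operator of the `𝒬`-metric on `𝒬` 1-forms. -/
def qBox1 {M : ℝ} (w : QForm M) : QForm M := fun c =>
  qTr (fun a b => qNabla2 (qNabla1 w) a b c)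

/-- The wave operator of the `𝒬`-metric on 2-covariant `𝒬`-tensors. -/
def qBox2 {M : ℝ} (T : QTens M) : QTens M := fun c d =>
  qTr (fun a b => qNabla3 (qNabla2 T) a b c d)

/-- `(u ⊗̂ v)_{ab} = u_a v_b + u_b v_a - g̃_{ab} uᶜv_c`. -/
def qHat {M : ℝ} (u v : QForm M) : QTens M := fun a b =>
  u a * v b + u b * v a - gQ a b * qTr (fun c d => u c * v d)

/-- `(∇̃ ⊗̂ w)_{ab} = ∇̃_a w_b + ∇̃_b w_a + g̃_{ab} δ̃w`. -/
def qNablaHat {M : ℝ} (w : QForm M) : QTens M := fun a b =>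
  qNabla1 w a b + qNabla1 w b a + gQ a b * qDelta1 w

/-- The Hodge star `(⋆̃w)_b = ε̃_{ab} wᵃ`. -/
def qStar {M : ℝ} (w : QForm M) : QForm M := fun b => ∑ a, ∑ c, epsQ a b * gQinv a c * w c

/-- The contraction `w_P`. -/
def contrP {M : ℝ} (w : QForm M) : Scal M := ∑ a, vecP a * w a

/-- The contraction `(T_P)_b = Pᵃ T_{ab}`. -/
def contrP2 {M : ℝ} (T : QTens M) : QForm M := fun b => ∑ a, vecP a * T a b

/-- `∇̃_P f`. -/
def qNablaP0 {M : ℝ} (f : Scal M) : Scal M := contrP (qGrad f)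

/-- `∇̃_P T`. -/
def qNablaP2 {M : ℝ} (T : QTens M) : QTens M := fun b c => ∑ a, vecP a * qNabla2 T a b c

/-- `(∇̃w)_P`, with components `Pᵇ ∇̃_a w_b`. -/
def qNablaContrP1 {M : ℝ} (w : QForm M) : QForm M := fun a => ∑ b, vecP b * qNabla1 w a b

/-- `(∇̃T)_P`, with components `Pᶜ ∇̃_a T_{bc}`. -/
def qNablaContrP2 {M : ℝ} (T : QTens M) : QTens M := fun a b => ∑ c, vecP c * qNabla2 T a b c

/-- `(∇̃ ⊗̂ T)_P`: twice the symmetric trace-free part of `Pᶜ ∇̃_a T_{bc}`. -/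
def qNablaHatP {M : ℝ} (T : QTens M) : QTens M := fun a b =>
  qNablaContrP2 T a b + qNablaContrP2 T b a - gQ a b * qTr (qNablaContrP2 T)

/-! ### The `S`-metric and its calculus

The Levi-Civita connection of `r² g̊` on a sphere is that of the unit sphere: differentiate the
Cartesian components along the sphere and project every index onto the tangent plane. -/

/-- The Cartesian components `δᵢⱼ - xᵢxⱼ` of the metric of the unit sphere, which are also those of
the projection onto its tangent plane. -/
def proj {M : ℝ} (i j : Fin 3) : Scal M := (if i = j then 1 else 0) - pos i * pos j

/-- The `S`-metric `r² g̊`. -/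
def gS {M : ℝ} : STens M := fun i j => rad ^ 2 * proj i j

/-- `∇̸f` on functions. -/
def sGrad {M : ℝ} (f : Scal M) : SForm M := fun i => dS i f

/-- `∇̸_i ξ_j`. -/
def sNabla1 {M : ℝ} (ξ : SForm M) : Fin 3 → Fin 3 → Scal M := fun i j =>
  ∑ b, proj j b * dS i (ξ b)

/-- `∇̸_i θ_{jk}`. -/
def sNabla2 {M : ℝ} (θ : STens M) : Fin 3 → Fin 3 → Fin 3 → Scal M := fun i j k =>
  ∑ b, ∑ c, proj j b * proj k c * dS i (θ b c)

/-- `∇̸_i U_{jkl}`. -/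
def sNabla3 {M : ℝ} (U : Fin 3 → Fin 3 → Fin 3 → Scal M) :
    Fin 3 → Fin 3 → Fin 3 → Fin 3 → Scal M := fun i j k l =>
  ∑ b, ∑ c, ∑ d, proj j b * proj k c * proj l d * dS i (U b c d)

/-- The trace of a (tangential) tensor with respect to the `S`-metric `r² g̊`. -/
def sTr {M : ℝ} (θ : STens M) : Scal M := (∑ i, θ i i) / rad ^ 2

/-- The divergence of `S` 1-forms. -/
def sDiv1 {M : ℝ} (ξ : SForm M) : Scal M := sTr (sNabla1 ξ)

/-- The divergence of 2-covariant `S`-tensors. -/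
def sDiv2 {M : ℝ} (θ : STens M) : SForm M := fun k => sTr (fun i j => sNabla2 θ i j k)

/-- The Laplacian of the `S`-metric on functions. -/
def sLap0 {M : ℝ} (f : Scal M) : Scal M := sTr (sNabla1 (sGrad f))

/-- The Laplacian of the `S`-metric on `S` 1-forms. -/
def sLap1 {M : ℝ} (ξ : SForm M) : SForm M := fun k =>
  sTr (fun i j => sNabla2 (sNabla1 ξ) i j k)

/-- The Laplacian of the `S`-metric on 2-covariant `S`-tensors. -/
def sLap2 {M : ℝ} (θ : STens M) : STens M := fun k l =>
  sTr (fun i j => sNabla3 (sNabla2 θ) i j k l)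

/-- `(∇̸ ⊗̂ ξ)_{ij} = ∇̸_i ξ_j + ∇̸_j ξ_i - g̸_{ij} div ξ`. -/
def sNablaHat {M : ℝ} (ξ : SForm M) : STens M := fun i j =>
  sNabla1 ξ i j + sNabla1 ξ j i - gS i j * sDiv1 ξ

/-- The curl `ε̸ⁱʲ ∇̸_i ξ_j` of an `S` 1-form, the sphere being oriented by its outward normal `x`:
in Cartesian components `r⁻² x · (∇̸ × ξ)`. -/
def sCurl {M : ℝ} (ξ : SForm M) : Scal M :=
  (pos 0 * (sNabla1 ξ 1 2 - sNabla1 ξ 2 1) + pos 1 * (sNabla1 ξ 2 0 - sNabla1 ξ 0 2)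
    + pos 2 * (sNabla1 ξ 0 1 - sNabla1 ξ 1 0)) / rad ^ 2

/-! ### The spherical harmonics `l = 0, 1` -/

/-- The surface measure of the unit sphere. -/
abbrev sphereMeasure : MeasureTheory.Measure S2 :=
  (MeasureTheory.volume : MeasureTheory.Measure E3).toSphere

/-- The projection of a function onto `l = 0`: its mean over every sphere of symmetry. -/
def sMean {M : ℝ} (f : Scal M) : Scal M := fun p => ⨍ y, f (p.1, p.2.1, y) ∂sphereMeasure

/-- Functions with vanishing projection to `l = 0, 1`. The spherical harmonics with `l = 0, 1` are
spanned by the constants and the restrictions of the Cartesian coordinates. -/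
def VanishingL01 {M : ℝ} (f : Scal M) : Prop :=
  ∀ (t : ℝ) (r : Set.Ici (2 * M)),
    ∫ y, f (t, r, y) ∂sphereMeasure = 0 ∧
    ∀ i : Fin 3, ∫ y, f (t, r, y) * (y : E3) i ∂sphereMeasure = 0

/-- The space of smooth functions with vanishing projection to `l = 0, 1`. -/
def LamM (M : ℝ) : Set (Scal M) := {f | Smooth f ∧ VanishingL01 f}

/-- The elliptic operator `Δ̸ + (2/r²)(1 - 3M/r)`. -/
def zSlap {M : ℝ} (f : Scal M) : Scal M :=
  sLap0 f + 2 / rad ^ 2 * (1 - 3 * mass / rad) * f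

/-- The operator `ζ`: the inverse of `r² (Δ̸ + (2/r²)(1 - 3M/r))` on `LamM M`. -/
def zeta {M : ℝ} (f : Scal M) : Scal M :=
  Function.invFunOn (fun u : Scal M => rad ^ 2 * zSlap u) (LamM M) f

/-- The operator `Π̸ f = r⁴ div div (∇̸ ⊗̂ ∇̸f)`. -/
def piS {M : ℝ} (f : Scal M) : Scal M :=
  rad ^ 4 * sDiv1 (sDiv2 (sNablaHat (sGrad f)))

/-! ### The equations of linearised gravity -/

/-- The linearised metric, decomposed into the trace-free part and the trace of its `𝒬`-part, its
`𝒬 ⊗ S`-part, and the trace-free part and the trace of its `S`-part. -/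
structure Perturbation (M : ℝ) where
  gHat : QTens M
  trG : Scal M
  gMix : QSForm M
  sHat : STens M
  trS : Scal M

/-- The spherically symmetric part of the trace-free `𝒬`-part of the linearised metric, contracted
with `P`. -/
def Perturbation.gHatZeroP {M : ℝ} (S : Perturbation M) : QForm M :=
  contrP2 (fun a b => sMean (S.gHat a b))

/-- The contraction of the `𝒬 ⊗ S`-part with `P`. -/
def Perturbation.gMixP {M : ℝ} (S : Perturbation M) : SForm M := fun i =>
  ∑ a, vecP a * S.gMix a i

/-- Smooth solutions of the equations of linearised gravity around Schwarzschild. -/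
structure IsSmoothSolution {M : ℝ} (S : Perturbation M) : Prop where
  smooth_gHat : ∀ a b, Smooth (S.gHat a b)
  smooth_trG : Smooth S.trG
  smooth_gMix : ∀ a i, Smooth (S.gMix a i)
  smooth_sHat : ∀ i j, Smooth (S.sHat i j)
  smooth_trS : Smooth S.trS
  gHat_symm : ∀ a b, S.gHat a b = S.gHat b a
  gHat_traceless : qTr S.gHat = 0
  gMix_tangential : ∀ a, ∑ i, pos i * S.gMix a i = 0
  sHat_symm : ∀ i j, S.sHat i j = S.sHat j i
  sHat_tangential : ∀ j, ∑ i, pos i * S.sHat i j = 0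
  sHat_traceless : sTr S.sHat = 0
  eq_gHat : ∀ a b,
    qBox2 S.gHat a b + sLap0 (S.gHat a b) + 2 / rad * qNablaP2 S.gHat a b
        - 2 / rad * qNablaHatP S.gHat a b - 4 / rad * (mu / rad) * S.gHat a b
      = 1 / rad * qHat dr (qGrad S.trG) a b
        + 2 / rad * qHat dr (fun c => sDiv1 (S.gMix c)) a b
        - 1 / rad * qHat dr (qGrad S.trS) a b
        - qNablaHat (fun c => 1 / rad * S.gHatZeroP c) a b
  eq_trG :
    qBox0 S.trG + sLap0 S.trG
      = 2 / rad * qDelta1 S.gHatZeroP - 2 / rad ^ 2 * contrP S.gHatZeroP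
  eq_gMix : ∀ a i,
    qBox1 (fun c => S.gMix c i) a + sLap1 (S.gMix a) i
        - 2 / rad * qNablaContrP1 (fun c => S.gMix c i) a
        - 1 / rad ^ 2 * S.gMix a i + 2 / rad ^ 2 * dr a * S.gMixP i
      = 2 / rad * dr a * sDiv2 S.sHat i
  eq_sHat : ∀ i j,
    qBox0 (S.sHat i j) + sLap2 S.sHat i j - 2 / rad * qNablaP0 (S.sHat i j)
        - 4 / rad * (mu / rad) * S.sHat i j = 0
  eq_trS :
    qBox0 S.trS + sLap0 S.trS + 2 / rad * qNablaP0 S.trS + 2 / rad ^ 2 * S.trS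
      = 4 / rad ^ 2 * contrP (contrP2 S.gHat) + 2 / rad ^ 2 * S.trG
        - 4 / rad ^ 2 * contrP S.gHatZeroP
  gauge_Q : ∀ a,
    -qDelta2 S.gHat a + sDiv1 (S.gMix a) - 1 / 2 * qGrad S.trS a
      = -(1 / rad * S.gHatZeroP a)
  gauge_S : ∀ i,
    -qDelta1 (fun c => S.gMix c i) - 1 / 2 * sGrad S.trG i + sDiv2 S.sHat i = 0

/-! ### The gauge-invariant quantities -/

/-- The auxiliary `𝒬` 1-form
`h = r⁴ div div (∇̸ ⊗̂ g_mix) - r² d̃(r² div div ĝ̸)`. -/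
def Perturbation.h {M : ℝ} (S : Perturbation M) : QForm M := fun a =>
  rad ^ 4 * sDiv1 (sDiv2 (sNablaHat (S.gMix a)))
    - rad ^ 2 * qGrad (rad ^ 2 * sDiv1 (sDiv2 S.sHat)) a

/-- `τ̂ = Π̸ ĝ - ∇̃ ⊗̂ h`. -/
def Perturbation.tauHat {M : ℝ} (S : Perturbation M) : QTens M := fun a b =>
  piS (S.gHat a b) - qNablaHat S.h a b

/-- `tr τ = Π̸ tr g + 2 δ̃h`. -/
def Perturbation.trTau {M : ℝ} (S : Perturbation M) : Scal M :=
  piS S.trG + 2 * qDelta1 S.h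

/-- `η = r⁴ curl div (∇̸ ⊗̂ g_mix) - r² d̃(r² curl div ĝ̸)`. -/
def Perturbation.eta {M : ℝ} (S : Perturbation M) : QForm M := fun a =>
  rad ^ 4 * sCurl (sDiv2 (sNablaHat (S.gMix a)))
    - rad ^ 2 * qGrad (rad ^ 2 * sCurl (sDiv2 S.sHat)) a

/-- `σ = Π̸ tr g̸ - (4/r) h_P - 2r⁴ Δ̸ div div ĝ̸`. -/
def Perturbation.sigma {M : ℝ} (S : Perturbation M) : Scal M :=
  piS S.trS - 4 / rad * contrP S.h - 2 * rad ^ 4 * sLap0 (sDiv1 (sDiv2 S.sHat))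

/-! ### The Regge–Wheeler and Zerilli equations -/

/-- Smooth solutions of the Regge–Wheeler equation. -/
def IsReggeWheeler {M : ℝ} (Φ : Scal M) : Prop :=
  Φ ∈ LamM M ∧ qBox0 Φ + sLap0 Φ = -(6 / rad ^ 2 * (mass / rad) * Φ)

/-- Smooth solutions of the Zerilli equation. -/
def IsZerilli {M : ℝ} (Ψ : Scal M) : Prop :=
  Ψ ∈ LamM M ∧
  qBox0 Ψ + sLap0 Ψ
    = -(6 / rad ^ 2 * (mass / rad) * Ψ)
      + 24 / rad ^ 3 * (mass / rad) * (rad - 3 * mass) * zeta Ψ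
      + 72 / rad ^ 3 * (mass / rad) * (mass / rad) * (rad - 2 * mass) * zeta (zeta Ψ)

end

end LinGrav

namespace LinGrav

noncomputable section

/-! ### Calculus on the exterior -/

section Calculus

variable {M : ℝ}

/-! The tensor equations are turned into identities in one commutative ring, the ring `SF M` of
smooth functions, equipped with the derivations ∂_t, ∂_r along 𝒬 and D_i along the sphere. On 𝒬 one
uses the null frame K = ∂_t − ∂_r, N = (1+μ)∂_t + (1−μ)∂_r. There the Levi-Civita connection is
diagonal (`dq_e`): a covariant derivative acts on a component of boost weight s as K or as N +
2sM/r², and a symmetric trace-free tensor has only a KK and an NN component. On the sphere,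
Cartesian components replace covariant derivatives by D_i plus multiples of x_i.

Let Δ be the Laplacian of the unit sphere. Applying Δ(Δ+2) to the 𝒬-components, (Δ+2)div or
(Δ+2)curl to the mixed part and div div to the trace-free sphere part removes the radial 1-form k
and leaves two scalar systems, `EvenSystem` and `OddSystem`. The vanishing of tr τ is a linear
combination of two even equations. The quantities τ̂ and σ satisfy `TauSystem`, which is the even
system with the trace, mixed and trace-free sphere data set to zero.

The potentials come from elliptic equations on the spheres. In the odd case let X = r² curl(r⁻²η)
(`oddMaster`); the system expresses (Δ+2)η through X and its first derivatives, so Φ is defined by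
(2/r)(Δ+2)Φ = X. In the even case a combination X of τ̂ and σ (`master`) has the property that
Δ(Δ+2−6M/r), applied to σ and to the components of τ̂, gives explicit differential expressions in X;
Ψ is defined by 2r⁻²Δ(Δ+2−6M/r)Ψ = −X. Even and odd representation formulas and the Zerilli equation
are proved by applying to the difference of the two sides an operator that is injective on Λ; the
Regge–Wheeler equation then follows by taking the curl of the formula for η. Conversely, any
representation forces the elliptic equation, which gives uniqueness.

The analytic input is therefore the inversion of Δ + c on Λ for smooth radial c with |c| ≤ 2
(`exists_lap_add`, `eq_zero_of_lap_add`). It rests on the kernels zⁿ with z = (1+x·y)/2: since Δzⁿ⁺¹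
= (n+1)²zⁿ − (n+1)(n+2)zⁿ⁺¹, the series Σ zⁿ/n telescopes under Δ, and a modification of it gives an
operator `invLap` on C(S²) of norm at most 5/12 which inverts Δ on Λ. A Neumann series then inverts
1 + c·`invLap`, and equivariance under isometries gives smoothness of the solution. -/

theorem region_eq_prod :
    region M = Set.univ ×ˢ (Set.Ici (2 * M) ×ˢ ({0}ᶜ : Set E3)) := by
  ext p; simp [region]

theorem uniqueDiffOn_region : UniqueDiffOn ℝ (region M) := by
  rw [region_eq_prod]
  exact uniqueDiffOn_univ.prod ((uniqueDiffOn_Ici _).prod isOpen_compl_singleton.uniqueDiffOn)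

/-- This makes second derivatives symmetric also at the boundary r = 2M, where the derivatives are
one-sided: see `hess_comm`. -/
theorem region_subset_closure_interior : region M ⊆ closure (interior (region M)) := by
  rw [region_eq_prod, interior_prod_eq, interior_prod_eq, closure_prod_eq, closure_prod_eq,
    interior_Ici, closure_Ioi, isOpen_compl_singleton.interior_eq, interior_univ, closure_univ]
  exact Set.prod_mono le_rfl (Set.prod_mono le_rfl subset_closure)

/-- The point of the exterior below a point of the cone. -/
def toExt (p : ℝ × ℝ × E3) (h : p ∈ region M) : Ext M :=
  (p.1, ⟨p.2.1, Set.mem_Ici.mpr h.1⟩, ⟨‖p.2.2‖⁻¹ • p.2.2, normalize_mem h.2⟩)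

theorem lift_of_mem (f : Scal M) {p : ℝ × ℝ × E3} (h : p ∈ region M) :
    lift f p = f (toExt p h) := dif_pos h

theorem norm_sphere (x : S2) : ‖(x : E3)‖ = 1 := mem_sphere_zero_iff_norm.mp x.2

theorem incl_mem (p : Ext M) : incl p ∈ region M :=
  ⟨p.2.1.2, fun h => by
    have h1 := norm_sphere p.2.2
    rw [show (p.2.2 : E3) = 0 from h, norm_zero] at h1
    exact zero_ne_one h1⟩

theorem toExt_incl (p : Ext M) : toExt (incl p) (incl_mem p) = p := by
  have := norm_sphere p.2.2
  simp [toExt, incl, this]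

theorem lift_incl (f : Scal M) (p : Ext M) : lift f (incl p) = f p := by
  rw [lift_of_mem f (incl_mem p), toExt_incl]

theorem incl_toExt {p : ℝ × ℝ × E3} (h : p ∈ region M) :
    incl (toExt p h) = (p.1, p.2.1, ‖p.2.2‖⁻¹ • p.2.2) := rfl

theorem lift_ray (f : Scal M) {t r s : ℝ} {x : E3} (hs : 0 < s) :
    lift f (t, r, s • x) = lift f (t, r, x) := by
  unfold lift
  have h1 : ∀ y : E3, ‖s • y‖⁻¹ • s • y = ‖y‖⁻¹ • y := fun y => by
    rw [norm_smul, smul_smul, Real.norm_of_nonneg hs.le]; congr 1; field_simp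
  simp [hs.ne', h1]

theorem lift_add (f g : Scal M) : lift (f + g) = lift f + lift g := by
  ext p; simp only [lift, Pi.add_apply]; split_ifs <;> simp

theorem lift_mul (f g : Scal M) : lift (f * g) = lift f * lift g := by
  ext p; simp only [lift, Pi.mul_apply]; split_ifs <;> simp

theorem Smooth.add {f g : Scal M} (hf : Smooth f) (hg : Smooth g) : Smooth (f + g) := by
  unfold Smooth; rw [lift_add]; exact ContDiffOn.add hf hg

theorem Smooth.mul {f g : Scal M} (hf : Smooth f) (hg : Smooth g) : Smooth (f * g) := by
  unfold Smooth; rw [lift_mul]; exact ContDiffOn.mul hf hg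

theorem smooth_of_eqOn {f : Scal M} {F : ℝ × ℝ × E3 → ℝ} (hF : ContDiffOn ℝ ∞ F (region M))
    (h : ∀ p (hp : p ∈ region M), f (toExt p hp) = F p) : Smooth f :=
  hF.congr fun p hp => by rw [lift_of_mem f hp, h p hp]

theorem smooth_const (c : ℝ) : Smooth (fun _ : Ext M => c) :=
  smooth_of_eqOn contDiffOn_const fun _ _ => rfl

theorem smooth_rad : Smooth (rad : Scal M) :=
  smooth_of_eqOn (F := fun p => p.2.1) (by fun_prop) fun _ _ => rfl

theorem rad_pos (hM : 0 < M) (p : Ext M) : 0 < rad p :=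
  lt_of_lt_of_le (by positivity) p.2.1.2

theorem smooth_inv_rad (hM : 0 < M) : Smooth (rad⁻¹ : Scal M) :=
  smooth_of_eqOn (F := fun p => p.2.1⁻¹)
    (ContDiffOn.inv (by fun_prop) fun p hp => (lt_of_lt_of_le (by positivity) hp.1).ne')
    fun _ _ => rfl

theorem contDiffOn_inv_norm :
    ContDiffOn ℝ ∞ (fun p : ℝ × ℝ × E3 => ‖p.2.2‖⁻¹) (region M) := by
  refine ContDiffOn.inv (ContDiffOn.norm ℝ (by fun_prop) fun p hp => hp.2) fun p hp => ?_
  exact norm_ne_zero_iff.mpr hp.2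

theorem contDiffOn_coord (i : Fin 3) (s : Set (ℝ × ℝ × E3)) :
    ContDiffOn ℝ ∞ (fun p : ℝ × ℝ × E3 => p.2.2 i) s :=
  ((EuclideanSpace.proj (𝕜 := ℝ) i).contDiff.comp
    (contDiff_snd.comp contDiff_snd)).contDiffOn

theorem smooth_pos (i : Fin 3) : Smooth (pos i : Scal M) :=
  smooth_of_eqOn (F := fun p => ‖p.2.2‖⁻¹ * p.2.2 i)
    (contDiffOn_inv_norm.mul (contDiffOn_coord i _)) fun p hp => by simp [pos, toExt]

theorem contDiffOn_ray :
    ContDiffOn ℝ ∞ (fun p : ℝ × ℝ × E3 => (p.1, p.2.1, ‖p.2.2‖⁻¹ • p.2.2)) (region M) := by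
  have := contDiffOn_inv_norm (M := M)
  fun_prop

theorem ray_mem {p : ℝ × ℝ × E3} (hp : p ∈ region M) :
    (p.1, p.2.1, ‖p.2.2‖⁻¹ • p.2.2) ∈ region M := by
  rw [← incl_toExt hp]; exact incl_mem _

theorem Smooth.contDiffOn_fderivWithin {f : Scal M} (hf : Smooth f) :
    ContDiffOn ℝ ∞ (fderivWithin ℝ (lift f) (region M)) (region M) :=
  ContDiffOn.fderivWithin hf uniqueDiffOn_region (by simp)

theorem Smooth.hasFDerivWithinAt {f : Scal M} (hf : Smooth f) {p : ℝ × ℝ × E3}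
    (hp : p ∈ region M) :
    HasFDerivWithinAt (lift f) (fderivWithin ℝ (lift f) (region M) p) (region M) p :=
  (ContDiffOn.differentiableOn hf (by simp) p hp).hasFDerivWithinAt

theorem Smooth.dirDeriv {f : Scal M} (hf : Smooth f) (v : ℝ × ℝ × E3) :
    Smooth (dirDeriv v f) :=
  smooth_of_eqOn
    (F := fun p => fderivWithin ℝ (lift f) (region M) (p.1, p.2.1, ‖p.2.2‖⁻¹ • p.2.2) v)
    ((hf.contDiffOn_fderivWithin.comp contDiffOn_ray fun _ hp => ray_mem hp).clm_apply contDiffOn_const)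
    fun _ _ => rfl

theorem dirDeriv_add {f g : Scal M} (hf : Smooth f) (hg : Smooth g) (v : ℝ × ℝ × E3) :
    dirDeriv v (f + g) = dirDeriv v f + dirDeriv v g := by
  ext p
  have h := (hf.hasFDerivWithinAt (incl_mem p)).add (hg.hasFDerivWithinAt (incl_mem p))
  simp only [dirDeriv, lift_add, Pi.add_apply]
  rw [h.fderivWithin (uniqueDiffOn_region _ (incl_mem p))]; rfl

theorem dirDeriv_mul {f g : Scal M} (hf : Smooth f) (hg : Smooth g) (v : ℝ × ℝ × E3) :
    dirDeriv v (f * g) = f * dirDeriv v g + g * dirDeriv v f := by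
  ext p
  have h := (hf.hasFDerivWithinAt (incl_mem p)).mul (hg.hasFDerivWithinAt (incl_mem p))
  simp only [dirDeriv, lift_mul, Pi.add_apply, Pi.mul_apply]
  rw [h.fderivWithin (uniqueDiffOn_region _ (incl_mem p))]
  simp [lift_incl]

theorem dirDeriv_of_eqOn {f : Scal M} {F : ℝ × ℝ × E3 → ℝ} {F' : ℝ × ℝ × E3 →L[ℝ] ℝ} {p : Ext M}
    (h : ∀ p (hp : p ∈ region M), f (toExt p hp) = F p)
    (hF : HasFDerivWithinAt F F' (region M) (incl p)) (v : ℝ × ℝ × E3) :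
    dirDeriv v f p = F' v := by
  have h1 : HasFDerivWithinAt (lift f) F' (region M) (incl p) :=
    hF.congr (fun p hp => by rw [lift_of_mem f hp, h p hp])
      (by rw [lift_of_mem f (incl_mem p), h _ (incl_mem p)])
  simp only [dirDeriv]
  rw [h1.fderivWithin (uniqueDiffOn_region _ (incl_mem p))]

theorem dirDeriv_const (c : ℝ) (v : ℝ × ℝ × E3) :
    dirDeriv v (fun _ : Ext M => c) = 0 := by
  ext p
  rw [dirDeriv_of_eqOn (F := fun _ => c) (fun _ _ => rfl) (hasFDerivWithinAt_const _ _ _)]; rfl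

theorem dirDeriv_rad (v : ℝ × ℝ × E3) : dirDeriv v (rad : Scal M) = fun _ => v.2.1 := by
  ext p
  rw [dirDeriv_of_eqOn (F := fun p => p.2.1) (fun _ _ => rfl)
    ((ContinuousLinearMap.fst ℝ ℝ E3).comp (ContinuousLinearMap.snd ℝ ℝ (ℝ × E3))).hasFDerivWithinAt]
  rfl

theorem hasFDerivAt_norm_snd {p : ℝ × ℝ × E3} (hp : p.2.2 ≠ 0) :
    HasFDerivAt (fun p : ℝ × ℝ × E3 => ‖p.2.2‖)
      (‖p.2.2‖⁻¹ • (innerSL ℝ p.2.2).comp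
        ((ContinuousLinearMap.snd ℝ ℝ E3).comp (ContinuousLinearMap.snd ℝ ℝ (ℝ × E3)))) p := by
  have h1 : HasFDerivAt (fun p : ℝ × ℝ × E3 => p.2.2)
      ((ContinuousLinearMap.snd ℝ ℝ E3).comp (ContinuousLinearMap.snd ℝ ℝ (ℝ × E3))) p :=
    ((ContinuousLinearMap.snd ℝ ℝ E3).comp (ContinuousLinearMap.snd ℝ ℝ (ℝ × E3))).hasFDerivAt
  have h2 := h1.norm_sq.sqrt (by positivity)
  simp only [Real.sqrt_sq (norm_nonneg _)] at h2
  refine h2.congr_fderiv ?_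
  have := norm_ne_zero_iff.mpr hp
  ext v <;> simp
  field_simp

theorem dirDeriv_pos (v : ℝ × ℝ × E3) (j : Fin 3) (p : Ext M) :
    dirDeriv v (pos j : Scal M) p = v.2.2 j - inner ℝ (p.2.2 : E3) v.2.2 * pos j p := by
  have hx : ‖(incl p).2.2‖ = 1 := norm_sphere p.2.2
  have hx0 : (incl p).2.2 ≠ 0 := (incl_mem p).2
  have hc : HasFDerivAt (fun p : ℝ × ℝ × E3 => p.2.2 j) _ (incl p) :=
    ((EuclideanSpace.proj (𝕜 := ℝ) j).comp
      ((ContinuousLinearMap.snd ℝ ℝ E3).comp (ContinuousLinearMap.snd ℝ ℝ (ℝ × E3)))).hasFDerivAt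
  have h := ((hasDerivAt_inv (by rw [hx]; norm_num)).comp_hasFDerivAt _
    (hasFDerivAt_norm_snd hx0)).mul hc
  rw [dirDeriv_of_eqOn (F := fun p => ‖p.2.2‖⁻¹ * p.2.2 j)
    (fun p hp => by simp [pos, toExt]) h.hasFDerivWithinAt]
  simp [hx]
  simp [incl, pos]
  ring

theorem dS_pos (i j : Fin 3) :
    dS i (pos j : Scal M) = (if i = j then 1 else 0) - pos i * pos j := by
  ext p
  have h3 : ((if i = j then 1 else 0 : Scal M) p) = if i = j then (1 : ℝ) else 0 := by
    split_ifs <;> rfl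
  simp only [Pi.sub_apply, Pi.mul_apply, h3]
  rw [dS, dirDeriv_pos]
  simp [EuclideanSpace.inner_single_right, pos, eq_comm]

/-- The full differential of the homogeneous extension in terms of the coordinate derivatives. -/
theorem fderivWithin_lift {f : Scal M} (hf : Smooth f) {p : ℝ × ℝ × E3} (hp : p ∈ region M)
    (v : ℝ × ℝ × E3) :
    fderivWithin ℝ (lift f) (region M) p v = v.1 * lift (dQ 0 f) p + v.2.1 * lift (dQ 1 f) p
      + ‖p.2.2‖⁻¹ * ∑ i, v.2.2 i * lift (dS i f) p := by
  have hs : 0 < ‖p.2.2‖⁻¹ := inv_pos.mpr (norm_pos_iff.mpr hp.2)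
  set s := ‖p.2.2‖⁻¹
  -- The lift is invariant under this dilation of the cone, which carries p onto the unit sphere;
  -- the chain rule then transports the differential at p to a point of the exterior.
  let S : (ℝ × ℝ × E3) →L[ℝ] (ℝ × ℝ × E3) :=
    (ContinuousLinearMap.id ℝ ℝ).prodMap ((ContinuousLinearMap.id ℝ ℝ).prodMap
      (s • ContinuousLinearMap.id ℝ E3))
  have hS : ∀ q, S q = (q.1, q.2.1, s • q.2.2) := fun q => rfl
  have hSp : S p = incl (toExt p hp) := rfl
  have hmaps : Set.MapsTo S (region M) (region M) := fun q hq =>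
    ⟨hq.1, smul_ne_zero hs.ne' hq.2⟩
  have h1 := (hf.hasFDerivWithinAt (hmaps hp)).comp p S.hasFDerivWithinAt hmaps
  have h2 : lift f ∘ S = lift f := by
    ext ⟨t, r, x⟩; exact lift_ray f hs
  rw [h2] at h1
  rw [h1.fderivWithin (uniqueDiffOn_region p hp), ContinuousLinearMap.comp_apply, hSp, hS]
  rw [lift_of_mem _ hp, lift_of_mem _ hp]
  simp_rw [lift_of_mem _ hp]
  simp only [dQ, dS, dirDeriv]
  set D := fderivWithin ℝ (lift f) (region M) (incl (toExt p hp))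
  have hv : (v.1, v.2.1, s • v.2.2) = v.1 • ((1, 0, 0) : ℝ × ℝ × E3) + v.2.1 • (0, 1, 0)
      + s • ∑ i, v.2.2 i • (0, 0, EuclideanSpace.single i 1) := by
    refine Prod.ext ?_ (Prod.ext ?_ ?_)
    · simp [Prod.fst_sum]
    · simp [Prod.fst_sum, Prod.snd_sum]
    · simp only [Prod.snd_add, Prod.smul_snd, Prod.snd_sum, smul_zero, zero_add]
      congr 1
      ext j; fin_cases j <;> simp [Fin.sum_univ_three]
  rw [hv]
  simp only [map_add, map_smul, map_sum, smul_eq_mul]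
  rfl

theorem lift_dQ {f : Scal M} (hf : Smooth f) {p : ℝ × ℝ × E3} (hp : p ∈ region M) (a : Fin 2) :
    lift (dQ a f) p = fderivWithin ℝ (lift f) (region M) p
      ((![(1, 0, 0), (0, 1, 0)] : Fin 2 → ℝ × ℝ × E3) a) := by
  rw [fderivWithin_lift hf hp]
  fin_cases a <;> simp

/-- The gradient of a function homogeneous of degree 0 has degree −1, so the factor |x| is needed to
recover the extension that is constant along rays. Its derivative is the source of the commutators
in `dS_dS`. -/
theorem lift_dS {f : Scal M} (hf : Smooth f) {p : ℝ × ℝ × E3} (hp : p ∈ region M) (i : Fin 3) :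
    lift (dS i f) p = ‖p.2.2‖ * fderivWithin ℝ (lift f) (region M) p
      (0, 0, EuclideanSpace.single i 1) := by
  rw [fderivWithin_lift hf hp]
  have := norm_ne_zero_iff.mpr hp.2
  simp
  fin_cases i <;> simp <;> field_simp

/-- Euler's relation: the lift is constant along rays, so its radial derivative vanishes. -/
theorem sum_pos_mul_dS {f : Scal M} (hf : Smooth f) : ∑ i, pos i * dS i f = 0 := by
  ext p
  have hm : Set.MapsTo (fun s : ℝ => ((p.1, (p.2.1 : ℝ), s • (p.2.2 : E3)) : ℝ × ℝ × E3))
      (Set.Ioi 0) (region M) := fun s hs =>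
    ⟨p.2.1.2, smul_ne_zero (ne_of_gt hs) (incl_mem p).2⟩
  have hc : HasDerivAt (fun s : ℝ => ((p.1, (p.2.1 : ℝ), s • (p.2.2 : E3)) : ℝ × ℝ × E3))
      (0, 0, (1 : ℝ) • (p.2.2 : E3)) 1 :=
    (hasDerivAt_const _ _).prodMk ((hasDerivAt_const _ _).prodMk
      ((hasDerivAt_id' (1 : ℝ)).smul_const _))
  have h1 : HasFDerivWithinAt (lift f) (fderivWithin ℝ (lift f) (region M) (incl p)) (region M)
      (p.1, (p.2.1 : ℝ), (1 : ℝ) • (p.2.2 : E3)) := by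
    rw [one_smul]; exact hf.hasFDerivWithinAt (incl_mem p)
  have h2 := h1.comp_hasDerivWithinAt (1 : ℝ) hc.hasDerivWithinAt hm
  have h3 : HasDerivWithinAt (lift f ∘ fun s : ℝ =>
      ((p.1, (p.2.1 : ℝ), s • (p.2.2 : E3)) : ℝ × ℝ × E3)) 0 (Set.Ioi 0) 1 :=
    (hasDerivWithinAt_const _ _ (f p)).congr (fun s hs => by
      rw [Function.comp_apply, lift_ray f hs]; exact lift_incl f p)
      (by rw [Function.comp_apply, one_smul]; exact lift_incl f p)
  have h4 := (uniqueDiffOn_Ioi (0 : ℝ) 1 (by simp)).eq_deriv _ h2 h3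
  rw [fderivWithin_lift hf (incl_mem p)] at h4
  have h5 : ‖(incl p).2.2‖ = 1 := norm_sphere p.2.2
  simpa [h5, lift_incl, pos] using h4

/-- The second differential of the homogeneous extension. -/
def hess (f : Scal M) (p : Ext M) (u v : ℝ × ℝ × E3) : ℝ :=
  fderivWithin ℝ (fderivWithin ℝ (lift f) (region M)) (region M) (incl p) u v

theorem hess_comm {f : Scal M} (hf : Smooth f) (p : Ext M) (u v : ℝ × ℝ × E3) :
    hess f p u v = hess f p v u :=
  ContDiffWithinAt.isSymmSndFDerivWithinAt (hf (incl p) (incl_mem p)) 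
    (by rw [minSmoothness_of_isRCLikeNormedField]; exact ENat.LEInfty.out)
    uniqueDiffOn_region (region_subset_closure_interior (incl_mem p)) (incl_mem p) u v

theorem hasFDerivWithinAt_fderivWithin_apply {f : Scal M} (hf : Smooth f) (p : Ext M)
    (v : ℝ × ℝ × E3) :
    HasFDerivWithinAt (fun q => fderivWithin ℝ (lift f) (region M) q v)
      ((fderivWithin ℝ (fderivWithin ℝ (lift f) (region M)) (region M) (incl p)).flip v)
      (region M) (incl p) := by
  have h := (hf.contDiffOn_fderivWithin.differentiableOn (by simp) (incl p) (incl_mem p)).hasFDerivWithinAt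
  have := h.clm_apply (hasFDerivWithinAt_const v (incl p) (region M))
  exact this.congr_fderiv (by ext <;> simp)

theorem dirDeriv_dQ {f : Scal M} (hf : Smooth f) (a : Fin 2) (v : ℝ × ℝ × E3) (p : Ext M) :
    dirDeriv v (dQ a f) p
      = hess f p v ((![(1, 0, 0), (0, 1, 0)] : Fin 2 → ℝ × ℝ × E3) a) := by
  rw [dirDeriv_of_eqOn (fun q hq => by rw [← lift_of_mem (dQ a f) hq, lift_dQ hf hq])
    (hasFDerivWithinAt_fderivWithin_apply hf p _)]
  rfl

theorem dirDeriv_dS {f : Scal M} (hf : Smooth f) (i : Fin 3) (v : ℝ × ℝ × E3) (p : Ext M) :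
    dirDeriv v (dS i f) p = hess f p v (0, 0, EuclideanSpace.single i 1)
      + inner ℝ (p.2.2 : E3) v.2.2 * dS i f p := by
  have hx : ‖(incl p).2.2‖ = 1 := norm_sphere p.2.2
  have h := (hasFDerivAt_norm_snd (incl_mem p).2).hasFDerivWithinAt.mul
    (hasFDerivWithinAt_fderivWithin_apply hf p (0, 0, EuclideanSpace.single i 1))
  rw [dirDeriv_of_eqOn (fun q hq => by
    rw [← lift_of_mem (dS i f) hq, lift_dS hf hq]; rfl) h]
  simp [hess, dS, dirDeriv, incl, mul_comm]

theorem dQ_comm {f : Scal M} (hf : Smooth f) (a b : Fin 2) : dQ a (dQ b f) = dQ b (dQ a f) := by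
  ext p
  rw [show dQ a (dQ b f) p = _ from dirDeriv_dQ hf b _ p,
    show dQ b (dQ a f) p = _ from dirDeriv_dQ hf a _ p, hess_comm hf]

theorem dS_dQ {f : Scal M} (hf : Smooth f) (i : Fin 3) (a : Fin 2) :
    dS i (dQ a f) = dQ a (dS i f) := by
  ext p
  rw [show dS i (dQ a f) p = _ from dirDeriv_dQ hf a _ p,
    show dQ a (dS i f) p = _ from dirDeriv_dS hf i _ p, hess_comm hf]
  fin_cases a <;> simp

/-- The second differential of the lift is symmetric, so only the derivative of the factor |x| from
`lift_dS` contributes. The fields D_i are the tangential projections of the Cartesian fields, and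
these do not commute. -/
theorem dS_dS {f : Scal M} (hf : Smooth f) (i j : Fin 3) :
    dS i (dS j f) = dS j (dS i f) + pos i * dS j f - pos j * dS i f := by
  ext p
  simp only [Pi.add_apply, Pi.sub_apply, Pi.mul_apply]
  rw [show dS i (dS j f) p = _ from dirDeriv_dS hf j _ p,
    show dS j (dS i f) p = _ from dirDeriv_dS hf i _ p, hess_comm hf]
  simp [EuclideanSpace.inner_single_right, pos]
  ring

/-- The algebra of smooth functions on the exterior. -/
def smoothAlg (M : ℝ) : Subalgebra ℝ (Scal M) where
  carrier := {f | Smooth f}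
  mul_mem' := Smooth.mul
  add_mem' := Smooth.add
  algebraMap_mem' c := smooth_const c

/-- Smooth functions on the exterior. -/
def SF (M : ℝ) : Type := smoothAlg M

instance SF.instCommRing : CommRing (SF M) := inferInstanceAs (CommRing (smoothAlg M))

instance SF.instAlgebra : Algebra ℝ (SF M) := inferInstanceAs (Algebra ℝ (smoothAlg M))

/-- The underlying function. -/
def SF.val (f : SF M) : Scal M := Subtype.val f

instance SF.instCoe : CoeOut (SF M) (Scal M) := ⟨SF.val⟩

@[ext] theorem SF.ext {f g : SF M} (h : (f : Scal M) = g) : f = g := Subtype.ext h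

theorem SF.smooth (f : SF M) : Smooth (f : Scal M) := f.2

/-- The coordinate derivative in the direction `v`, as a derivation. -/
def derivDir (v : ℝ × ℝ × E3) : Derivation ℝ (SF M) (SF M) :=
  Derivation.mk'
    { toFun := fun f => ⟨dirDeriv v f, f.smooth.dirDeriv v⟩
      map_add' := fun f g => SF.ext (dirDeriv_add f.smooth g.smooth v)
      map_smul' := fun c f => SF.ext (by
        have h := dirDeriv_mul (smooth_const c) f.smooth v
        rw [dirDeriv_const, mul_zero, add_zero] at h
        exact h) }
    (fun f g => SF.ext (dirDeriv_mul f.smooth g.smooth v))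

/-! ### The derivations of the ring of smooth functions and their relations. -/

namespace SF

/-- `∂/∂t*`. -/
def T : Derivation ℝ (SF M) (SF M) := derivDir (1, 0, 0)
/-- `∂/∂r`. -/
def R : Derivation ℝ (SF M) (SF M) := derivDir (0, 1, 0)
/-- The Cartesian components of the tangential gradient along the unit sphere. -/
def D (i : Fin 3) : Derivation ℝ (SF M) (SF M) := derivDir (0, 0, EuclideanSpace.single i 1)
/-- The Cartesian coordinates on the unit sphere. -/
def x (i : Fin 3) : SF M := ⟨pos i, smooth_pos i⟩
/-- The area radius. -/
def r : SF M := ⟨rad, smooth_rad⟩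
/-- The mass. -/
def m : SF M := algebraMap ℝ (SF M) M
/-- The inverse of the area radius. -/
def w [hM : Fact (0 < M)] : SF M := ⟨rad⁻¹, smooth_inv_rad hM.out⟩

theorem coe_D (i : Fin 3) (f : SF M) : ((D i f : SF M) : Scal M) = dS i (f : Scal M) := rfl
theorem coe_x (i : Fin 3) : ((x i : SF M) : Scal M) = pos i := rfl

theorem T_R (f : SF M) : T (R f) = R (T f) := SF.ext (dQ_comm f.smooth 0 1)
theorem D_T (i : Fin 3) (f : SF M) : D i (T f) = T (D i f) := SF.ext (dS_dQ f.smooth i 0)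
theorem D_R (i : Fin 3) (f : SF M) : D i (R f) = R (D i f) := SF.ext (dS_dQ f.smooth i 1)
theorem D_D (i j : Fin 3) (f : SF M) : D i (D j f) = D j (D i f) + x i * D j f - x j * D i f :=
  SF.ext (dS_dS f.smooth i j)
theorem D_x (i j : Fin 3) : D i (x j) = (if i = j then 1 else 0) - x i * (x j : SF M) :=
  SF.ext (by rw [coe_D, coe_x, dS_pos]; split_ifs <;> rfl)
theorem x_D (f : SF M) : x 0 * D 0 f + x 1 * D 1 f + x 2 * D 2 f = 0 :=
  SF.ext (by have := sum_pos_mul_dS f.smooth; rwa [Fin.sum_univ_three] at this)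
theorem x_sq : x 0 * x 0 + x 1 * x 1 + x 2 * x 2 = (1 : SF M) := SF.ext (by
  funext p
  have h := norm_sphere p.2.2
  rw [EuclideanSpace.norm_eq, Real.sqrt_eq_one] at h
  simp only [Fin.sum_univ_three, Real.norm_eq_abs, sq_abs] at h
  simp only [pow_two] at h
  exact h)

theorem T_r : T (r : SF M) = 0 := SF.ext (dirDeriv_rad _)
theorem R_r : R (r : SF M) = 1 := SF.ext (dirDeriv_rad _)

theorem r_mul_w [hM : Fact (0 < M)] : r * w = (1 : SF M) := SF.ext (by
  funext p
  exact mul_inv_cancel₀ (rad_pos hM.out p).ne')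

theorem deriv_w [Fact (0 < M)] (d : Derivation ℝ (SF M) (SF M)) :
    d w = -(w * w * d r) := by
  have h : d (r * w) = 0 := by rw [r_mul_w, Derivation.map_one_eq_zero]
  rw [Derivation.leibniz, smul_eq_mul, smul_eq_mul] at h
  linear_combination w * h - d w * r_mul_w (M := M)

theorem T_w [Fact (0 < M)] : T (w : SF M) = 0 := by rw [deriv_w, T_r, mul_zero, neg_zero]
theorem R_w [Fact (0 < M)] : R (w : SF M) = -(w * w) := by rw [deriv_w, R_r, mul_one]
theorem T_x (i : Fin 3) : T (x i : SF M) = 0 := SF.ext (by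
  funext p
  refine (dirDeriv_pos _ i p).trans ?_
  simp only [PiLp.zero_apply, inner_zero_right, zero_mul, sub_self]
  rfl)
theorem R_x (i : Fin 3) : R (x i : SF M) = 0 := SF.ext (by
  funext p
  refine (dirDeriv_pos _ i p).trans ?_
  simp only [PiLp.zero_apply, inner_zero_right, zero_mul, sub_self]
  rfl)

end SF

end Calculus

end

end LinGrav

namespace LinGrav

noncomputable section

/-! ### Tensor calculus on the unit sphere in Cartesian components -/

/-- A commutative algebra with the derivations `D i` along the unit sphere and the Cartesian
coordinates `x i`. -/
structure SphereCalculus (A : Type*) [CommRing A] [Algebra ℝ A] where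
  D : Fin 3 → Derivation ℝ A A
  x : Fin 3 → A
  x_sq : x 0 * x 0 + x 1 * x 1 + x 2 * x 2 = 1
  D_x : ∀ i j, D i (x j) = (if i = j then 1 else 0) - x i * x j
  x_D : ∀ f, x 0 * D 0 f + x 1 * D 1 f + x 2 * D 2 f = 0
  comm : ∀ i j f, D i (D j f) = D j (D i f) + x i * D j f - x j * D i f

namespace SphereCalculus

variable {A : Type*} [CommRing A]

theorem sum_delta (k : Fin 3) (F : Fin 3 → A) :
    (if 0 = k then 1 else 0) * F 0 + (if 1 = k then 1 else 0) * F 1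
      + (if 2 = k then 1 else 0) * F 2 = F k := by
  fin_cases k <;> simp

theorem sum_delta' (k : Fin 3) (F : Fin 3 → A) :
    (if k = 0 then 1 else 0) * F 0 + (if k = 1 then 1 else 0) * F 1
      + (if k = 2 then 1 else 0) * F 2 = F k := by
  fin_cases k <;> simp

variable [Algebra ℝ A] (S : SphereCalculus A)

/-- The Laplacian on functions. -/
def lap (f : A) : A := S.D 0 (S.D 0 f) + S.D 1 (S.D 1 f) + S.D 2 (S.D 2 f)

/-- The divergence of a tangential 1-form. -/
def div (ξ : Fin 3 → A) : A := S.D 0 (ξ 0) + S.D 1 (ξ 1) + S.D 2 (ξ 2)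

/-- The curl of a 1-form. -/
def curl (ξ : Fin 3 → A) : A :=
  S.x 0 * (S.D 1 (ξ 2) - S.D 2 (ξ 1)) + S.x 1 * (S.D 2 (ξ 0) - S.D 0 (ξ 2))
    + S.x 2 * (S.D 0 (ξ 1) - S.D 1 (ξ 0))

/-- Tangentiality of a 1-form. -/
def Tan (ξ : Fin 3 → A) : Prop := S.x 0 * ξ 0 + S.x 1 * ξ 1 + S.x 2 * ξ 2 = 0

variable {S}

/-- Differentiate x·ξ = 0. The normal part of D_i ξ is thus of order zero in ξ, which is why
projecting it away costs only algebraic terms. -/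
theorem Tan.sum_x_D {ξ : Fin 3 → A} (h : S.Tan ξ) (i : Fin 3) :
    S.x 0 * S.D i (ξ 0) + S.x 1 * S.D i (ξ 1) + S.x 2 * S.D i (ξ 2) = -ξ i := by
  have h1 := congrArg (S.D i) h
  simp only [map_add, Derivation.leibniz, smul_eq_mul, S.D_x, map_zero] at h1
  have h2 := sum_delta' i ξ
  have h3 : S.x 0 * ξ 0 + S.x 1 * ξ 1 + S.x 2 * ξ 2 = 0 := h
  linear_combination h1 - h2 + S.x i * h3

variable (S)

theorem tan_grad (f : A) : S.Tan (fun i => S.D i f) := S.x_D f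

theorem sum_x_D_D (k : Fin 3) (f : A) :
    S.x 0 * S.D k (S.D 0 f) + S.x 1 * S.D k (S.D 1 f) + S.x 2 * S.D k (S.D 2 f) = -S.D k f :=
  (S.tan_grad f).sum_x_D k

theorem lap_add (f g : A) : S.lap (f + g) = S.lap f + S.lap g := by
  simp only [lap, map_add]; ring

theorem lap_zero : S.lap 0 = 0 := by simp [lap]

theorem sum_D_x_D (k : Fin 3) (g : A) :
    S.D 0 (S.x k) * S.D 0 g + S.D 1 (S.x k) * S.D 1 g + S.D 2 (S.x k) * S.D 2 g = S.D k g := by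
  simp only [S.D_x]
  linear_combination sum_delta k (fun i => S.D i g) - S.x k * S.x_D g

theorem lap_mul (f g : A) : S.lap (f * g) = f * S.lap g + g * S.lap f
    + 2 * (S.D 0 f * S.D 0 g + S.D 1 f * S.D 1 g + S.D 2 f * S.D 2 g) := by
  simp only [lap, Derivation.leibniz, map_add, smul_eq_mul]; ring

theorem lap_x (k : Fin 3) : S.lap (S.x k) = -2 * S.x k := by
  have h1 := S.x_sq
  have h2 := fun i => S.x_D (S.x i)
  simp only [lap, S.D_x, map_sub, Derivation.leibniz, smul_eq_mul]
  have h3 : ∀ i : Fin 3, S.D i (if i = k then 1 else 0) = 0 := fun i => by split_ifs <;> simp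
  simp only [h3]
  simp only [if_true]
  linear_combination 2 * S.x k * h1 - sum_delta k S.x

/-- D_k is moved out through both derivatives of the Laplacian with the commutator rule; the terms
that remain are collected with x·∇f = 0, its derivative and |x|² = 1. -/
theorem lap_D (k : Fin 3) (f : A) :
    S.lap (S.D k f) = S.D k (S.lap f) - 2 * S.x k * S.lap f := by
  have h : ∀ i, S.D i (S.D i (S.D k f)) = S.D k (S.D i (S.D i f)) + S.x i * S.D k (S.D i f)
      - 2 * S.x k * S.D i (S.D i f) + (1 - S.x i * S.x i) * S.D k f + S.x i * S.D i (S.D k f)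
      - ((if i = k then 1 else 0) - S.x i * S.x k) * S.D i f := by
    intro i
    rw [S.comm i k f]
    simp only [map_sub, map_add, Derivation.leibniz, smul_eq_mul, S.D_x, if_true]
    rw [S.comm i k (S.D i f), S.comm i k f]
    ring
  simp only [lap, h, map_add]
  linear_combination S.sum_x_D_D k f + S.x_D (S.D k f) - sum_delta k (fun i => S.D i f)
    + S.x k * S.x_D f - S.D k f * S.x_sq

theorem div_mul_x (φ : A) : S.div (fun k => S.x k * φ) = 2 * φ := by
  simp only [div, Derivation.leibniz, smul_eq_mul, S.D_x, if_true]
  linear_combination S.x_D φ - φ * S.x_sq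

theorem div_add (ξ η : Fin 3 → A) : S.div (fun k => ξ k + η k) = S.div ξ + S.div η := by
  simp only [div, map_add]; ring

theorem curl_add (ξ η : Fin 3 → A) : S.curl (fun k => ξ k + η k) = S.curl ξ + S.curl η := by
  simp only [curl, map_add]; ring

theorem div_mul (c : A) (hc : ∀ i, S.D i c = 0) (ξ : Fin 3 → A) :
    S.div (fun k => c * ξ k) = c * S.div ξ := by
  simp only [div, Derivation.leibniz, smul_eq_mul, hc]; ring

theorem curl_mul (c : A) (hc : ∀ i, S.D i c = 0) (ξ : Fin 3 → A) :
    S.curl (fun k => c * ξ k) = c * S.curl ξ := by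
  simp only [curl, Derivation.leibniz, smul_eq_mul, hc]; ring

theorem curl_mul_x (φ : A) : S.curl (fun k => S.x k * φ) = 0 := by
  simp only [curl, Derivation.leibniz, smul_eq_mul, S.D_x]
  simp only [Fin.reduceEq, if_false]
  ring

variable {S} in
theorem Tan.sum_x_lap {ξ : Fin 3 → A} (h : S.Tan ξ) :
    S.x 0 * S.lap (ξ 0) + S.x 1 * S.lap (ξ 1) + S.x 2 * S.lap (ξ 2) = -2 * S.div ξ := by
  have h1 := congrArg S.lap h
  simp only [lap_add, lap_mul, S.lap_x, lap_zero, S.sum_D_x_D] at h1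
  have h3 : S.x 0 * ξ 0 + S.x 1 * ξ 1 + S.x 2 * ξ 2 = 0 := h
  simp only [div]
  linear_combination h1 + 2 * h3

-- Moving D_k past the Laplacian leaves 2 x·Δξ, and `Tan.sum_x_lap` evaluates this normal part as −4
-- div ξ.
variable {S} in
theorem Tan.div_lap {ξ : Fin 3 → A} (h : S.Tan ξ) :
    S.div (fun k => S.lap (ξ k)) = S.lap (S.div ξ) - 4 * S.div ξ := by
  have h1 := h.sum_x_lap
  have h2 : ∀ k, S.D k (S.lap (ξ k)) = S.lap (S.D k (ξ k)) + 2 * S.x k * S.lap (ξ k) := fun k => by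
    rw [S.lap_D]; ring
  have h3 : S.lap (S.div ξ) = S.lap (S.D 0 (ξ 0)) + S.lap (S.D 1 (ξ 1)) + S.lap (S.D 2 (ξ 2)) := by
    rw [div, lap_add, lap_add]
  rw [h3, div, h2, h2, h2]
  linear_combination 2 * h1

/-- The fields x_i D_j − x_j D_i generate rotations, so they commute with the Laplacian. -/
theorem lap_rot (i j : Fin 3) (f : A) :
    S.lap (S.x i * S.D j f - S.x j * S.D i f)
      = S.x i * S.D j (S.lap f) - S.x j * S.D i (S.lap f) := by
  have h := S.lap_add (S.x i * S.D j f - S.x j * S.D i f) (S.x j * S.D i f)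
  rw [sub_add_cancel, lap_mul, lap_mul, S.lap_x, S.lap_x, S.sum_D_x_D, S.sum_D_x_D, S.lap_D,
    S.lap_D] at h
  have h2 := S.comm i j f
  linear_combination -h + 2 * h2

/-- The curl is a sum of rotation fields applied to the single components, and each of these
commutes with the Laplacian. Tangentiality plays no role. -/
theorem curl_lap (ξ : Fin 3 → A) :
    S.curl (fun k => S.lap (ξ k)) = S.lap (S.curl ξ) := by
  have h : S.curl ξ = (S.x 1 * S.D 2 (ξ 0) - S.x 2 * S.D 1 (ξ 0))
      + (S.x 2 * S.D 0 (ξ 1) - S.x 0 * S.D 2 (ξ 1))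
      + (S.x 0 * S.D 1 (ξ 2) - S.x 1 * S.D 0 (ξ 2)) := by rw [curl]; ring
  rw [h, lap_add, lap_add, lap_rot, lap_rot, lap_rot, curl]; ring

/-! #### Covariant derivatives -/

/-- The projection onto the tangent plane. -/
def proj (i j : Fin 3) : A := (if i = j then 1 else 0) - S.x i * S.x j

variable {S}

theorem Tan.proj_sum {ξ : Fin 3 → A} (h : S.Tan ξ) (j : Fin 3) :
    ∑ b, S.proj j b * ξ b = ξ j := by
  have h3 : S.x 0 * ξ 0 + S.x 1 * ξ 1 + S.x 2 * ξ 2 = 0 := h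
  simp only [Fin.sum_univ_three, proj]
  linear_combination sum_delta' j ξ - S.x j * h3

/-- By `Tan.sum_x_D` the normal component of D_i ξ is −ξ_i, so the projection adds exactly x_j ξ_i.
-/
theorem Tan.proj_D {ξ : Fin 3 → A} (h : S.Tan ξ) (i j : Fin 3) :
    ∑ b, S.proj j b * S.D i (ξ b) = S.D i (ξ j) + S.x j * ξ i := by
  simp only [Fin.sum_univ_three, proj]
  linear_combination sum_delta' j (fun b => S.D i (ξ b)) - S.x j * h.sum_x_D i

theorem proj_D₂ {θ : Fin 3 → Fin 3 → A} (h1 : ∀ k, S.Tan (fun j => θ j k))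
    (h2 : ∀ j, S.Tan (θ j)) (i j k : Fin 3) :
    ∑ b, ∑ c, S.proj j b * S.proj k c * S.D i (θ b c)
      = S.D i (θ j k) + S.x j * θ i k + S.x k * θ j i := by
  have e : ∀ b, ∑ c, S.proj j b * S.proj k c * S.D i (θ b c)
      = S.proj j b * S.D i (θ b k) + S.x k * (S.proj j b * θ b i) := fun b => by
    simp only [mul_assoc]
    rw [← Finset.mul_sum, (h2 b).proj_D]; ring
  simp only [e, Finset.sum_add_distrib, ← Finset.mul_sum]
  rw [(h1 k).proj_D, (h1 i).proj_sum]

theorem proj_D₃ {U : Fin 3 → Fin 3 → Fin 3 → A} (h1 : ∀ k l, S.Tan (fun j => U j k l))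
    (h2 : ∀ j l, S.Tan (fun k => U j k l)) (h3 : ∀ j k, S.Tan (U j k)) (i j k l : Fin 3) :
    ∑ b, ∑ c, ∑ d, S.proj j b * S.proj k c * S.proj l d * S.D i (U b c d)
      = S.D i (U j k l) + S.x j * U i k l + S.x k * U j i l + S.x l * U j k i := by
  have e : ∀ b, ∑ c, ∑ d, S.proj j b * S.proj k c * S.proj l d * S.D i (U b c d)
      = S.proj j b * S.D i (U b k l) + S.x k * (S.proj j b * U b i l)
        + S.x l * (S.proj j b * U b k i) := fun b => by
    simp only [mul_assoc]
    simp only [← Finset.mul_sum]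
    have := proj_D₂ (fun d => h2 b d) (fun c => h3 b c) i k l
    simp only [mul_assoc] at this
    simp only [← Finset.mul_sum] at this
    rw [this]; ring
  simp only [e, Finset.sum_add_distrib, ← Finset.mul_sum]
  rw [(h1 k l).proj_D, (h1 i l).proj_sum, (h1 k i).proj_sum]

variable (S)

/-- The covariant derivative of a tangential 1-form. -/
def nab (ξ : Fin 3 → A) (i j : Fin 3) : A := S.D i (ξ j) + S.x j * ξ i

/-- The covariant derivative of a tangential 2-tensor. -/
def nab₂ (θ : Fin 3 → Fin 3 → A) (i j k : Fin 3) : A :=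
  S.D i (θ j k) + S.x j * θ i k + S.x k * θ j i

variable {S}

theorem Tan.nab_left {ξ : Fin 3 → A} (h : S.Tan ξ) (k : Fin 3) :
    S.Tan (fun j => S.nab ξ j k) := by
  have h3 : S.x 0 * ξ 0 + S.x 1 * ξ 1 + S.x 2 * ξ 2 = 0 := h
  simp only [Tan, nab]
  linear_combination S.x_D (ξ k) + S.x k * h3

theorem Tan.nab_right {ξ : Fin 3 → A} (h : S.Tan ξ) (k : Fin 3) : S.Tan (S.nab ξ k) := by
  simp only [Tan, nab]
  linear_combination h.sum_x_D k + ξ k * S.x_sq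

theorem nab₂_left {θ : Fin 3 → Fin 3 → A} (h1 : ∀ k, S.Tan (fun j => θ j k))
    (h2 : ∀ j, S.Tan (θ j)) (k l : Fin 3) : S.Tan (fun j => S.nab₂ θ j k l) := by
  have e1 : S.x 0 * θ 0 l + S.x 1 * θ 1 l + S.x 2 * θ 2 l = 0 := h1 l
  have e2 : S.x 0 * θ k 0 + S.x 1 * θ k 1 + S.x 2 * θ k 2 = 0 := h2 k
  simp only [Tan, nab₂]
  linear_combination S.x_D (θ k l) + S.x k * e1 + S.x l * e2

theorem nab₂_mid {θ : Fin 3 → Fin 3 → A} (h1 : ∀ k, S.Tan (fun j => θ j k))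
    (j l : Fin 3) : S.Tan (fun k => S.nab₂ θ j k l) := by
  have e1 : S.x 0 * θ 0 j + S.x 1 * θ 1 j + S.x 2 * θ 2 j = 0 := h1 j
  have e2 := (h1 l).sum_x_D j
  simp only [Tan, nab₂]
  linear_combination e2 + S.x l * e1 + θ j l * S.x_sq

theorem nab₂_right {θ : Fin 3 → Fin 3 → A} (h2 : ∀ j, S.Tan (θ j))
    (j k : Fin 3) : S.Tan (S.nab₂ θ j k) := by
  have e1 : S.x 0 * θ j 0 + S.x 1 * θ j 1 + S.x 2 * θ j 2 = 0 := h2 j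
  have e2 := (h2 k).sum_x_D j
  simp only [Tan, nab₂]
  linear_combination e2 + S.x k * e1 + θ k j * S.x_sq

theorem Tan.tr_nab {ξ : Fin 3 → A} (h : S.Tan ξ) :
    S.nab ξ 0 0 + S.nab ξ 1 1 + S.nab ξ 2 2 = S.div ξ := by
  have h3 : S.x 0 * ξ 0 + S.x 1 * ξ 1 + S.x 2 * ξ 2 = 0 := h
  simp only [nab, div]
  linear_combination h3

theorem curl_nab (ξ : Fin 3 → A) :
    S.x 0 * (S.nab ξ 1 2 - S.nab ξ 2 1) + S.x 1 * (S.nab ξ 2 0 - S.nab ξ 0 2)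
      + S.x 2 * (S.nab ξ 0 1 - S.nab ξ 1 0) = S.curl ξ := by
  simp only [nab, curl]; ring

variable (S) in
/-- The divergence `D_i θ_{ik}` of a trace-free 2-tensor. -/
def div₂ (θ : Fin 3 → Fin 3 → A) (k : Fin 3) : A := S.div (fun i => θ i k)

theorem tr_nab₂ {θ : Fin 3 → Fin 3 → A} (h1 : ∀ k, S.Tan (fun j => θ j k))
    (htr : θ 0 0 + θ 1 1 + θ 2 2 = 0) (k : Fin 3) :
    S.nab₂ θ 0 0 k + S.nab₂ θ 1 1 k + S.nab₂ θ 2 2 k = S.div₂ θ k := by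
  have h3 : S.x 0 * θ 0 k + S.x 1 * θ 1 k + S.x 2 * θ 2 k = 0 := h1 k
  simp only [nab₂, div₂, div]
  linear_combination h3 + S.x k * htr

theorem tan_div₂ {θ : Fin 3 → Fin 3 → A} (h2 : ∀ j, S.Tan (θ j))
    (htr : θ 0 0 + θ 1 1 + θ 2 2 = 0) : S.Tan (S.div₂ θ) := by
  have e := fun i => (h2 i).sum_x_D i
  simp only [Tan, div₂, div]
  linear_combination e 0 + e 1 + e 2 - htr

/-- The connection Laplacian on 1-forms. -/
theorem Tan.lap_form {ξ : Fin 3 → A} (h : S.Tan ξ) (k : Fin 3) :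
    S.nab₂ (S.nab ξ) 0 0 k + S.nab₂ (S.nab ξ) 1 1 k + S.nab₂ (S.nab ξ) 2 2 k
      = S.lap (ξ k) + ξ k + 2 * (S.x k * S.div ξ) := by
  have e1 := h.tr_nab
  have e2 : S.x 0 * S.nab ξ 0 k + S.x 1 * S.nab ξ 1 k + S.x 2 * S.nab ξ 2 k = 0 := h.nab_left k
  have h3 : S.x 0 * ξ 0 + S.x 1 * ξ 1 + S.x 2 * ξ 2 = 0 := h
  have e3 : S.D 0 (S.nab ξ 0 k) + S.D 1 (S.nab ξ 1 k) + S.D 2 (S.nab ξ 2 k)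
      = S.lap (ξ k) + ξ k + S.x k * S.div ξ := by
    simp only [nab, lap, div, map_add, Derivation.leibniz, smul_eq_mul, S.D_x]
    linear_combination sum_delta k ξ - S.x k * h3
  simp only [nab₂]
  linear_combination e3 + e2 + S.x k * e1

/-- The connection Laplacian on symmetric trace-free 2-tensors. -/
theorem lap_tensor {θ : Fin 3 → Fin 3 → A} (h1 : ∀ k, S.Tan (fun j => θ j k))
    (hs : ∀ i j, θ i j = θ j i) (htr : θ 0 0 + θ 1 1 + θ 2 2 = 0) (k l : Fin 3) :
    (∑ i, (S.D i (S.nab₂ θ i k l) + S.x i * S.nab₂ θ i k l + S.x k * S.nab₂ θ i i l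
      + S.x l * S.nab₂ θ i k i))
      = S.lap (θ k l) + 2 * θ k l + 2 * (S.x k * S.div₂ θ l) + 2 * (S.x l * S.div₂ θ k) := by
  have h2 : ∀ j, S.Tan (θ j) := fun j => by
    have := h1 j; simp only [Tan, hs _ j] at this; exact this
  have e1 := tr_nab₂ h1 htr l
  have e1' := tr_nab₂ h1 htr k
  have e2 : S.x 0 * S.nab₂ θ 0 k l + S.x 1 * S.nab₂ θ 1 k l + S.x 2 * S.nab₂ θ 2 k l = 0 :=
    nab₂_left h1 h2 k l
  have e4 : ∀ i, S.nab₂ θ i k i = S.nab₂ θ i i k := fun i => by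
    simp only [nab₂]; rw [hs k i, hs i i]; ring
  have hk : S.x 0 * θ 0 k + S.x 1 * θ 1 k + S.x 2 * θ 2 k = 0 := h1 k
  have hl : S.x 0 * θ 0 l + S.x 1 * θ 1 l + S.x 2 * θ 2 l = 0 := h1 l
  have e3 : S.D 0 (S.nab₂ θ 0 k l) + S.D 1 (S.nab₂ θ 1 k l) + S.D 2 (S.nab₂ θ 2 k l)
      = S.lap (θ k l) + 2 * θ k l + S.x k * S.div₂ θ l + S.x l * S.div₂ θ k := by
    simp only [nab₂, lap, div, div₂, map_add, Derivation.leibniz, smul_eq_mul, S.D_x, hs k 0,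
      hs k 1, hs k 2]
    linear_combination sum_delta k (fun i => θ i l) + sum_delta l (fun i => θ i k) - S.x k * hl
      - S.x l * hk + hs l k
  simp only [Fin.sum_univ_three, e4]
  linear_combination e3 + e2 + S.x k * e1 + S.x l * e1'

/-- The divergence of the conformal Killing operator. -/
theorem Tan.div_conformal {ξ : Fin 3 → A} (h : S.Tan ξ) (k : Fin 3) :
    S.div₂ (fun i j => S.nab ξ i j + S.nab ξ j i - S.proj i j * S.div ξ) k
      = S.lap (ξ k) + 2 * ξ k + 2 * (S.x k * S.div ξ) := by
  have h3 : S.x 0 * ξ 0 + S.x 1 * ξ 1 + S.x 2 * ξ 2 = 0 := h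
  have c := fun i => S.comm i k (ξ i)
  have e1 : S.D k (S.div ξ) = S.D k (S.D 0 (ξ 0)) + S.D k (S.D 1 (ξ 1)) + S.D k (S.D 2 (ξ 2)) := by
    simp only [div, map_add]
  have e2 := h.sum_x_D k
  have hd : ∀ i : Fin 3, S.D i (if i = k then 1 else 0) = 0 := fun i => by split_ifs <;> simp
  have e5 := sum_delta k (fun i => S.D i (S.div ξ))
  have e6 := S.x_D (S.div ξ)
  simp only [div₂, div] at e5 e6 ⊢
  simp only [nab, proj, lap, map_add, map_sub, Derivation.leibniz, smul_eq_mul, S.D_x, hd,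
    if_true] at e5 e6 ⊢
  rw [c 0, c 1, c 2]
  have e8 := sum_delta k S.x
  linear_combination sum_delta k ξ - S.x k * h3 + e2 - e5 + S.x k * e6
    + (S.D 0 (ξ 0) + S.D 1 (ξ 1) + S.D 2 (ξ 2)) * (e8 - 2 * S.x k * S.x_sq)
    + S.x_D (ξ k) - ξ k * S.x_sq

variable (S) in
theorem D_two (i : Fin 3) : S.D i 2 = 0 := by simpa using Derivation.map_natCast (S.D i) 2

/-- The expression Δξ + cξ + 2x div ξ occurs with c = 1 as the connection Laplacian on 1-forms, with
c = 2 as the divergence of the conformal Killing operator, and with c = 4 after one divergence of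
the tensor Laplacian. The normal term compensates the −4 div ξ of `Tan.div_lap`, so div carries it
to Δ + c. -/
theorem Tan.div_lap_add {ξ : Fin 3 → A} (h : S.Tan ξ) (c : ℕ) :
    S.div (fun k => S.lap (ξ k) + c * ξ k + 2 * (S.x k * S.div ξ))
      = S.lap (S.div ξ) + c * S.div ξ := by
  rw [S.div_add, S.div_add, h.div_lap, S.div_mul c (by simp), S.div_mul 2 S.D_two, S.div_mul_x]
  ring

theorem curl_lap_add (ξ : Fin 3 → A) (φ : A) (c : ℕ) :
    S.curl (fun k => S.lap (ξ k) + c * ξ k + 2 * (S.x k * φ))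
      = S.lap (S.curl ξ) + c * S.curl ξ := by
  rw [S.curl_add, S.curl_add, S.curl_lap, S.curl_mul c (by simp),
    S.curl_mul 2 S.D_two, S.curl_mul_x]
  ring

/-- The divergence of the connection Laplacian of a symmetric trace-free 2-tensor. -/
theorem div₂_lap_tensor {θ : Fin 3 → Fin 3 → A} (h1 : ∀ k, S.Tan (fun j => θ j k))
    (hs : ∀ i j, θ i j = θ j i) (htr : θ 0 0 + θ 1 1 + θ 2 2 = 0) (l : Fin 3) :
    S.div₂ (fun k l => S.lap (θ k l) + 2 * θ k l + 2 * (S.x k * S.div₂ θ l)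
      + 2 * (S.x l * S.div₂ θ k)) l
      = S.lap (S.div₂ θ l) + 4 * S.div₂ θ l + 2 * (S.x l * S.div (S.div₂ θ)) := by
  have h2 : ∀ j, S.Tan (θ j) := fun j => by
    have := h1 j; simp only [Tan, hs _ j] at this; exact this
  have e1 : S.x 0 * S.div₂ θ 0 + S.x 1 * S.div₂ θ 1 + S.x 2 * S.div₂ θ 2 = 0 := tan_div₂ h2 htr
  have e3 : S.div (fun k => S.x l * S.div₂ θ k) = S.div₂ θ l + S.x l * S.div (S.div₂ θ) := by
    simp only [div, Derivation.leibniz, smul_eq_mul, S.D_x]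
    linear_combination sum_delta l (S.div₂ θ) - S.x l * e1
  have e4 : S.div (fun k => S.lap (θ k l)) = S.lap (S.div₂ θ l) - 4 * S.div₂ θ l := (h1 l).div_lap
  rw [div₂, S.div_add, S.div_add, S.div_add, e4, S.div_mul 2 S.D_two, S.div_mul 2 S.D_two, S.div_mul 2 S.D_two,
    S.div_mul_x, e3, ← div₂]
  ring

end SphereCalculus

/-- The calculus along the spheres on smooth functions on the exterior. -/
def SF.sphere {M : ℝ} : SphereCalculus (SF M) where
  D := SF.D
  x := SF.x
  x_sq := SF.x_sq
  D_x := SF.D_x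
  x_D := SF.x_D
  comm := SF.D_D

end

end LinGrav

namespace LinGrav

noncomputable section

/-! ### Parameter-dependent continuous functions on the sphere -/

section Slice

variable {E F : Type}

section

variable [NormedAddCommGroup F]

open Classical in
/-- A function of a parameter and a point of the sphere, as a function of the parameter with values
in the continuous functions on the sphere. -/
def slice (G : E → S2 → F) (p : E) : C(S2, F) :=
  if h : Continuous (G p) then ⟨G p, h⟩ else 0

theorem slice_apply {G : E → S2 → F} {p : E} (h : Continuous (G p)) (y : S2) :
    slice G p y = G p y := by
  rw [slice, dif_pos h]; rfl

variable [NormedAddCommGroup E]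

theorem continuous_of_continuousOn {G : E → S2 → F} {s : Set E}
    (hG : ContinuousOn (Function.uncurry G) (s ×ˢ Set.univ)) {p : E} (hp : p ∈ s) :
    Continuous (G p) := by
  have h : ContinuousOn (fun y => Function.uncurry G (p, y)) Set.univ :=
    hG.comp (by fun_prop) fun y _ => ⟨hp, trivial⟩
  exact continuousOn_univ.mp h

theorem continuousOn_slice {G : E → S2 → F} {s : Set E}
    (hG : ContinuousOn (Function.uncurry G) (s ×ˢ Set.univ)) : ContinuousOn (slice G) s := by
  rw [continuousOn_iff_continuous_domRestrict]
  have hc : Continuous fun q : s × S2 => G q.1 q.2 := by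
    have : ContinuousOn (fun q : s × S2 => Function.uncurry G ((q.1 : E), q.2)) Set.univ :=
      hG.comp (by fun_prop) fun q _ => ⟨q.1.2, trivial⟩
    exact continuousOn_univ.mp this
  have : s.domRestrict (slice G) = ContinuousMap.curry ⟨fun q : s × S2 => G q.1 q.2, hc⟩ := by
    ext p y
    rw [Set.domRestrict_apply, slice_apply (continuous_of_continuousOn hG p.2)]; rfl
  rw [this]
  exact ContinuousMap.continuous _

theorem continuousOn_uncurry_sphere {G : E × E3 → F} {s : Set E} {V : Set E3}
    (hV : Metric.sphere 0 1 ⊆ V) (hG : ContinuousOn G (s ×ˢ V)) :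
    ContinuousOn (Function.uncurry fun p (y : S2) => G (p, y)) (s ×ˢ Set.univ) :=
  hG.comp (f := fun q : E × S2 => (q.1, (q.2 : E3))) (by fun_prop) fun q hq => ⟨hq.1, hV q.2.2⟩

end

variable [NormedAddCommGroup E] [NormedSpace ℝ E] [NormedAddCommGroup F] [NormedSpace ℝ F]

/-- Evaluation of operator-valued functions on the sphere. -/
def evalCLM : C(S2, E →L[ℝ] F) →L[ℝ] E →L[ℝ] C(S2, F) :=
  LinearMap.mkContinuous₂
    (LinearMap.mk₂ ℝ (fun (u : C(S2, E →L[ℝ] F)) (e : E) => (⟨fun y => u y e, by fun_prop⟩ : C(S2, F)))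
      (fun u v e => by ext; simp) (fun c u e => by ext; simp) (fun u e e' => by ext; simp)
      (fun c u e => by ext; simp)) 1 fun u e => by
    rw [one_mul, LinearMap.mk₂_apply, ContinuousMap.norm_le _ (by positivity)]
    intro y
    exact (u y).le_of_opNorm_le (u.norm_coe_le_norm y) e

theorem evalCLM_apply (u : C(S2, E →L[ℝ] F)) (e : E) (y : S2) : evalCLM u e y = u y e := rfl

/-- The mean value inequality at each fixed y bounds the remainder by ε|q − p| on a ball that does
not depend on y, because `slice G'` is continuous for the sup norm. Convexity of s keeps the
segments inside s. -/
theorem hasFDerivWithinAt_slice {G : E → S2 → F} {G' : E → S2 → E →L[ℝ] F} {s : Set E}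
    (hs : Convex ℝ s) (hG : ContinuousOn (Function.uncurry G) (s ×ˢ Set.univ))
    (hG' : ContinuousOn (Function.uncurry G') (s ×ˢ Set.univ))
    (h : ∀ p ∈ s, ∀ y, HasFDerivWithinAt (fun p => G p y) (G' p y) s p) {p : E} (hp : p ∈ s) :
    HasFDerivWithinAt (slice G) (evalCLM (slice G' p)) s p := by
  refine HasFDerivWithinAt.of_isLittleO (Asymptotics.isLittleO_iff.mpr fun ε hε => ?_)
  have hc := continuousOn_slice hG' p hp
  rw [Metric.continuousWithinAt_iff] at hc
  obtain ⟨δ, hδ, hd⟩ := hc ε hε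
  filter_upwards [inter_mem_nhdsWithin s (Metric.ball_mem_nhds p hδ)] with q hq
  rw [ContinuousMap.norm_le _ (by positivity)]
  intro y
  have hsub : s ∩ Metric.ball p δ ⊆ s := Set.inter_subset_left
  have key := (hs.inter (convex_ball p δ)).norm_image_sub_le_of_norm_hasFDerivWithin_le'
    (f := fun p => G p y) (f' := fun p => G' p y) (φ := G' p y) (C := ε)
    (fun z hz => (h z hz.1 y).mono hsub) (fun z hz => by
      have h1 := hd hz.1 hz.2
      rw [dist_eq_norm] at h1
      refine le_trans ?_ h1.le
      have h2 := (slice G' z - slice G' p).norm_coe_le_norm y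
      rwa [ContinuousMap.sub_apply, slice_apply (continuous_of_continuousOn hG' hz.1),
        slice_apply (continuous_of_continuousOn hG' hp)] at h2)
    ⟨hp, Metric.mem_ball_self hδ⟩ hq
  simpa [evalCLM_apply, slice_apply (continuous_of_continuousOn hG hq.1),
    slice_apply (continuous_of_continuousOn hG hp),
    slice_apply (continuous_of_continuousOn hG' hp)] using key

/-- The derivative with respect to the parameter. -/
def paramDeriv (G : E × E3 → F) (s : Set E) (V : Set E3) (q : E × E3) : E →L[ℝ] F :=
  (fderivWithin ℝ G (s ×ˢ V) q).comp (ContinuousLinearMap.inl ℝ E E3)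

theorem ContDiffOn.paramDeriv {G : E × E3 → F} {s : Set E} {V : Set E3} (hs : UniqueDiffOn ℝ s)
    (hV : IsOpen V) (hG : ContDiffOn ℝ ∞ G (s ×ˢ V)) :
    ContDiffOn ℝ ∞ (paramDeriv G s V) (s ×ˢ V) :=
  (hG.fderivWithin (hs.prod hV.uniqueDiffOn) (by simp)).clm_comp contDiffOn_const

theorem hasFDerivWithinAt_paramDeriv {G : E × E3 → F} {s : Set E} {V : Set E3}
    (hG : ContDiffOn ℝ ∞ G (s ×ˢ V)) {p : E} (hp : p ∈ s) {y : E3} (hy : y ∈ V) :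
    HasFDerivWithinAt (fun p => G (p, y)) (LinGrav.paramDeriv G s V (p, y)) s p := by
  have h1 := (hG.differentiableOn (by simp) (p, y) ⟨hp, hy⟩).hasFDerivWithinAt
  have h2 : HasFDerivWithinAt (fun p : E => (p, y)) (ContinuousLinearMap.inl ℝ E E3) s p :=
    (hasFDerivWithinAt_id p s).prodMk (hasFDerivWithinAt_const y p s)
  exact h1.comp p h2 fun q hq => (⟨hq, hy⟩ : (q, y) ∈ s ×ˢ V)

theorem hasFDerivWithinAt_slice' {G : E × E3 → F} {s : Set E} {V : Set E3} (hs : Convex ℝ s)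
    (hsu : UniqueDiffOn ℝ s) (hV : IsOpen V) (hSV : Metric.sphere 0 1 ⊆ V)
    (hG : ContDiffOn ℝ ∞ G (s ×ˢ V)) {p : E} (hp : p ∈ s) :
    HasFDerivWithinAt (slice fun p (y : S2) => G (p, y))
      (evalCLM (slice (fun p (y : S2) => paramDeriv G s V (p, y)) p)) s p :=
  hasFDerivWithinAt_slice hs (continuousOn_uncurry_sphere hSV hG.continuousOn)
    (continuousOn_uncurry_sphere hSV (ContDiffOn.paramDeriv hsu hV hG).continuousOn)
    (fun _ hp y => hasFDerivWithinAt_paramDeriv hG hp (hSV y.2)) hp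

/-- Induction on the order, over all target spaces at once: the derivative of a slice is the slice
of the parameter derivative, whose values lie in E →L F instead of F. -/
theorem contDiffOn_slice_nat {s : Set E} {V : Set E3} (hs : Convex ℝ s) (hsu : UniqueDiffOn ℝ s)
    (hV : IsOpen V) (hSV : Metric.sphere 0 1 ⊆ V) (n : ℕ) :
    ∀ {F : Type} [NormedAddCommGroup F] [NormedSpace ℝ F] {G : E × E3 → F},
      ContDiffOn ℝ ∞ G (s ×ˢ V) → ContDiffOn ℝ n (slice fun p (y : S2) => G (p, y)) s := by
  induction n with
  | zero =>
    intro F _ _ G hG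
    exact contDiffOn_zero.mpr (continuousOn_slice (continuousOn_uncurry_sphere hSV hG.continuousOn))
  | succ n ih =>
    intro F _ _ G hG
    rw [Nat.cast_add, Nat.cast_one, contDiffOn_succ_iff_hasFDerivWithinAt_of_uniqueDiffOn hsu]
    refine ⟨by simp, _, ?_, fun p hp => hasFDerivWithinAt_slice' hs hsu hV hSV hG hp⟩
    exact (ContinuousLinearMap.contDiff (𝕜 := ℝ) (E := C(S2, E →L[ℝ] F)) (F := E →L[ℝ] C(S2, F))
      evalCLM).comp_contDiffOn (ih (ContDiffOn.paramDeriv hsu hV hG))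

theorem contDiffOn_slice {s : Set E} {V : Set E3} (hs : Convex ℝ s) (hsu : UniqueDiffOn ℝ s)
    (hV : IsOpen V) (hSV : Metric.sphere 0 1 ⊆ V) {G : E × E3 → F}
    (hG : ContDiffOn ℝ ∞ G (s ×ˢ V)) : ContDiffOn ℝ ∞ (slice fun p (y : S2) => G (p, y)) s :=
  contDiffOn_infty.mpr fun n => contDiffOn_slice_nat hs hsu hV hSV n hG

end Slice

/-! ### Invariance of the surface measure -/

/-- The action of a linear isometry on the sphere. -/
def sphereMap (A : E3 ≃ₗᵢ[ℝ] E3) : C(S2, S2) where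
  toFun y := ⟨A y, by simp⟩
  continuous_toFun := by fun_prop

theorem coe_sphereMap (A : E3 ≃ₗᵢ[ℝ] E3) (y : S2) : (sphereMap A y : E3) = A y := rfl

-- The measure of a set on the sphere is, up to a constant, the volume of the cone over it inside
-- the unit ball. A linear isometry maps such cones to cones and preserves volume.
open MeasureTheory Pointwise in
theorem measurePreserving_sphereMap (A : E3 ≃ₗᵢ[ℝ] E3) :
    MeasurePreserving (sphereMap A) sphereMeasure sphereMeasure := by
  refine ⟨(sphereMap A).continuous.measurable, ?_⟩
  ext s hs
  rw [Measure.map_apply (sphereMap A).continuous.measurable hs,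
    Measure.toSphere_apply' _ ((sphereMap A).continuous.measurable hs),
    Measure.toSphere_apply' _ hs]
  congr 1
  have h : (Set.Ioo (0 : ℝ) 1 • ((fun y : S2 => (y : E3)) '' (sphereMap A ⁻¹' s)) : Set E3)
      = A ⁻¹' (Set.Ioo (0 : ℝ) 1 • ((fun y : S2 => (y : E3)) '' s)) := by
    ext z
    simp only [Set.mem_smul, Set.mem_image, Set.mem_preimage]
    constructor
    · rintro ⟨c, hc, _, ⟨y, hy, rfl⟩, rfl⟩
      exact ⟨c, hc, _, ⟨_, hy, rfl⟩, by simp [coe_sphereMap]⟩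
    · rintro ⟨c, hc, _, ⟨y, hy, rfl⟩, h⟩
      have hy' : sphereMap A (sphereMap A.symm y) = y := Subtype.ext (by simp [coe_sphereMap])
      refine ⟨c, hc, _, ⟨sphereMap A.symm y, by rwa [hy'], rfl⟩, ?_⟩
      apply A.injective
      simp [coe_sphereMap, h]
  refine (congrArg _ h).trans ?_
  exact A.measurePreserving.measure_preimage_equiv (f := A.toMeasurableEquiv) _

theorem integral_sphereMap (A : E3 ≃ₗᵢ[ℝ] E3) {f : S2 → ℝ} (hf : Continuous f) :
    ∫ y, f (sphereMap A y) ∂sphereMeasure = ∫ y, f y ∂sphereMeasure := by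
  have h := measurePreserving_sphereMap A
  conv_rhs => rw [← h.map_eq]
  rw [MeasureTheory.integral_map h.measurable.aemeasurable hf.aestronglyMeasurable]

theorem integrable_sphere {f : S2 → ℝ} (hf : Continuous f) :
    MeasureTheory.Integrable f sphereMeasure :=
  hf.integrable_of_hasCompactSupport (HasCompactSupport.of_compactSpace f)

/-- Integration over the sphere. -/
def sphereInt : C(S2, ℝ) →L[ℝ] ℝ :=
  LinearMap.mkContinuous
    { toFun := fun u => ∫ y, u y ∂sphereMeasure
      map_add' := fun u v =>
        MeasureTheory.integral_add (integrable_sphere u.continuous) (integrable_sphere v.continuous)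
      map_smul' := fun c u => MeasureTheory.integral_const_mul c _ }
    (sphereMeasure.real Set.univ) fun u => by
      have := MeasureTheory.norm_integral_le_of_norm_le_const (μ := sphereMeasure) (f := u)
        (Filter.Eventually.of_forall u.norm_coe_le_norm)
      rw [mul_comm]; exact this

theorem sphereInt_apply (u : C(S2, ℝ)) : sphereInt u = ∫ y, u y ∂sphereMeasure := rfl

end

end LinGrav

namespace LinGrav

noncomputable section

variable {M : ℝ}

/-! ### Integration over the spheres of symmetry -/

theorem convex_quadrant : Convex ℝ ((Set.univ : Set ℝ) ×ˢ Set.Ici (2 * M)) :=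
  convex_univ.prod (convex_Ici _)

theorem uniqueDiffOn_quadrant : UniqueDiffOn ℝ ((Set.univ : Set ℝ) ×ˢ Set.Ici (2 * M)) :=
  uniqueDiffOn_univ.prod (uniqueDiffOn_Ici _)

theorem sphere_subset_compl : Metric.sphere (0 : E3) 1 ⊆ {0}ᶜ := fun y hy h => by
  rw [mem_sphere_zero_iff_norm, show y = 0 from h, norm_zero] at hy
  exact zero_ne_one hy

/-- A smooth function restricted to the spheres of symmetry. -/
def sphereSlice (f : Scal M) : ℝ × ℝ → C(S2, ℝ) :=
  slice fun p y => lift f (p.1, p.2, (y : E3))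

theorem contDiffOn_lift_assoc {f : Scal M} (hf : Smooth f) :
    ContDiffOn ℝ ∞ (fun q : (ℝ × ℝ) × E3 => lift f (q.1.1, q.1.2, q.2))
      (((Set.univ : Set ℝ) ×ˢ Set.Ici (2 * M)) ×ˢ {0}ᶜ) :=
  ContDiffOn.comp hf (f := fun q : (ℝ × ℝ) × E3 => (q.1.1, q.1.2, q.2)) (by fun_prop)
    fun _ hq => ⟨hq.1.2, hq.2⟩

theorem Smooth.contDiffOn_sphereSlice {f : Scal M} (hf : Smooth f) :
    ContDiffOn ℝ ∞ (sphereSlice f) ((Set.univ : Set ℝ) ×ˢ Set.Ici (2 * M)) :=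
  contDiffOn_slice convex_quadrant uniqueDiffOn_quadrant isOpen_compl_singleton
    sphere_subset_compl (contDiffOn_lift_assoc hf)

theorem lift_sphere (f : Scal M) (t : ℝ) (r : Set.Ici (2 * M)) (y : S2) :
    lift f (t, (r : ℝ), (y : E3)) = f (t, r, y) := lift_incl f (t, r, y)

theorem Smooth.continuous_sphere {f : Scal M} (hf : Smooth f) (t : ℝ) (r : Set.Ici (2 * M)) :
    Continuous fun y : S2 => f (t, r, y) := by
  have h := continuous_of_continuousOn (G := fun (p : ℝ × ℝ) (y : S2) => lift f (p.1, p.2, (y : E3)))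
    (continuousOn_uncurry_sphere sphere_subset_compl (contDiffOn_lift_assoc hf).continuousOn)
    (p := (t, (r : ℝ))) ⟨trivial, r.2⟩
  simpa only [lift_sphere] using h

theorem Smooth.sphereSlice_apply {f : Scal M} (hf : Smooth f) (t : ℝ) (r : Set.Ici (2 * M)) (y : S2) :
    sphereSlice f (t, (r : ℝ)) y = f (t, r, y) := by
  rw [sphereSlice, slice_apply (by simpa only [lift_sphere] using hf.continuous_sphere t r),
    lift_sphere]

/-- The integral of a function over the spheres of symmetry. -/
def sInt (f : Scal M) : Scal M := fun p => ∫ y, f (p.1, p.2.1, y) ∂sphereMeasure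

theorem Smooth.sInt_eq {f : Scal M} (hf : Smooth f) (p : ℝ × ℝ × E3) (hp : p ∈ region M) :
    sInt f (toExt p hp) = sphereInt (sphereSlice f (p.1, p.2.1)) := by
  rw [sphereInt_apply]
  exact MeasureTheory.integral_congr_ae (Filter.Eventually.of_forall fun y =>
    (hf.sphereSlice_apply p.1 ⟨p.2.1, hp.1⟩ y).symm)

theorem Smooth.sInt {f : Scal M} (hf : Smooth f) : Smooth (sInt f) :=
  smooth_of_eqOn (F := fun p => sphereInt (sphereSlice f (p.1, p.2.1)))
    (sphereInt.contDiff.comp_contDiffOn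
      (hf.contDiffOn_sphereSlice.comp (f := fun p : ℝ × ℝ × E3 => (p.1, p.2.1)) (by fun_prop)
        fun _ hp => ⟨trivial, hp.1⟩))
    hf.sInt_eq

theorem Smooth.hasFDerivWithinAt_sphereSlice {f : Scal M} (hf : Smooth f) {p : ℝ × ℝ}
    (hp : p ∈ (Set.univ : Set ℝ) ×ˢ Set.Ici (2 * M)) :
    HasFDerivWithinAt (sphereSlice f)
      (evalCLM (slice (fun (p : ℝ × ℝ) (y : S2) =>
        (fderivWithin ℝ (lift f) (region M) (p.1, p.2, (y : E3))).comp
          ((ContinuousLinearMap.fst ℝ ℝ ℝ).prod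
            ((ContinuousLinearMap.snd ℝ ℝ ℝ).prod 0))) p))
      ((Set.univ : Set ℝ) ×ˢ Set.Ici (2 * M)) p := by
  have hm : ∀ (y : S2), Set.MapsTo (fun q : ℝ × ℝ => (q.1, q.2, (y : E3)))
      ((Set.univ : Set ℝ) ×ˢ Set.Ici (2 * M)) (region M) := fun y q hq =>
    ⟨hq.2, sphere_subset_compl y.2⟩
  refine hasFDerivWithinAt_slice convex_quadrant
    (continuousOn_uncurry_sphere (G := fun q : (ℝ × ℝ) × E3 => lift f (q.1.1, q.1.2, q.2))
      sphere_subset_compl (contDiffOn_lift_assoc hf).continuousOn) ?_ ?_ hp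
  · refine ContinuousOn.clm_comp ?_ continuousOn_const
    exact hf.contDiffOn_fderivWithin.continuousOn.comp
      (f := fun q : (ℝ × ℝ) × S2 => (q.1.1, q.1.2, (q.2 : E3))) (by fun_prop)
      fun q hq => hm q.2 hq.1
  · intro q hq y
    have h2 : HasFDerivWithinAt (fun q : ℝ × ℝ => (q.1, q.2, (y : E3)))
        ((ContinuousLinearMap.fst ℝ ℝ ℝ).prod ((ContinuousLinearMap.snd ℝ ℝ ℝ).prod 0))
        ((Set.univ : Set ℝ) ×ˢ Set.Ici (2 * M)) q :=
      hasFDerivWithinAt_fst.prodMk (hasFDerivWithinAt_snd.prodMk (hasFDerivWithinAt_const _ _ _))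
    exact (hf.hasFDerivWithinAt (hm y hq)).comp q h2 (hm y)

/-- Differentiation under the integral: the integral is a continuous linear functional on C(S²),
composed with the C(S²)-valued differentiable map `sphereSlice f`. -/
theorem dQ_sInt {f : Scal M} (hf : Smooth f) (a : Fin 2) : dQ a (sInt f) = sInt (dQ a f) := by
  ext p
  have hp : (p.1, (p.2.1 : ℝ)) ∈ (Set.univ : Set ℝ) ×ˢ Set.Ici (2 * M) := ⟨trivial, p.2.1.2⟩
  have h2 : HasFDerivWithinAt (fun q : ℝ × ℝ × E3 => (q.1, q.2.1))
      ((ContinuousLinearMap.fst ℝ ℝ (ℝ × E3)).prod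
        ((ContinuousLinearMap.fst ℝ ℝ E3).comp (ContinuousLinearMap.snd ℝ ℝ (ℝ × E3))))
      (region M) (incl p) :=
    ((ContinuousLinearMap.fst ℝ ℝ (ℝ × E3)).prod ((ContinuousLinearMap.fst ℝ ℝ E3).comp
      (ContinuousLinearMap.snd ℝ ℝ (ℝ × E3)))).hasFDerivWithinAt
  have h := sphereInt.hasFDerivAt.comp_hasFDerivWithinAt (incl p)
    (HasFDerivWithinAt.comp (incl p) (f := fun q : ℝ × ℝ × E3 => (q.1, q.2.1))
      (hf.hasFDerivWithinAt_sphereSlice hp) h2 fun q hq => ⟨trivial, hq.1⟩)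
  rw [dQ, dirDeriv_of_eqOn hf.sInt_eq h]
  simp only [ContinuousLinearMap.comp_apply, sphereInt_apply, sInt]
  refine MeasureTheory.integral_congr_ae (Filter.Eventually.of_forall fun y => ?_)
  have hc : Continuous fun y : S2 =>
      (fderivWithin ℝ (lift f) (region M) (p.1, (p.2.1 : ℝ), (y : E3))).comp
          ((ContinuousLinearMap.fst ℝ ℝ ℝ).prod
            ((ContinuousLinearMap.snd ℝ ℝ ℝ).prod (0 : ℝ × ℝ →L[ℝ] E3))) := by
    refine Continuous.clm_comp ?_ continuous_const
    exact hf.contDiffOn_fderivWithin.continuousOn.comp_continuous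
      (f := fun y : S2 => (p.1, (p.2.1 : ℝ), (y : E3))) (by fun_prop)
      fun y => ⟨p.2.1.2, sphere_subset_compl y.2⟩
  simp only [evalCLM_apply]
  rw [slice_apply hc]
  fin_cases a <;> rfl

/-- Functions that are constant on the spheres of symmetry. -/
def IsRadial (c : Scal M) : Prop := ∀ (p : Ext M) (y : S2), c (p.1, p.2.1, y) = c p

theorem IsRadial.dS {c : Scal M} (h : IsRadial c) (hc : Smooth c) (i : Fin 3) : dS i c = 0 := by
  ext p
  set γ : ℝ → ℝ × ℝ × E3 := fun s =>
    (p.1, (p.2.1 : ℝ), (p.2.2 : E3) + s • EuclideanSpace.single i 1) with hγ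
  have hγ0 : γ 0 = incl p := by simp [hγ, incl]
  have hd : HasDerivAt γ (0, 0, (1 : ℝ) • EuclideanSpace.single i 1) 0 :=
    (hasDerivAt_const _ _).prodMk ((hasDerivAt_const _ _).prodMk
      (((hasDerivAt_id' (0 : ℝ)).smul_const _).const_add _))
  have hcont : ContinuousAt γ 0 := hd.continuousAt
  have hev : ∀ᶠ s in nhds (0 : ℝ), γ s ∈ region M := by
    have h1 : ∀ᶠ s in nhds (0 : ℝ), (γ s).2.2 ≠ 0 :=
      (continuousAt_snd.comp (continuousAt_snd.comp hcont)).eventually_ne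
        (by simpa [hγ] using sphere_subset_compl p.2.2.2)
    filter_upwards [h1] with s hs using ⟨p.2.1.2, hs⟩
  have h1 : HasFDerivWithinAt (lift c) (fderivWithin ℝ (lift c) (region M) (incl p)) (region M)
      (γ 0) := by rw [hγ0]; exact hc.hasFDerivWithinAt (incl_mem p)
  have h2 := (h1.comp_hasDerivWithinAt (s := γ ⁻¹' region M) (0 : ℝ) hd.hasDerivWithinAt
    (Set.mapsTo_preimage _ _)).hasDerivAt hev
  have h3 : HasDerivAt (lift c ∘ γ) 0 0 := by
    refine (hasDerivAt_const (0 : ℝ) (c p)).congr_of_eventuallyEq ?_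
    filter_upwards [hev] with s hs
    rw [Function.comp_apply, lift_of_mem c hs]
    exact h p _
  have := h2.unique h3
  rw [one_smul] at this
  exact this

/-- The rotation by `-2 arctan s` in the plane of two coordinate axes. -/
def rotCurve (i j : Fin 3) (q : ℝ × E3) : E3 :=
  (2 * (q.2 i - q.1 * q.2 j) / (1 + q.1 ^ 2)) • (EuclideanSpace.single i 1
    + q.1 • EuclideanSpace.single j 1) - (2 * q.2 i) • EuclideanSpace.single i 1 + q.2

/-- A product of two reflections in lines of a coordinate plane is a rotation. Parametrised by
slope, the curve of isometries is rational in s, so its smoothness needs no trigonometric functions.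
-/
theorem rotCurve_eq {i j : Fin 3} (hij : i ≠ j) (s : ℝ) (y : E3) :
    rotCurve i j (s, y)
      = Submodule.reflection (ℝ ∙ (EuclideanSpace.single i 1 + s • EuclideanSpace.single j 1 : E3))
        (Submodule.reflection (ℝ ∙ (EuclideanSpace.single i 1 : E3)) y) := by
  rw [Submodule.reflection_singleton_apply, Submodule.reflection_singleton_apply]
  have h1 : ‖(EuclideanSpace.single i 1 : E3)‖ = 1 := by simp
  have h2 : ‖(EuclideanSpace.single i 1 + s • EuclideanSpace.single j 1 : E3)‖ ^ 2 = 1 + s ^ 2 := by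
    rw [@norm_add_sq_real]
    simp [norm_smul, inner_smul_right, EuclideanSpace.inner_single_left, hij]
  simp only [RCLike.ofReal_real_eq_id, id_eq] at *
  rw [h2, h1]
  simp only [inner_sub_right, inner_add_left, inner_smul_left,
    EuclideanSpace.inner_single_left, rotCurve]
  ext k
  simp [hij.symm]
  ring_nf

theorem contDiff_rotCurve (i j : Fin 3) : ContDiff ℝ ∞ (rotCurve i j) := by
  have hc : ∀ k : Fin 3, ContDiff ℝ ∞ fun q : ℝ × E3 => q.2 k := fun k =>
    (EuclideanSpace.proj (𝕜 := ℝ) k).contDiff.comp contDiff_snd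
  have h1 : ContDiff ℝ ∞ fun q : ℝ × E3 => 2 * (q.2 i - q.1 * q.2 j) / (1 + q.1 ^ 2) :=
    (contDiff_const.mul ((hc i).sub (contDiff_fst.mul (hc j)))).div (by fun_prop)
      fun q => by positivity
  have h2 : ContDiff ℝ ∞ fun q : ℝ × E3 => (EuclideanSpace.single i 1
      + q.1 • EuclideanSpace.single j 1 : E3) := by fun_prop
  exact ((h1.smul h2).sub ((contDiff_const.mul (hc i)).smul contDiff_const)).add contDiff_snd

theorem hasDerivAt_rotCurve (i j : Fin 3) (y : E3) :
    HasDerivAt (fun s => rotCurve i j (s, y))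
      ((2 * y i) • EuclideanSpace.single j 1 - (2 * y j) • EuclideanSpace.single i 1) 0 := by
  have h1 : HasDerivAt (fun s : ℝ => 2 * (y i - s * y j) / (1 + s ^ 2)) (-(2 * y j)) 0 := by
    have ha : HasDerivAt (fun s : ℝ => 2 * (y i - s * y j)) (2 * -(1 * y j)) 0 :=
      (((hasDerivAt_id' (0 : ℝ)).mul_const (y j)).const_sub (y i)).const_mul 2
    have hb : HasDerivAt (fun s : ℝ => 1 + s ^ 2) (2 * 0) 0 := by
      simpa using (hasDerivAt_pow 2 (0 : ℝ)).const_add 1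
    refine (ha.div hb (by norm_num)).congr_deriv (by norm_num)
  have h2 : HasDerivAt (fun s : ℝ => (EuclideanSpace.single i 1
      + s • EuclideanSpace.single j 1 : E3)) ((1 : ℝ) • EuclideanSpace.single j 1) 0 :=
    ((hasDerivAt_id' (0 : ℝ)).smul_const _).const_add _
  have h3 := ((h1.smul h2).sub_const ((2 * y i) • (EuclideanSpace.single i 1 : E3))).add_const y
  refine h3.congr_deriv ?_
  simp
  abel

/-- The integral of f composed with the isometries `rotCurve` does not depend on s, by invariance of
the measure. Its derivative at s = 0 is twice the integral of (x_i D_j − x_j D_i)f. -/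
theorem integral_rot {f : Scal M} (hf : Smooth f) {i j : Fin 3} (hij : i ≠ j) (t : ℝ)
    (r : Set.Ici (2 * M)) :
    ∫ y, (pos i * dS j f - pos j * dS i f : Scal M) (t, r, y) ∂sphereMeasure = 0 := by
  set G : ℝ × E3 → ℝ := fun q => lift f (t, (r : ℝ), rotCurve i j q) with hG
  have hne : ∀ (s : ℝ) (y : E3), y ≠ 0 → rotCurve i j (s, y) ≠ 0 := fun s y hy => by
    rw [rotCurve_eq hij]; simpa using hy
  have hGs : ContDiffOn ℝ ∞ G (Set.univ ×ˢ {0}ᶜ) := by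
    refine ContDiffOn.comp hf (f := fun q : ℝ × E3 => (t, (r : ℝ), rotCurve i j q)) ?_ ?_
    · have := contDiff_rotCurve i j
      exact ContDiff.contDiffOn (by fun_prop)
    · exact fun q hq => ⟨r.2, hne _ _ hq.2⟩
  have h1 := hasFDerivWithinAt_slice' convex_univ uniqueDiffOn_univ isOpen_compl_singleton
    sphere_subset_compl hGs (Set.mem_univ (0 : ℝ))
  rw [hasFDerivWithinAt_univ] at h1
  have h2 := (sphereInt.hasFDerivAt.comp (0 : ℝ) h1).hasDerivAt
  have hcG : ∀ s, Continuous fun y : S2 => G (s, (y : E3)) := fun s =>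
    continuous_of_continuousOn (continuousOn_uncurry_sphere sphere_subset_compl hGs.continuousOn)
      (Set.mem_univ s)
  have hcP : Continuous fun y : S2 => paramDeriv G Set.univ {0}ᶜ ((0 : ℝ), (y : E3)) :=
    continuous_of_continuousOn (continuousOn_uncurry_sphere sphere_subset_compl
      (ContDiffOn.paramDeriv uniqueDiffOn_univ isOpen_compl_singleton hGs).continuousOn)
      (Set.mem_univ (0 : ℝ))
  have h3 : (⇑sphereInt ∘ slice fun s (y : S2) => G (s, y))
      = fun _ => ∫ y, f (t, r, y) ∂sphereMeasure := by
    funext s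
    rw [Function.comp_apply, sphereInt_apply]
    have h4 := integral_sphereMap (((ℝ ∙ (EuclideanSpace.single i 1 : E3)).reflection).trans
      ((ℝ ∙ (EuclideanSpace.single i 1 + s • EuclideanSpace.single j 1 : E3)).reflection))
      (hf.continuous_sphere t r)
    rw [← h4]
    refine MeasureTheory.integral_congr_ae (Filter.Eventually.of_forall fun y => ?_)
    simp only
    rw [slice_apply (hcG s), ← lift_sphere f, coe_sphereMap, hG]
    simp only [rotCurve_eq hij]
    rfl
  rw [h3] at h2
  have h5 := h2.unique (hasDerivAt_const _ _)
  simp only [ContinuousLinearMap.comp_apply, sphereInt_apply, evalCLM_apply] at h5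
  have h6 : ∀ y : S2, slice (fun (s : ℝ) (y : S2) => paramDeriv G Set.univ {0}ᶜ (s, (y : E3))) 0 y 1
      = 2 * (pos i * dS j f - pos j * dS i f : Scal M) (t, r, y) := by
    intro y
    rw [slice_apply hcP]
    have ha := hasFDerivWithinAt_paramDeriv hGs (Set.mem_univ (0 : ℝ)) (sphere_subset_compl y.2)
    rw [hasFDerivWithinAt_univ] at ha
    have hr0 : rotCurve i j (0, (y : E3)) = y := by simp [rotCurve]
    have hin : incl (t, r, y) = (t, (r : ℝ), rotCurve i j (0, (y : E3))) := by rw [hr0]; rfl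
    have hb := hf.hasFDerivWithinAt (incl_mem (t, r, y))
    have hc : HasDerivAt (fun s : ℝ => ((t, (r : ℝ), rotCurve i j (s, (y : E3))) : ℝ × ℝ × E3))
        (0, 0, _) 0 :=
      (hasDerivAt_const _ _).prodMk ((hasDerivAt_const _ _).prodMk (hasDerivAt_rotCurve i j y))
    rw [hin] at hb
    have hd := hb.comp_hasDerivWithinAt (s := Set.univ) (0 : ℝ) hc.hasDerivWithinAt
      fun s _ => (show (t, (r : ℝ), rotCurve i j (s, (y : E3))) ∈ region M from
        ⟨r.2, hne s y (sphere_subset_compl y.2)⟩)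
    rw [hasDerivWithinAt_univ] at hd
    rw [ha.hasDerivAt.unique hd, ← hin, fderivWithin_lift hf (incl_mem _)]
    simp only [lift_incl]
    have hn : ‖(incl ((t, r, y) : Ext M)).2.2‖ = 1 := norm_sphere y
    rw [hn]
    simp only [Pi.sub_apply, Pi.mul_apply, pos]
    fin_cases i <;> fin_cases j <;> simp [Fin.sum_univ_three] at hij ⊢ <;> ring
  rw [MeasureTheory.integral_congr_ae (Filter.Eventually.of_forall h6),
    MeasureTheory.integral_const_mul] at h5
  simpa using h5

end

end LinGrav

namespace LinGrav

noncomputable section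

variable {M : ℝ}

/-! ### Integration by parts on the spheres of symmetry -/

theorem isRadial_sInt (f : Scal M) : IsRadial (sInt f) := fun _ _ => rfl

theorem sInt_radial_mul {c : Scal M} (hc : IsRadial c) (f : Scal M) :
    sInt (c * f) = c * sInt f := by
  funext p
  simp only [sInt, Pi.mul_apply]
  rw [← MeasureTheory.integral_const_mul]
  exact MeasureTheory.integral_congr_ae (Filter.Eventually.of_forall fun y => by
    simp only [hc p y])

theorem sInt_add {f g : Scal M} (hf : Smooth f) (hg : Smooth g) :
    sInt (f + g) = sInt f + sInt g := by
  funext p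
  exact MeasureTheory.integral_add (integrable_sphere (hf.continuous_sphere p.1 p.2.1))
    (integrable_sphere (hg.continuous_sphere p.1 p.2.1))

theorem eq_zero_of_sInt_sq {f : Scal M} (hf : Smooth f) (h : sInt (f * f) = 0) : f = 0 := by
  funext p
  have hc := hf.continuous_sphere p.1 p.2.1
  have h1 : ∫ y, f (p.1, p.2.1, y) * f (p.1, p.2.1, y) ∂sphereMeasure = 0 := congrFun h p
  rw [MeasureTheory.integral_eq_zero_iff_of_nonneg (fun y => mul_self_nonneg _)
    (integrable_sphere (hc.mul hc))] at h1
  exact mul_self_eq_zero.mp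
    (congrFun ((Continuous.ae_eq_iff_eq _ (hc.mul hc) continuous_zero).mp h1) p.2.2)

namespace SphereCalculus

variable {A : Type*} [CommRing A] [Algebra ℝ A] (S : SphereCalculus A)

/-- The components of the vector product of the position with a 1-form. -/
def cross (i : Fin 3) (ξ : Fin 3 → A) : A :=
  ![S.x 1 * ξ 2 - S.x 2 * ξ 1, S.x 2 * ξ 0 - S.x 0 * ξ 2, S.x 0 * ξ 1 - S.x 1 * ξ 0] i

theorem x_curl (i : Fin 3) (ξ : Fin 3 → A) :
    S.x i * S.curl ξ = S.curl (fun k => S.x i * ξ k) + S.cross i ξ := by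
  have h : S.curl (fun k => S.x i * ξ k) = S.x i * S.curl ξ
      + (ξ 0 * (S.x 1 * S.D 2 (S.x i) - S.x 2 * S.D 1 (S.x i))
        + ξ 1 * (S.x 2 * S.D 0 (S.x i) - S.x 0 * S.D 2 (S.x i))
        + ξ 2 * (S.x 0 * S.D 1 (S.x i) - S.x 1 * S.D 0 (S.x i))) := by
    simp only [curl, Derivation.leibniz, smul_eq_mul]; ring
  rw [h]
  simp only [S.D_x]
  fin_cases i <;> simp [cross] <;> ring

end SphereCalculus

/-! ### Integration by parts and the space Λ, inside the ring of smooth functions. -/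

namespace SF

/-- Integration over the spheres of symmetry. -/
def J : SF M →ₗ[ℝ] SF M where
  toFun f := ⟨sInt f, f.smooth.sInt⟩
  map_add' f g := SF.ext (sInt_add f.smooth g.smooth)
  map_smul' c f := SF.ext (by
    exact sInt_radial_mul (c := fun _ => c) (fun _ _ => rfl) (f : Scal M))

/-- Smooth functions that are constant on the spheres of symmetry. -/
def Radial (c : SF M) : Prop := IsRadial (c : Scal M)

theorem Radial.D {c : SF M} (hc : Radial c) (i : Fin 3) : D i c = 0 :=
  SF.ext (IsRadial.dS hc c.smooth i)

theorem radial_r : Radial (r : SF M) := fun _ _ => rfl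
theorem radial_m : Radial (m : SF M) := fun _ _ => rfl
theorem radial_w [Fact (0 < M)] : Radial (w : SF M) := fun _ _ => rfl
theorem radial_J (f : SF M) : Radial (J f) := isRadial_sInt (f : Scal M)
theorem Radial.mul {c d : SF M} (hc : Radial c) (hd : Radial d) : Radial (c * d) := fun p y =>
  congrArg₂ (· * ·) (hc p y) (hd p y)
theorem Radial.add {c d : SF M} (hc : Radial c) (hd : Radial d) : Radial (c + d) := fun p y =>
  congrArg₂ (· + ·) (hc p y) (hd p y)
theorem radial_algebraMap (c : ℝ) : Radial (algebraMap ℝ (SF M) c) := fun _ _ => rfl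

theorem J_mul {c : SF M} (hc : Radial c) (f : SF M) : J (c * f) = c * J f :=
  SF.ext (sInt_radial_mul hc f)

theorem J_T (f : SF M) : J (T f) = T (J f) := SF.ext (dQ_sInt f.smooth 0).symm
theorem J_R (f : SF M) : J (R f) = R (J f) := SF.ext (dQ_sInt f.smooth 1).symm

theorem eq_zero_of_J_sq {f : SF M} (h : J (f * f) = 0) : f = 0 :=
  SF.ext (eq_zero_of_sInt_sq f.smooth (congrArg SF.val h))

theorem J_rot (i j : Fin 3) (f : SF M) : J (x i * D j f - x j * D i f) = 0 := by
  rcases eq_or_ne i j with rfl | hij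
  · rw [sub_self, map_zero]
  · exact SF.ext (funext fun p => integral_rot f.smooth hij p.1 p.2.1)

/-- From |x|² = 1 and x·∇f = 0 one gets D_j f = Σ_i (x_i D_j − x_j D_i)(x_i f) + 2 x_j f, and the
rotation terms integrate to zero. -/
theorem J_D (j : Fin 3) (f : SF M) : J (D j f) = 2 * J (x j * f) := by
  have h : D j f = (x 0 * D j (x 0 * f) - x j * D 0 (x 0 * f))
      + (x 1 * D j (x 1 * f) - x j * D 1 (x 1 * f)) + (x 2 * D j (x 2 * f) - x j * D 2 (x 2 * f))
      + (x j * f + x j * f) := by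
    simp only [Derivation.leibniz, smul_eq_mul, D_x, if_true]
    linear_combination x j * x_D f - D j f * x_sq (M := M) - f * SphereCalculus.sum_delta' j x
  rw [h, map_add, map_add, map_add, J_rot, J_rot, J_rot, map_add]
  ring

/-- By `J_D` the integral is 2∫ x·ξ, which vanishes for tangential ξ. -/
theorem J_div {ξ : Fin 3 → SF M} (h : sphere.Tan ξ) : J (sphere.div ξ) = 0 := by
  have h1 : x 0 * ξ 0 + x 1 * ξ 1 + x 2 * ξ 2 = 0 := h
  have h2 := congrArg J h1
  rw [map_add, map_add, map_zero] at h2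
  have h3 : J (sphere.div ξ) = J (D 0 (ξ 0)) + J (D 1 (ξ 1)) + J (D 2 (ξ 2)) := by
    rw [← map_add, ← map_add]; rfl
  rw [h3, J_D, J_D, J_D]
  linear_combination 2 * h2

theorem J_curl (ξ : Fin 3 → SF M) : J (sphere.curl ξ) = 0 := by
  have h : sphere.curl ξ = (x 1 * D 2 (ξ 0) - x 2 * D 1 (ξ 0))
      + (x 2 * D 0 (ξ 1) - x 0 * D 2 (ξ 1)) + (x 0 * D 1 (ξ 2) - x 1 * D 0 (ξ 2)) := by
    simp only [SphereCalculus.curl, sphere]; ring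
  rw [h, map_add, map_add, J_rot, J_rot, J_rot]; simp

/-- The Laplacian on the unit sphere. -/
abbrev lap (f : SF M) : SF M := sphere.lap f

/-- Green's identity: f Δg − g Δf is the divergence of the tangential field f∇g − g∇f. -/
theorem J_lap_comm (f g : SF M) : J (f * lap g) = J (g * lap f) := by
  have h : sphere.Tan (fun i => f * D i g - g * D i f) := by
    simp only [SphereCalculus.Tan, sphere]
    linear_combination f * x_D g - g * x_D f
  have h1 := J_div h
  have h2 : sphere.div (fun i => f * D i g - g * D i f) = f * lap g - g * lap f := by
    simp only [SphereCalculus.div, SphereCalculus.lap, sphere, map_sub, Derivation.leibniz, smul_eq_mul]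
    ring
  rw [h2, map_sub, sub_eq_zero] at h1
  exact h1

theorem J_lap (f : SF M) : J (lap f) = 0 := by
  have h : lap f = sphere.div (fun i => sphere.D i f) := rfl
  rw [h, J_div (sphere.tan_grad f)]

theorem J_x_lap (i : Fin 3) (f : SF M) : J (x i * lap f) = -2 * J (x i * f) := by
  have h : lap (x i : SF M) = -2 * x i := sphere.lap_x i
  rw [J_lap_comm, h, show f * (-2 * x i) = (-2 : ℝ) • (x i * f) by rw [Algebra.smul_def, map_neg, map_ofNat]; ring,
    map_smul, Algebra.smul_def, map_neg, map_ofNat]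

/-- Functions orthogonal to the spherical harmonics with `l = 0, 1`. -/
def Lam (f : SF M) : Prop := J f = 0 ∧ ∀ i, J (x i * f) = 0

theorem mem_LamM_iff (f : SF M) : (f : Scal M) ∈ LamM M ↔ Lam f := by
  constructor
  · rintro ⟨-, h⟩
    refine ⟨SF.ext (funext fun p => (h p.1 p.2.1).1), fun i =>
      SF.ext (funext fun p => ?_)⟩
    rw [mul_comm]
    exact (h p.1 p.2.1).2 i
  · rintro ⟨h0, h1⟩
    refine ⟨f.smooth, fun t r => ⟨?_, fun i => ?_⟩⟩
    · exact congrFun (congrArg SF.val h0) (t, r, ⟨EuclideanSpace.single 0 1, by simp⟩)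
    · have h2 := h1 i
      rw [mul_comm] at h2
      exact congrFun (congrArg SF.val h2) (t, r, ⟨EuclideanSpace.single 0 1, by simp⟩)

namespace Lam

variable {f g : SF M}

theorem add (hf : Lam f) (hg : Lam g) : Lam (f + g) :=
  ⟨by rw [map_add, hf.1, hg.1, add_zero], fun i => by rw [mul_add, map_add, hf.2, hg.2, add_zero]⟩

theorem radial_mul (hf : Lam f) {c : SF M} (hc : Radial c) : Lam (c * f) :=
  ⟨by rw [J_mul hc, hf.1, mul_zero], fun i => by
    rw [mul_left_comm, J_mul hc, hf.2, mul_zero]⟩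

theorem neg (hf : Lam f) : Lam (-f) :=
  ⟨by rw [map_neg, hf.1, neg_zero], fun i => by
    rw [show x i * -f = -(x i * f) by ring, map_neg, hf.2, neg_zero]⟩

theorem sub (hf : Lam f) (hg : Lam g) : Lam (f - g) := by
  rw [sub_eq_add_neg]; exact hf.add hg.neg

theorem T (hf : Lam f) : Lam (T f) :=
  ⟨by rw [J_T, hf.1, map_zero], fun i => by
    rw [show x i * SF.T f = SF.T (x i * f) by rw [Derivation.leibniz, T_x, smul_zero, add_zero, smul_eq_mul],
      J_T, hf.2, map_zero]⟩

theorem R (hf : Lam f) : Lam (R f) :=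
  ⟨by rw [J_R, hf.1, map_zero], fun i => by
    rw [show x i * SF.R f = SF.R (x i * f) by rw [Derivation.leibniz, R_x, smul_zero, add_zero, smul_eq_mul],
      J_R, hf.2, map_zero]⟩

theorem lap (hf : Lam f) : Lam (lap f) :=
  ⟨J_lap f, fun i => by rw [J_x_lap, hf.2, mul_zero]⟩

end Lam

/-- The coordinates satisfy Δx_i = −2x_i, so Δ + 2 removes the l = 1 part of any function; only the
mean has to vanish beforehand. -/
theorem lam_lap_add_two {f : SF M} (hf : J f = 0) : Lam (lap f + 2 * f) := by
  have h2 : (2 : SF M) = algebraMap ℝ (SF M) 2 := (map_ofNat _ 2).symm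
  have hr : Radial (2 : SF M) := by rw [h2]; exact radial_algebraMap 2
  refine ⟨by rw [map_add, J_lap, J_mul hr, hf, mul_zero, add_zero], fun i => ?_⟩
  rw [mul_add, map_add, J_x_lap, mul_left_comm, J_mul hr]
  ring

theorem lam_lap_lap_add_two (f : SF M) : Lam (lap (lap f + 2 * f)) := by
  have h2 : (2 : SF M) = algebraMap ℝ (SF M) 2 := (map_ofNat _ 2).symm
  have hr : Radial (2 : SF M) := by rw [h2]; exact radial_algebraMap 2
  refine ⟨J_lap _, fun i => ?_⟩
  rw [J_x_lap, mul_add, map_add, J_x_lap, mul_left_comm, J_mul hr]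
  ring

theorem J_D_sum {θ : Fin 3 → SF M} (h : sphere.Tan θ) (i : Fin 3) :
    J (x i * sphere.div θ) = -J (θ i) := by
  have h3 : x 0 * θ 0 + x 1 * θ 1 + x 2 * θ 2 = 0 := h
  have ht : sphere.Tan (fun k => x i * θ k) := by
    simp only [SphereCalculus.Tan, sphere]
    linear_combination x i * h3
  have h1 := J_div ht
  have h2 : sphere.div (fun k => x i * θ k) = x i * sphere.div θ + θ i := by
    simp only [SphereCalculus.div, sphere, Derivation.leibniz, smul_eq_mul, D_x]
    linear_combination SphereCalculus.sum_delta i θ - x i * h3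
  rw [h2, map_add] at h1
  linear_combination h1

/-- By `J_D_sum` the moment against x_i is minus the mean of (div θ)_i, which is itself the
divergence of a tangential column of θ. The adjoint reason is that l = 0, 1 gradients are conformal
Killing fields. -/
theorem lam_div_div₂ {θ : Fin 3 → Fin 3 → SF M} (h1 : ∀ k, sphere.Tan (fun j => θ j k))
    (hs : ∀ i j, θ i j = θ j i) (htr : θ 0 0 + θ 1 1 + θ 2 2 = 0) :
    Lam (sphere.div (sphere.div₂ θ)) := by
  have h2 : ∀ j, sphere.Tan (θ j) := fun j => by
    have := h1 j; simp only [SphereCalculus.Tan, hs _ j] at this; exact this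
  have ht := SphereCalculus.tan_div₂ h2 htr
  refine ⟨J_div ht, fun i => ?_⟩
  rw [J_D_sum ht, show sphere.div₂ θ i = sphere.div (fun j => θ j i) from rfl, J_div (h1 i), neg_zero]

/-- The moments against x_i are integrals of the components of x × div θ. Since ∫ x_i (div θ)_k = −∫
θ_ik, they vanish by the symmetry of θ. -/
theorem lam_curl_div₂ {θ : Fin 3 → Fin 3 → SF M} (h1 : ∀ k, sphere.Tan (fun j => θ j k))
    (hs : ∀ i j, θ i j = θ j i) :
    Lam (sphere.curl (sphere.div₂ θ)) := by
  refine ⟨J_curl _, fun i => ?_⟩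
  have e : ∀ i k, J (x i * sphere.div₂ θ k) = -J (θ i k) := fun i k => by
    rw [SphereCalculus.div₂]; exact J_D_sum (h1 k) i
  have h : ∀ ξ : Fin 3 → SF M, x i * sphere.curl ξ
      = sphere.curl (fun k => x i * ξ k) + sphere.cross i ξ := sphere.x_curl i
  rw [h, map_add, J_curl, zero_add]
  fin_cases i
  · change J (x 1 * sphere.div₂ θ 2 - x 2 * sphere.div₂ θ 1) = 0
    rw [map_sub, e, e, hs 1 2, sub_self]
  · change J (x 2 * sphere.div₂ θ 0 - x 0 * sphere.div₂ θ 2) = 0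
    rw [map_sub, e, e, hs 2 0, sub_self]
  · change J (x 0 * sphere.div₂ θ 1 - x 1 * sphere.div₂ θ 0) = 0
    rw [map_sub, e, e, hs 0 1, sub_self]

end SF

end

end LinGrav

namespace LinGrav

noncomputable section

/-! ### Integral operators on the sphere with zonal kernels -/

instance : Nonempty S2 := ⟨⟨EuclideanSpace.single 0 1, by simp⟩⟩

/-- The area of the unit sphere. -/
def area : ℝ := sphereMeasure.real Set.univ

theorem area_pos : 0 < area := by
  have : NeZero sphereMeasure := ⟨MeasureTheory.Measure.toSphere_ne_zero _⟩
  exact MeasureTheory.measureReal_univ_pos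

/-- The kernel `(1 + x·y)/2`. -/
def zonal : C(S2, C(S2, ℝ)) :=
  ContinuousMap.curry ⟨fun q : S2 × S2 => (1 + inner ℝ (q.1 : E3) (q.2 : E3)) / 2, by fun_prop⟩

theorem zonal_apply (x y : S2) : zonal x y = (1 + inner ℝ (x : E3) (y : E3)) / 2 := rfl

theorem zonal_comm (x y : S2) : zonal x y = zonal y x := by
  rw [zonal_apply, zonal_apply, real_inner_comm]

theorem zonal_nonneg (x y : S2) : 0 ≤ zonal x y := by
  have h := abs_real_inner_le_norm (x : E3) (y : E3)
  rw [norm_sphere, norm_sphere, mul_one] at h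
  have := neg_le_of_abs_le h
  rw [zonal_apply]; linarith

theorem zonal_self (x : S2) : zonal x x = 1 := by
  rw [zonal_apply, real_inner_self_eq_norm_sq, norm_sphere]; norm_num

theorem zonal_lt_one {x y : S2} (h : y ≠ x) : zonal x y < 1 := by
  have h1 := inner_lt_one_iff_real_of_norm_eq_one (norm_sphere x) (norm_sphere y)
  have h2 := h1.mpr fun h3 => h (Subtype.ext h3.symm)
  rw [zonal_apply]; linarith

theorem zonal_le_one (x y : S2) : zonal x y ≤ 1 := by
  rcases eq_or_ne y x with rfl | h
  · exact (zonal_self y).le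
  · exact (zonal_lt_one h).le

theorem zonal_map (A : E3 ≃ₗᵢ[ℝ] E3) (x y : S2) :
    zonal (sphereMap A x) (sphereMap A y) = zonal x y := by
  simp only [zonal_apply, coe_sphereMap, LinearIsometryEquiv.inner_map_map]

/-- The operator with kernel `((1 + x·y)/2) ^ n`. -/
def zonalOp (n : ℕ) : C(S2, ℝ) →L[ℝ] C(S2, ℝ) :=
  LinearMap.mkContinuous
    { toFun := fun u => ⟨fun x => sphereInt (zonal x ^ n * u), by fun_prop⟩
      map_add' := fun u v => by ext x; simp [mul_add]
      map_smul' := fun c u => by ext x; simp }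
    (‖sphereInt‖ * ‖zonal‖ ^ n) fun u => by
    rw [ContinuousMap.norm_le _ (by positivity)]
    intro x
    refine (sphereInt.le_opNorm _).trans ?_
    rw [mul_assoc]
    refine mul_le_mul_of_nonneg_left ((norm_mul_le _ _).trans ?_) (norm_nonneg _)
    refine mul_le_mul_of_nonneg_right ((norm_pow_le (zonal x) n).trans ?_) (norm_nonneg _)
    exact pow_le_pow_left₀ (norm_nonneg _) (zonal.norm_coe_le_norm x) n

theorem zonalOp_apply (n : ℕ) (u : C(S2, ℝ)) (x : S2) :
    zonalOp n u x = ∫ y, zonal x y ^ n * u y ∂sphereMeasure := rfl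

/-- The kernel depends only on x·y and the measure is invariant, so the operator commutes with
isometries. This equivariance is inherited by `invLap` and `resolvent`. -/
theorem zonalOp_comp (n : ℕ) (A : E3 ≃ₗᵢ[ℝ] E3) (u : C(S2, ℝ)) (x : S2) :
    zonalOp n (u.comp (sphereMap A)) x = zonalOp n u (sphereMap A x) := by
  rw [zonalOp_apply, zonalOp_apply,
    ← integral_sphereMap A (f := fun y => zonal (sphereMap A x) y ^ n * u y) (by fun_prop)]
  simp only [zonal_map, ContinuousMap.comp_apply]

theorem zonalOp_symm (n : ℕ) (u v : C(S2, ℝ)) :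
    sphereInt (v * zonalOp n u) = sphereInt (u * zonalOp n v) := by
  have h1 : ∀ u v : C(S2, ℝ), sphereInt (v * zonalOp n u)
      = ∫ x, ∫ y, v x * (zonal x y ^ n * u y) ∂sphereMeasure ∂sphereMeasure := fun u v => by
    rw [sphereInt_apply]
    refine MeasureTheory.integral_congr_ae (Filter.Eventually.of_forall fun x => ?_)
    simp only [ContinuousMap.mul_apply, zonalOp_apply]
    rw [MeasureTheory.integral_const_mul]
  have hz : Continuous fun q : S2 × S2 => zonal q.1 q.2 := by
    simp only [zonal_apply]; fun_prop
  rw [h1, h1, MeasureTheory.integral_integral_swap_of_hasCompactSupport (by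
    show Continuous fun q : S2 × S2 => v q.1 * (zonal q.1 q.2 ^ n * u q.2)
    fun_prop) (HasCompactSupport.of_compactSpace _)]
  refine MeasureTheory.integral_congr_ae (Filter.Eventually.of_forall fun x => ?_)
  refine MeasureTheory.integral_congr_ae (Filter.Eventually.of_forall fun y => ?_)
  simp only [zonal_comm y x]
  ring

/-! ### The Laplacian of the zonal kernels -/

namespace SphereCalculus

variable {A : Type*} [CommRing A] [Algebra ℝ A] (S : SphereCalculus A)

/-- For z = (1 + a·x)/2 one has Δz = 1 − 2z and |∇z|² = z(1 − z); the product rule for the Laplacian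
then gives the powers by induction. The element c plays the role of 1/2 in the ring. -/
theorem lap_zonal_pow {a : Fin 3 → A} (ha : ∀ i j, S.D i (a j) = 0)
    (ha1 : a 0 * a 0 + a 1 * a 1 + a 2 * a 2 = 1) {c : A} (hc : 2 * c = 1)
    (hcD : ∀ i, S.D i c = 0) {z : A}
    (hz : z = c * (1 + (a 0 * S.x 0 + a 1 * S.x 1 + a 2 * S.x 2))) (n : ℕ) :
    S.lap (z ^ (n + 1)) = (n + 1) ^ 2 * z ^ n - (n + 1) * (n + 2) * z ^ (n + 1) := by
  have hD : ∀ i, S.D i z = c * (a i - S.x i * (a 0 * S.x 0 + a 1 * S.x 1 + a 2 * S.x 2)) := by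
    intro i
    rw [hz]
    simp only [Derivation.leibniz, map_add, smul_eq_mul, ha, hcD, Derivation.map_one_eq_zero, S.D_x]
    linear_combination c * sum_delta' i a
  have hlap : S.lap z = 1 - 2 * z := by
    have h1 := S.lap_x
    simp only [lap] at h1
    have h2 : S.lap z = c * (a 0 * S.lap (S.x 0) + a 1 * S.lap (S.x 1) + a 2 * S.lap (S.x 2)) := by
      rw [hz]
      simp only [lap, Derivation.leibniz, map_add, smul_eq_mul, ha, hcD,
        Derivation.map_one_eq_zero, map_zero]
      ring
    rw [h2, S.lap_x, S.lap_x, S.lap_x, hz]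
    linear_combination hc
  have hg : S.D 0 z * S.D 0 z + S.D 1 z * S.D 1 z + S.D 2 z * S.D 2 z = z * (1 - z) := by
    rw [hD, hD, hD, hz]
    set s := a 0 * S.x 0 + a 1 * S.x 1 + a 2 * S.x 2 with hs
    linear_combination c ^ 2 * ha1 + c ^ 2 * s ^ 2 * S.x_sq + (c * (1 + s)) * hc + 2 * c ^ 2 * s * hs
  have hE : ∀ n : ℕ, S.D 0 (z ^ (n + 1)) * S.D 0 z + S.D 1 (z ^ (n + 1)) * S.D 1 z
      + S.D 2 (z ^ (n + 1)) * S.D 2 z = (n + 1) * z ^ (n + 1) * (1 - z) := fun n => by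
    simp only [Derivation.leibniz_pow, smul_eq_mul, nsmul_eq_mul, Nat.add_sub_cancel]
    push_cast
    linear_combination (n + 1) * z ^ n * hg
  induction n with
  | zero => simp [hlap]
  | succ n ih =>
    rw [pow_succ z (n + 1), S.lap_mul, ih, hlap, hE]
    push_cast
    ring

end SphereCalculus

variable {M : ℝ}

namespace SF

/-- The restriction of a smooth function to a sphere of symmetry. -/
def sl (u : SF M) (t : ℝ) (r : Set.Ici (2 * M)) : C(S2, ℝ) :=
  ⟨fun y => (u : Scal M) (t, r, y), u.smooth.continuous_sphere t r⟩

theorem sl_apply (u : SF M) (t : ℝ) (r : Set.Ici (2 * M)) (y : S2) :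
    u.sl t r y = (u : Scal M) (t, r, y) := rfl

/-- The zonal function with pole `a`. -/
def zonalFun (a : S2) : SF M :=
  algebraMap ℝ (SF M) (1 / 2) * (1 + (algebraMap ℝ (SF M) ((a : E3) 0) * x 0
    + algebraMap ℝ (SF M) ((a : E3) 1) * x 1 + algebraMap ℝ (SF M) ((a : E3) 2) * x 2))

theorem zonalFun_apply (a : S2) (t : ℝ) (r : Set.Ici (2 * M)) (y : S2) :
    (zonalFun a : SF M).val (t, r, y) = zonal a y := by
  rw [zonal_apply, PiLp.inner_apply, Fin.sum_univ_three]
  change (1 / 2 : ℝ) * (1 + ((a : E3) 0 * (y : E3) 0 + (a : E3) 1 * (y : E3) 1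
    + (a : E3) 2 * (y : E3) 2)) = _
  simp only [RCLike.inner_apply, conj_trivial]
  ring

theorem lap_zonalFun_pow (a : S2) (n : ℕ) :
    lap ((zonalFun a : SF M) ^ (n + 1)) = ((n : SF M) + 1) ^ 2 * (zonalFun a : SF M) ^ n
      - ((n : SF M) + 1) * ((n : SF M) + 2) * (zonalFun a : SF M) ^ (n + 1) :=
  sphere.lap_zonal_pow (a := fun i => algebraMap ℝ (SF M) ((a : E3) i))
    (fun i j => Derivation.map_algebraMap _ _) (by
      have h := norm_sphere a
      rw [EuclideanSpace.norm_eq, Real.sqrt_eq_one] at h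
      simp only [Fin.sum_univ_three, Real.norm_eq_abs, sq_abs] at h
      have h1 := congrArg (algebraMap ℝ (SF M)) h
      simp only [map_add, map_pow, map_one] at h1
      linear_combination h1)
    (by
      have h1 : algebraMap ℝ (SF M) (2 * (1 / 2)) = algebraMap ℝ (SF M) 1 := by norm_num
      rwa [map_mul, map_one, map_ofNat] at h1)
    (fun i => Derivation.map_algebraMap _ _) rfl n

theorem J_zonal (a : S2) (n : ℕ) (u : SF M) (t : ℝ) (r : Set.Ici (2 * M)) (y : S2) :
    (J (zonalFun a ^ n * u) : Scal M) (t, r, y) = zonalOp n (u.sl t r) a := by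
  rw [zonalOp_apply]
  refine MeasureTheory.integral_congr_ae (Filter.Eventually.of_forall fun y => ?_)
  change (zonalFun a : SF M).val (t, r, y) ^ n * _ = _
  rw [zonalFun_apply]; rfl

/-- Self-adjointness moves the Laplacian from u onto the kernel. Divided by n + 1, the right side is
a difference of consecutive values of (n+1) Z_n u, where Z_n is `zonalOp n`; `invLap_lap` telescopes
it. -/
theorem zonalOp_lap (n : ℕ) (u : SF M) (t : ℝ) (r : Set.Ici (2 * M)) (a : S2) :
    zonalOp (n + 1) ((lap u).sl t r) a
      = (n + 1) ^ 2 * zonalOp n (u.sl t r) a - (n + 1) * (n + 2) * zonalOp (n + 1) (u.sl t r) a := by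
  have h : J (zonalFun a ^ (n + 1) * lap u)
      = ((n + 1 : ℝ) ^ 2) • J (zonalFun a ^ n * u)
        - ((n + 1 : ℝ) * (n + 2)) • J (zonalFun a ^ (n + 1) * u) := by
    rw [J_lap_comm, lap_zonalFun_pow, ← map_smul, ← map_smul, ← map_sub]
    congr 1
    simp only [Algebra.smul_def, map_mul, map_pow, map_add, map_natCast, map_one, map_ofNat]
    ring
  have h1 := congrFun (congrArg SF.val h) (t, r, a)
  rw [J_zonal] at h1
  rw [h1]
  change (n + 1 : ℝ) ^ 2 * (J (zonalFun a ^ n * u) : Scal M) (t, r, a)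
    - (n + 1 : ℝ) * (n + 2) * (J (zonalFun a ^ (n + 1) * u) : Scal M) (t, r, a) = _
  rw [J_zonal, J_zonal]

end SF

end

end LinGrav

namespace LinGrav

noncomputable section

/-! ### An inverse of the Laplacian of the unit sphere -/

instance : NormedAddCommGroup (C(S2, ℝ) →L[ℝ] C(S2, ℝ)) :=
  ContinuousLinearMap.toNormedAddCommGroup

instance : NormedSpace ℝ (C(S2, ℝ) →L[ℝ] C(S2, ℝ)) := ContinuousLinearMap.toNormedSpace

theorem area_ne : area ≠ 0 := area_pos.ne'

/-- The Cartesian coordinates as continuous functions on the sphere. -/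
def coord (i : Fin 3) : C(S2, ℝ) := ⟨fun y => (y : E3) i, by fun_prop⟩

theorem coord_apply (i : Fin 3) (y : S2) : coord i y = (y : E3) i := rfl

theorem sl_one (t : ℝ) (r : Set.Ici (2 * (0 : ℝ))) : (1 : SF 0).sl t r = 1 := rfl

theorem sl_x (i : Fin 3) (t : ℝ) (r : Set.Ici (2 * (0 : ℝ))) :
    (SF.x i : SF 0).sl t r = coord i := rfl

theorem zonalOp_zero (u : C(S2, ℝ)) (x : S2) : zonalOp 0 u x = sphereInt u := by
  simp [zonalOp_apply, sphereInt_apply]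

theorem zonal_eq (x y : S2) : zonal x y
    = (1 + (coord 0 x * coord 0 y + coord 1 x * coord 1 y + coord 2 x * coord 2 y)) / 2 := by
  rw [zonal_apply, PiLp.inner_apply, Fin.sum_univ_three]
  simp only [RCLike.inner_apply, conj_trivial, coord_apply]
  ring

theorem zonalOp_one (u : C(S2, ℝ)) (x : S2) :
    zonalOp 1 u x = (sphereInt u + (coord 0 x * sphereInt (coord 0 * u)
      + coord 1 x * sphereInt (coord 1 * u) + coord 2 x * sphereInt (coord 2 * u))) / 2 := by
  have h : zonalOp 1 u x = sphereInt ((1 / 2 : ℝ) • (u + (coord 0 x • (coord 0 * u)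
      + coord 1 x • (coord 1 * u) + coord 2 x • (coord 2 * u)))) := by
    rw [zonalOp_apply, sphereInt_apply]
    refine MeasureTheory.integral_congr_ae (Filter.Eventually.of_forall fun y => ?_)
    simp only [zonal_eq, ContinuousMap.smul_apply, ContinuousMap.add_apply, ContinuousMap.mul_apply,
      smul_eq_mul]
    ring
  rw [h]
  simp only [map_smul, map_add, smul_eq_mul]
  ring

theorem sphereInt_one : sphereInt 1 = area := by
  rw [sphereInt_apply]; simp [area]

theorem zonalOp_const (n : ℕ) (x : S2) : zonalOp n 1 x = area / (n + 1) := by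
  induction n with
  | zero => rw [zonalOp_zero, sphereInt_one]; simp
  | succ n ih =>
    -- The ring with M = 0 serves as an auxiliary smooth structure: a statement about the sphere
    -- alone is read off at one of its points.
    have h := SF.zonalOp_lap n (1 : SF 0) 0 ⟨0, by simp⟩ x
    have h0 : SF.lap (1 : SF 0) = 0 := by
      simp only [SF.lap, SphereCalculus.lap, Derivation.map_one_eq_zero, map_zero, add_zero]
    have h1 : (0 : SF 0).sl 0 ⟨0, by simp⟩ = 0 := rfl
    rw [h0, h1, map_zero, ContinuousMap.zero_apply, sl_one, ih] at h
    push_cast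
    have h2 : (n : ℝ) + 1 ≠ 0 := by positivity
    have h3 : (n : ℝ) + 1 + 1 ≠ 0 := by positivity
    rw [eq_div_iff h3]
    have h5 : ((n : ℝ) + 1) ^ 2 * (area / (n + 1)) = (n + 1) * area := by field_simp
    have h4 : (n + 1 : ℝ) * (zonalOp (n + 1) 1 x * (n + 1 + 1) - area) = 0 := by
      linear_combination h5 + h
    have := (mul_eq_zero.mp h4).resolve_left h2
    linarith

theorem sphereInt_coord_mul (i j : Fin 3) :
    sphereInt (coord i * coord j) = if i = j then area / 3 else 0 := by
  have h1 : 3 * SF.J (SF.x i * SF.x j : SF 0) = if i = j then SF.J 1 else 0 := by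
    have h := SF.J_D i (SF.x j : SF 0)
    rw [SF.D_x, map_sub] at h
    split_ifs at h ⊢
    · linear_combination -h
    · rw [map_zero] at h; linear_combination -h
  have h2 := congrFun (congrArg SF.val h1) (0, ⟨0, by simp⟩, Classical.arbitrary S2)
  have h3 : (3 * SF.J (SF.x i * SF.x j : SF 0)).val (0, ⟨0, by simp⟩, Classical.arbitrary S2)
      = 3 * sphereInt (coord i * coord j) := rfl
  rw [h3] at h2
  split_ifs at h2 ⊢
  · have h4 : (SF.J (1 : SF 0)).val (0, ⟨0, by simp⟩, Classical.arbitrary S2)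
      = sphereInt 1 := rfl
    rw [h4, sphereInt_one] at h2
    linarith
  · have h4 : (0 : SF 0).val (0, ⟨0, by simp⟩, Classical.arbitrary S2) = 0 := rfl
    rw [h4] at h2
    linarith

theorem sphereInt_coord (i : Fin 3) : sphereInt (coord i) = 0 := by
  have h := SF.J_D i (1 : SF 0)
  rw [Derivation.map_one_eq_zero, map_zero, mul_one] at h
  have h2 := congrFun (congrArg SF.val h) (0, ⟨0, by simp⟩, Classical.arbitrary S2)
  have h3 : (2 * SF.J (SF.x i : SF 0)).val (0, ⟨0, by simp⟩, Classical.arbitrary S2)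
      = 2 * sphereInt (coord i) := rfl
  have h4 : (0 : SF 0).val (0, ⟨0, by simp⟩, Classical.arbitrary S2) = 0 := rfl
  rw [h3, h4] at h2
  linarith

/-- Since Δx_i = −2x_i, the identity `zonalOp_lap` becomes a two-term recursion for the eigenvalue
on l = 1. -/
theorem zonalOp_coord (n : ℕ) (i : Fin 3) (x : S2) :
    zonalOp (n + 1) (coord i) x = area * (n + 1) / ((n + 2) * (n + 3)) * coord i x := by
  induction n with
  | zero =>
    rw [zonalOp_one, sphereInt_coord, sphereInt_coord_mul, sphereInt_coord_mul,
      sphereInt_coord_mul]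
    fin_cases i <;> simp <;> ring
  | succ n ih =>
    have h := SF.zonalOp_lap (n + 1) (SF.x i : SF 0) 0 ⟨0, by simp⟩ x
    have h0 : SF.lap (SF.x i : SF 0) = -2 * SF.x i := SF.sphere.lap_x i
    have h1 : (-2 * SF.x i : SF 0).sl 0 ⟨0, by simp⟩ = (-2 : ℝ) • coord i := rfl
    rw [h0, h1, map_smul, ContinuousMap.smul_apply, sl_x, ih, smul_eq_mul] at h
    push_cast at h ⊢
    -- The factor is (n+2)(n+3) − 2, the coefficient of the unknown in the recursion.
    have h2 : ((n : ℝ) + 1) * (n + 4) ≠ 0 := by positivity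
    refine mul_left_cancel₀ h2 ?_
    have h3 : ((n : ℝ) + 1) * (n + 4) * zonalOp (n + 1 + 1) (coord i) x
        = (n + 2) ^ 2 * (area * (n + 1) / ((n + 2) * (n + 3)) * coord i x) := by
      linear_combination h
    rw [h3]
    field_simp
    ring

theorem abs_integral_mul_le {φ : S2 → ℝ} (hφ : Continuous φ) (h0 : ∀ y, 0 ≤ φ y) (u : C(S2, ℝ)) :
    |∫ y, φ y * u y ∂sphereMeasure| ≤ (∫ y, φ y ∂sphereMeasure) * ‖u‖ := by
  rw [← MeasureTheory.integral_mul_const]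
  refine MeasureTheory.norm_integral_le_of_norm_le (f := fun y => φ y * u y)
    (g := fun y => φ y * ‖u‖) (integrable_sphere (hφ.mul continuous_const)) (Filter.Eventually.of_forall fun y => ?_)
  rw [norm_mul, Real.norm_of_nonneg (h0 y)]
  exact mul_le_mul_of_nonneg_left (u.norm_coe_le_norm y) (h0 y)

theorem integral_zonal_pow (n : ℕ) (x : S2) :
    ∫ y, zonal x y ^ n ∂sphereMeasure = area / (n + 1) := by
  rw [← zonalOp_const n x, zonalOp_apply]; simp

theorem norm_zonalOp_le (n : ℕ) : ‖zonalOp n‖ ≤ area / (n + 1) := by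
  have := area_pos
  refine ContinuousLinearMap.opNorm_le_bound _ (by positivity) fun u => ?_
  rw [ContinuousMap.norm_le _ (by positivity)]
  intro x
  have h := abs_integral_mul_le (φ := fun y => zonal x y ^ n) (by fun_prop)
    (fun y => pow_nonneg (zonal_nonneg x y) n) u
  rwa [integral_zonal_pow] at h

/-- The kernel z − z² has one sign because 0 ≤ z ≤ 1, so the norm is at most its integral, area·(1/2
− 1/3). -/
theorem norm_zonalOp_sub_le : ‖zonalOp 2 - zonalOp 1‖ ≤ area / 6 := by
  have := area_pos
  refine ContinuousLinearMap.opNorm_le_bound _ (by positivity) fun u => ?_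
  rw [ContinuousMap.norm_le _ (by positivity)]
  intro x
  have h := abs_integral_mul_le (φ := fun y => zonal x y ^ 1 - zonal x y ^ 2) (by fun_prop)
    (fun y => by nlinarith [zonal_nonneg x y, zonal_le_one x y]) u
  rw [MeasureTheory.integral_sub (integrable_sphere (by fun_prop)) (integrable_sphere (by fun_prop)),
    integral_zonal_pow, integral_zonal_pow] at h
  have h2 : (∫ y, (zonal x y ^ 1 - zonal x y ^ 2) * u y ∂sphereMeasure)
      = zonalOp 1 u x - zonalOp 2 u x := by
    rw [zonalOp_apply, zonalOp_apply, ← MeasureTheory.integral_sub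
      (integrable_sphere (by fun_prop)) (integrable_sphere (by fun_prop))]
    simp only [sub_mul]
  rw [h2, abs_sub_comm] at h
  refine h.trans (le_of_eq ?_)
  push_cast
  ring

theorem hasSum_telescope {a : ℝ} (ha : 0 < a) :
    HasSum (fun n : ℕ => 1 / (((n : ℝ) + a) * (n + a + 1))) (1 / a) := by
  rw [hasSum_iff_tendsto_nat_of_nonneg fun n => by positivity]
  have h : ∀ N : ℕ, ∑ n ∈ Finset.range N, 1 / (((n : ℝ) + a) * (n + a + 1))
      = 1 / a - 1 / ((N : ℝ) + a) := fun N => by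
    induction N with
    | zero => simp
    | succ N ih =>
      rw [Finset.sum_range_succ, ih]
      push_cast
      field_simp
      ring
  simp only [h]
  have h1 : Filter.Tendsto (fun N : ℕ => 1 / ((N : ℝ) + a)) Filter.atTop (nhds 0) := by
    simp only [one_div]
    exact (Filter.tendsto_atTop_add_const_right _ a tendsto_natCast_atTop_atTop).inv_tendsto_atTop
  simpa using tendsto_const_nhds.sub h1

theorem norm_term_le (n : ℕ) : ‖(1 / ((n : ℝ) + 3)) • zonalOp (n + 3)‖
    ≤ area * (1 / (((n : ℝ) + 3) * (n + 3 + 1))) := by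
  rw [norm_smul, Real.norm_of_nonneg (by positivity)]
  refine (mul_le_mul_of_nonneg_left (norm_zonalOp_le _) (by positivity)).trans (le_of_eq ?_)
  push_cast
  field_simp

/-- The series `∑_{n ≥ 3} Z_n / n` of zonal operators. -/
def zonalSeries : C(S2, ℝ) →L[ℝ] C(S2, ℝ) := ∑' n : ℕ, (1 / ((n : ℝ) + 3)) • zonalOp (n + 3)

theorem hasSum_zonalSeries :
    HasSum (fun n : ℕ => (1 / ((n : ℝ) + 3)) • zonalOp (n + 3)) zonalSeries :=
  (Summable.of_norm_bounded ((hasSum_telescope (by norm_num)).mul_left area).summable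
    norm_term_le).hasSum

theorem norm_zonalSeries_le : ‖zonalSeries‖ ≤ area / 3 := by
  have := tsum_of_norm_bounded ((hasSum_telescope (a := 3) (by norm_num)).mul_left area)
    norm_term_le
  rwa [mul_one_div] at this

/-- The inverse of the Laplacian of the unit sphere on functions orthogonal to the spherical
harmonics with `l = 0, 1`. -/
def invLap : C(S2, ℝ) →L[ℝ] C(S2, ℝ) :=
  -(area⁻¹ • ((1 / 2 : ℝ) • (zonalOp 2 - zonalOp 1) + zonalSeries))

/-- On Λ the operator Z_1 = `zonalOp 1` vanishes, so its coefficient is free. Taking −1/2 pairs it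
with Z_2/2 and gives 1/12 + 1/3 = 5/12. Omitting Z_1 would only give the bound 1/2, which does not
make c·`invLap` a contraction when |c| = 2. -/
theorem norm_invLap_le : ‖invLap‖ ≤ 5 / 12 := by
  have ha := area_pos
  rw [invLap, norm_neg, norm_smul, norm_inv, Real.norm_of_nonneg ha.le, inv_mul_le_iff₀ ha]
  have h1 : ‖(1 / 2 : ℝ) • (zonalOp 2 - zonalOp 1)‖ ≤ 1 / 2 * (area / 6) := by
    rw [norm_smul, Real.norm_of_nonneg (by norm_num)]
    exact mul_le_mul_of_nonneg_left norm_zonalOp_sub_le (by norm_num)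
  have := norm_add_le_of_le h1 norm_zonalSeries_le
  linarith

/-- The series converges in operator norm, so two continuous functionals agree on `invLap` as soon
as they agree on every `zonalOp n`. -/
theorem invLap_congr {φ ψ : (C(S2, ℝ) →L[ℝ] C(S2, ℝ)) →L[ℝ] ℝ}
    (h : ∀ n, φ (zonalOp n) = ψ (zonalOp n)) : φ invLap = ψ invLap := by
  have h1 : φ zonalSeries = ψ zonalSeries := by
    have h2 := hasSum_zonalSeries.mapL φ
    have h3 := hasSum_zonalSeries.mapL ψ
    simp only [map_smul, h] at h2 h3
    exact h2.unique h3
  simp only [invLap, map_neg, map_smul, map_add, map_sub, h, h1]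

theorem invLap_comp (A : E3 ≃ₗᵢ[ℝ] E3) (u : C(S2, ℝ)) :
    invLap (u.comp (sphereMap A)) = (invLap u).comp (sphereMap A) := by
  ext x
  exact invLap_congr
    (φ := (ContinuousMap.evalCLM ℝ x).comp (ContinuousLinearMap.apply ℝ _ (u.comp (sphereMap A))))
    (ψ := (ContinuousMap.evalCLM ℝ (sphereMap A x)).comp (ContinuousLinearMap.apply ℝ _ u))
    fun n => zonalOp_comp n A u x

theorem invLap_symm (u v : C(S2, ℝ)) : sphereInt (v * invLap u) = sphereInt (u * invLap v) :=
  invLap_congr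
    (φ := (sphereInt.comp (ContinuousLinearMap.mul ℝ _ v)).comp (ContinuousLinearMap.apply ℝ _ u))
    (ψ := (sphereInt.comp (ContinuousLinearMap.mul ℝ _ u)).comp (ContinuousLinearMap.apply ℝ _ v))
    fun n => zonalOp_symm n u v

theorem invLap_of_hasSum {u : C(S2, ℝ)} {x : S2} {s : ℝ}
    (h : HasSum (fun n : ℕ => 1 / ((n : ℝ) + 3) * zonalOp (n + 3) u x) s) :
    invLap u x = -(area⁻¹ * (1 / 2 * (zonalOp 2 u x - zonalOp 1 u x) + s)) := by
  have h1 := hasSum_zonalSeries.mapL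
    ((ContinuousMap.evalCLM ℝ x).comp (ContinuousLinearMap.apply ℝ _ u))
  have h2 : zonalSeries u x = s := h1.unique h
  rw [← h2]; rfl

/-- Outside Λ the operator is not an inverse of Δ. It is enough that constants, and by
`invLap_coord` the coordinates, are eigenvectors: together with self-adjointness this preserves
orthogonality to l = 0, 1. -/
theorem invLap_one : invLap 1 = (-(1 / 4) : ℝ) • 1 := by
  ext x
  rw [invLap_of_hasSum (s := area * (1 / 3))]
  · have := area_ne
    simp only [zonalOp_const, ContinuousMap.smul_apply, ContinuousMap.one_apply]
    push_cast
    field_simp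
    norm_num
  · refine ((hasSum_telescope (a := 3) (by norm_num)).mul_left area).congr_fun fun n => ?_
    rw [zonalOp_const]
    push_cast
    field_simp

theorem invLap_coord (i : Fin 3) : invLap (coord i) = (-(1 / 4) : ℝ) • coord i := by
  ext x
  rw [invLap_of_hasSum (s := area * coord i x * (1 / 4))]
  · have := area_ne
    simp only [zonalOp_coord, ContinuousMap.smul_apply, smul_eq_mul]
    push_cast
    field_simp
    ring
  · refine ((hasSum_telescope (a := 4) (by norm_num)).mul_left (area * coord i x)).congr_fun
      fun n => ?_
    rw [zonalOp_coord (n + 2)]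
    push_cast
    field_simp
    ring

/-- The kernel zⁿ has total mass area/(n+1) and its only maximum on the sphere is at y = x, so after
normalisation it is an approximate identity. -/
theorem tendsto_zonalOp (u : C(S2, ℝ)) (x : S2) :
    Filter.Tendsto (fun n : ℕ => ((n : ℝ) + 1) * zonalOp n u x) Filter.atTop
      (nhds (area * u x)) := by
  have h := tendsto_setIntegral_pow_smul_of_unique_maximum_of_isCompact_of_continuousOn
    (μ := sphereMeasure) (s := Set.univ) (c := zonal x) (g := u) (x₀ := x) isCompact_univ
    (by fun_prop) (fun y _ hy => by rw [zonal_self]; exact zonal_lt_one hy)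
    (fun y _ => zonal_nonneg x y) (by rw [zonal_self]; norm_num) (by simp) (by fun_prop)
  simp only [MeasureTheory.Measure.restrict_univ, integral_zonal_pow, smul_eq_mul] at h
  refine (h.const_mul area).congr fun n => ?_
  rw [← zonalOp_apply]
  have := area_ne
  field_simp

/-! ### The zonal series inverts the Laplacian on Λ. -/

namespace SF

variable {M : ℝ}

theorem Lam.sphereInt_sl {u : SF M} (hu : Lam u) (t : ℝ) (r : Set.Ici (2 * M)) :
    sphereInt (u.sl t r) = 0 :=
  congrFun (congrArg SF.val hu.1) (t, r, Classical.arbitrary S2)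

theorem Lam.sphereInt_coord_sl {u : SF M} (hu : Lam u) (t : ℝ) (r : Set.Ici (2 * M)) (i : Fin 3) :
    sphereInt (coord i * u.sl t r) = 0 :=
  congrFun (congrArg SF.val (hu.2 i)) (t, r, Classical.arbitrary S2)

theorem lam_iff_sl (u : SF M) : Lam u ↔ ∀ t r, sphereInt (u.sl t r) = 0 ∧
    ∀ i, sphereInt (coord i * u.sl t r) = 0 :=
  ⟨fun h t r => ⟨h.sphereInt_sl t r, h.sphereInt_coord_sl t r⟩, fun h =>
    ⟨SF.ext (funext fun p => (h p.1 p.2.1).1), fun i => SF.ext (funext fun p => (h p.1 p.2.1).2 i)⟩⟩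

/-- By `zonalOp_lap` the partial sums telescope to 3 Z_2 u − (N+3) Z_{N+2} u, where Z_n is `zonalOp
n`, with limit 3 Z_2 u − area·u. On Λ one has Z_0 u = Z_1 u = 0, hence Z_1 Δu = 0 and Z_2 Δu = −6
Z_2 u, so the two leading terms of `invLap` cancel 3 Z_2 u. -/
theorem invLap_lap {u : SF M} (hu : Lam u) (t : ℝ) (r : Set.Ici (2 * M)) :
    invLap ((lap u).sl t r) = u.sl t r := by
  ext x
  set v := u.sl t r with hv
  have h0 : zonalOp 0 v x = 0 := by rw [zonalOp_zero, hu.sphereInt_sl]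
  have h1 : zonalOp 1 v x = 0 := by
    rw [zonalOp_one, hu.sphereInt_sl, hu.sphereInt_coord_sl, hu.sphereInt_coord_sl,
      hu.sphereInt_coord_sl]
    simp
  have e : ∀ n, zonalOp (n + 1) ((lap u).sl t r) x
      = (n + 1) ^ 2 * zonalOp n v x - (n + 1) * (n + 2) * zonalOp (n + 1) v x := fun n =>
    zonalOp_lap n u t r x
  have hsum : HasSum (fun n : ℕ => 1 / ((n : ℝ) + 3) * zonalOp (n + 3) ((lap u).sl t r) x)
      (3 * zonalOp 2 v x - area * v x) := by
    have hs := (hasSum_zonalSeries.mapL ((ContinuousMap.evalCLM ℝ x).comp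
      (ContinuousLinearMap.apply ℝ _ ((lap u).sl t r)))).summable
    refine (Summable.hasSum_iff_tendsto_nat hs).mpr ?_
    have h2 : ∀ N : ℕ, ∑ n ∈ Finset.range N,
        1 / ((n : ℝ) + 3) * zonalOp (n + 3) ((lap u).sl t r) x
        = 3 * zonalOp 2 v x - (((N + 2 : ℕ) : ℝ) + 1) * zonalOp (N + 2) v x := fun N => by
      induction N with
      | zero => norm_num
      | succ N ih =>
        rw [Finset.sum_range_succ, ih, e (N + 2)]
        push_cast
        field_simp
        ring
    refine Filter.Tendsto.congr (fun N => (h2 N).symm) (tendsto_const_nhds.sub ?_)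
    exact (tendsto_zonalOp v x).comp (Filter.tendsto_add_atTop_nat 2)
  rw [invLap_of_hasSum hsum, e 0, e 1, h0, h1]
  have := area_ne
  push_cast
  field_simp
  ring

end SF

end

end LinGrav

namespace LinGrav

noncomputable section

/-! ### Inverting `Δ + c` -/

theorem norm_smul_invLap_le {s : ℝ} (hs : |s| ≤ 2) : ‖s • invLap‖ ≤ 5 / 6 := by
  rw [norm_smul, Real.norm_eq_abs]
  have := mul_le_mul hs norm_invLap_le (norm_nonneg _) (by norm_num)
  linarith

theorem eq_zero_of_add_invLap {s : ℝ} (hs : |s| ≤ 2) {u : C(S2, ℝ)} (h : u + s • invLap u = 0) :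
    u = 0 := by
  have h1 : ‖u‖ ≤ 5 / 6 * ‖u‖ := by
    have h2 : u = -((s • invLap) u) := eq_neg_of_add_eq_zero_left h
    calc ‖u‖ = ‖(s • invLap) u‖ := by conv_lhs => rw [h2, norm_neg]
      _ ≤ _ := (s • invLap).le_of_opNorm_le (norm_smul_invLap_le hs) u
  exact norm_eq_zero.mp (by linarith [norm_nonneg u])

theorem isUnit_one_add_invLap {s : ℝ} (hs : |s| ≤ 2) :
    IsUnit (1 + s • invLap : C(S2, ℝ) →L[ℝ] C(S2, ℝ)) := by
  have h := isUnit_one_sub_of_norm_lt_one (x := (-(s • invLap) : C(S2, ℝ) →L[ℝ] C(S2, ℝ)))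
    (by rw [norm_neg]; exact (norm_smul_invLap_le hs).trans_lt (by norm_num))
  rwa [sub_neg_eq_add] at h

/-- The operator `(1 + sK)⁻¹ K`, where `K` is the inverse of the Laplacian. -/
def resolvent (s : ℝ) : C(S2, ℝ) →L[ℝ] C(S2, ℝ) := Ring.inverse (1 + s • invLap) * invLap

theorem resolvent_spec {s : ℝ} (hs : |s| ≤ 2) (f : C(S2, ℝ)) :
    resolvent s f + s • invLap (resolvent s f) = invLap f := by
  have h := Ring.mul_inverse_cancel _ (isUnit_one_add_invLap hs)
  have h1 : (1 + s • invLap) * resolvent s = invLap := by rw [resolvent, ← mul_assoc, h, one_mul]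
  exact congrArg (fun T : C(S2, ℝ) →L[ℝ] C(S2, ℝ) => T f) h1

/-- Both sides solve the same equation v + s·`invLap` v = g, whose solution is unique. -/
theorem resolvent_comp {s : ℝ} (hs : |s| ≤ 2) (A : E3 ≃ₗᵢ[ℝ] E3) (f : C(S2, ℝ)) :
    resolvent s (f.comp (sphereMap A)) = (resolvent s f).comp (sphereMap A) := by
  have h1 := resolvent_spec hs (f.comp (sphereMap A))
  have h2 : (resolvent s f).comp (sphereMap A)
      + s • invLap ((resolvent s f).comp (sphereMap A)) = invLap (f.comp (sphereMap A)) := by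
    rw [invLap_comp, invLap_comp, ← resolvent_spec hs f]; rfl
  rw [← sub_eq_zero]
  refine eq_zero_of_add_invLap hs ?_
  rw [map_sub, smul_sub, sub_add_sub_comm, h1, h2, sub_self]

/-- Inversion in a Banach algebra is smooth at units, and the operator to be inverted is affine in
s. -/
theorem contDiffAt_resolvent {s : ℝ} (hs : |s| ≤ 2) : ContDiffAt ℝ ∞ resolvent s := by
  obtain ⟨U, hU⟩ := isUnit_one_add_invLap hs
  have h1 : ContDiffAt ℝ ∞ Ring.inverse (1 + s • invLap : C(S2, ℝ) →L[ℝ] C(S2, ℝ)) := by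
    rw [← hU]; exact contDiffAt_ringInverse (R := C(S2, ℝ) →L[ℝ] C(S2, ℝ)) ℝ U
  have h2 : ContDiffAt ℝ ∞ (fun s : ℝ => (1 + s • invLap : C(S2, ℝ) →L[ℝ] C(S2, ℝ))) s := by fun_prop
  have h3 : ContDiffAt ℝ ∞
      (Ring.inverse ∘ fun s : ℝ => (1 + s • invLap : C(S2, ℝ) →L[ℝ] C(S2, ℝ))) s :=
    ContDiffAt.comp s h1 h2
  exact h3.clm_comp contDiffAt_const

/-- Pairing the resolvent equation with e gives (1 − s/4)∫ e u = 0, and s ≤ 2 keeps the factor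
positive. -/
theorem sphereInt_resolvent {s : ℝ} (hs : |s| ≤ 2) {e f : C(S2, ℝ)}
    (he : invLap e = (-(1 / 4) : ℝ) • e) (hf : sphereInt (e * f) = 0) :
    sphereInt (e * resolvent s f) = 0 := by
  have hk : ∀ v, sphereInt (e * invLap v) = -(1 / 4) * sphereInt (e * v) := fun v => by
    rw [invLap_symm, he, mul_smul_comm, map_smul, smul_eq_mul, mul_comm v]
  have h := congrArg (fun v => sphereInt (e * v)) (resolvent_spec hs f)
  simp only [mul_add, map_add, mul_smul_comm, map_smul, smul_eq_mul, hk, hf] at h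
  have h1 : (1 - s / 4) * sphereInt (e * resolvent s f) = 0 := by linarith
  refine (mul_eq_zero.mp h1).resolve_left ?_
  have := (abs_le.mp hs).2
  intro h2
  linarith

/-! ### Smooth families of rotations -/

/-- The reflection across the line spanned by `x + |x| e`, which maps `e` to `x / |x|`. -/
def rotTo (e : E3) (q : E3 × E3) : E3 :=
  (2 * (inner ℝ (q.1 + ‖q.1‖ • e) q.2 / ‖q.1 + ‖q.1‖ • e‖ ^ 2)) • (q.1 + ‖q.1‖ • e) - q.2

theorem rotTo_eq (e x y : E3) :
    rotTo e (x, y) = Submodule.reflection (ℝ ∙ (x + ‖x‖ • e)) y := by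
  rw [Submodule.reflection_singleton_apply, rotTo]
  simp only [RCLike.ofReal_real_eq_id, id_eq]
  rw [two_mul, two_smul, add_smul]

theorem rotTo_self {e x : E3} (he : ‖e‖ = 1) (hx : x ≠ 0) (hv : x + ‖x‖ • e ≠ 0) :
    rotTo e (x, e) = ‖x‖⁻¹ • x := by
  have hx' : ‖x‖ ≠ 0 := norm_ne_zero_iff.mpr hx
  have h1 : inner ℝ (x + ‖x‖ • e) e = inner ℝ x e + ‖x‖ := by
    rw [inner_add_left, inner_smul_left, real_inner_self_eq_norm_sq, he]; simp
  have h2 : ‖x + ‖x‖ • e‖ ^ 2 = 2 * ‖x‖ * (inner ℝ x e + ‖x‖) := by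
    rw [@norm_add_sq_real, inner_smul_right, norm_smul, he, norm_norm]; ring
  have h3 : inner ℝ x e + ‖x‖ ≠ 0 := fun h => by
    rw [h, mul_zero] at h2
    exact hv (norm_eq_zero.mp (pow_eq_zero_iff two_ne_zero |>.mp h2))
  simp only [rotTo]
  rw [h1, h2, show 2 * ((inner ℝ x e + ‖x‖) / (2 * ‖x‖ * (inner ℝ x e + ‖x‖))) = ‖x‖⁻¹ by
    field_simp, smul_add, smul_smul, inv_mul_cancel₀ hx', one_smul, add_sub_cancel_right]

theorem contDiffOn_rotTo (e : E3) :
    ContDiffOn ℝ ∞ (rotTo e) {q | q.1 ≠ 0 ∧ q.1 + ‖q.1‖ • e ≠ 0} := by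
  have h0 : ContDiffOn ℝ ∞ (fun q : E3 × E3 => ‖q.1‖) {q | q.1 ≠ 0 ∧ q.1 + ‖q.1‖ • e ≠ 0} :=
    contDiffOn_fst.norm ℝ fun q hq => hq.1
  have hv : ContDiffOn ℝ ∞ (fun q : E3 × E3 => q.1 + ‖q.1‖ • e)
      {q | q.1 ≠ 0 ∧ q.1 + ‖q.1‖ • e ≠ 0} := contDiffOn_fst.add (h0.smul contDiffOn_const)
  refine ContDiffOn.sub (ContDiffOn.smul (contDiffOn_const.mul
    (ContDiffOn.div (hv.inner ℝ contDiffOn_snd) (hv.norm_sq ℝ) fun q hq => ?_)) hv) contDiffOn_snd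
  exact pow_ne_zero 2 (norm_ne_zero_iff.mpr hq.2)

/-- On this ball the inner product of x′ with x is positive, so x′ is not antipodal in direction to
x and the reflection line of `rotTo` is defined. -/
theorem add_norm_smul_ne_zero {x x' : E3} (hx : x ≠ 0) (h : x' ∈ Metric.ball x ‖x‖) :
    x' + ‖x'‖ • (‖x‖⁻¹ • x) ≠ 0 := by
  have hx' : 0 < ‖x‖ := norm_pos_iff.mpr hx
  rw [Metric.mem_ball, dist_eq_norm] at h
  have h1 : 0 < inner ℝ x' x := by
    have h2 := real_inner_le_norm (x - x') x
    rw [inner_sub_left, real_inner_self_eq_norm_sq, norm_sub_rev] at h2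
    nlinarith
  intro h0
  have h3 : inner ℝ (x' + ‖x'‖ • (‖x‖⁻¹ • x)) x = 0 := by rw [h0, inner_zero_left]
  rw [inner_add_left, inner_smul_left, inner_smul_left, real_inner_self_eq_norm_sq] at h3
  simp only [conj_trivial] at h3
  have h4 : 0 ≤ ‖x'‖ * (‖x‖⁻¹ * ‖x‖ ^ 2) := by positivity
  linarith

/-! ### Smooth solutions of Δu + cu = f in Λ. -/

namespace SF

variable {M : ℝ}

/-- The solution of `Δu + cu = f` on the spheres of symmetry. -/
def sol (c f : SF M) : Scal M := fun p => resolvent (c.val p) (f.sl p.1 p.2.1) p.2.2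

/-- Regularity in the point x of the sphere comes from symmetry instead of elliptic estimates. Near
a base direction e, a smooth family of reflections A_x maps e to x/|x|, and equivariance gives u(x)
= (`resolvent c` (f ∘ A_x))(e). Now f ∘ A_x is a smooth C(S²)-valued function of (t, r, x), the
resolvent is smooth in c, and evaluation at e is linear. -/
theorem smooth_sol {c f : SF M} (hb : ∀ p, |c.val p| ≤ 2) : Smooth (sol c f) := by
  intro p hp
  obtain ⟨t, r, x⟩ := p
  have hx : x ≠ 0 := hp.2
  set e : S2 := ⟨‖x‖⁻¹ • x, normalize_mem hx⟩ with he
  set N : Set (ℝ × ℝ × E3) := Set.univ ×ˢ (Set.Ici (2 * M) ×ˢ Metric.ball x ‖x‖) with hN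
  have hne : ∀ q ∈ N, q.2.2 ≠ 0 := fun q hq h0 => by
    have := hq.2.2
    rw [h0, Metric.mem_ball, dist_zero_left] at this
    exact this.false
  have hv : ∀ q ∈ N, q.2.2 + ‖q.2.2‖ • (e : E3) ≠ 0 := fun q hq =>
    add_norm_smul_ne_zero hx hq.2.2
  have hNr : N ⊆ region M := fun q hq => ⟨hq.2.1, hne q hq⟩
  set G : (ℝ × ℝ × E3) × E3 → ℝ := fun q => lift f.val (q.1.1, q.1.2.1, rotTo e (q.1.2.2, q.2))
    with hG
  have hrot : ∀ x' y : E3, y ≠ 0 → rotTo e (x', y) ≠ 0 := fun x' y hy => by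
    rw [rotTo_eq]; simpa using hy
  have hGs : ContDiffOn ℝ ∞ G (N ×ˢ {0}ᶜ) := by
    refine ContDiffOn.comp f.smooth
      (f := fun q : (ℝ × ℝ × E3) × E3 => (q.1.1, q.1.2.1, rotTo e (q.1.2.2, q.2))) ?_ ?_
    · refine ContDiffOn.prodMk (by fun_prop) (ContDiffOn.prodMk (by fun_prop) ?_)
      exact (contDiffOn_rotTo e).comp (f := fun q : (ℝ × ℝ × E3) × E3 => (q.1.2.2, q.2))
        (by fun_prop) fun q hq => ⟨hne _ hq.1, hv _ hq.1⟩
    · exact fun q hq => ⟨hq.1.2.1, hrot _ _ hq.2⟩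
  have hNc : Convex ℝ N := convex_univ.prod ((convex_Ici _).prod (convex_ball _ _))
  have hNu : UniqueDiffOn ℝ N :=
    uniqueDiffOn_univ.prod ((uniqueDiffOn_Ici _).prod Metric.isOpen_ball.uniqueDiffOn)
  have hslice := contDiffOn_slice hNc hNu isOpen_compl_singleton sphere_subset_compl hGs
  have hbl : ∀ q ∈ N, |lift c.val q| ≤ 2 := fun q hq => by
    rw [lift_of_mem _ (hNr hq)]; exact hb _
  have hres : ContDiffOn ℝ ∞ (fun q => resolvent (lift c.val q)) N := fun q hq =>
    (contDiffAt_resolvent (hbl q hq)).comp_contDiffWithinAt q (c.smooth.mono hNr q hq)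
  have hF : ContDiffOn ℝ ∞ (fun q => ContinuousMap.evalCLM ℝ e
      (resolvent (lift c.val q) (slice (fun q (y : S2) => G (q, y)) q))) N :=
    (ContinuousLinearMap.contDiff (𝕜 := ℝ) (E := C(S2, ℝ)) (F := ℝ)
      (ContinuousMap.evalCLM ℝ e)).comp_contDiffOn (hres.clm_apply hslice)
  have hEq : ∀ q ∈ N, lift (sol c f) q = ContinuousMap.evalCLM ℝ e
      (resolvent (lift c.val q) (slice (fun q (y : S2) => G (q, y)) q)) := fun q hq => by
    have hs : slice (fun q (y : S2) => G (q, y)) q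
        = (f.sl q.1 ⟨q.2.1, hq.2.1⟩).comp
          (sphereMap (Submodule.reflection (ℝ ∙ (q.2.2 + ‖q.2.2‖ • (e : E3))))) := by
      ext y
      rw [slice_apply (continuous_of_continuousOn
        (continuousOn_uncurry_sphere sphere_subset_compl hGs.continuousOn) hq)]
      simp only [hG, rotTo_eq]
      exact lift_sphere f.val q.1 ⟨q.2.1, hq.2.1⟩
        (sphereMap (Submodule.reflection (ℝ ∙ (q.2.2 + ‖q.2.2‖ • (e : E3)))) y)
    rw [hs, resolvent_comp (hbl q hq), lift_of_mem _ (hNr hq), lift_of_mem _ (hNr hq)]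
    have hm : sphereMap (Submodule.reflection (ℝ ∙ (q.2.2 + ‖q.2.2‖ • (e : E3)))) e
        = ⟨‖q.2.2‖⁻¹ • q.2.2, normalize_mem (hne q hq)⟩ := by
      refine Subtype.ext ?_
      rw [coe_sphereMap, ← rotTo_eq, rotTo_self (norm_sphere e) (hne q hq) (hv q hq)]
    change _ = (resolvent _ _) (sphereMap _ e)
    rw [hm]
    rfl
  have hpN : (t, r, x) ∈ N :=
    ⟨trivial, hp.1, Metric.mem_ball_self (norm_pos_iff.mpr hx)⟩
  have hmem : N ∈ nhdsWithin ((t, r, x) : ℝ × ℝ × E3) (region M) := by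
    have ho : IsOpen {q : ℝ × ℝ × E3 | q.2.2 ∈ Metric.ball x ‖x‖} :=
      Metric.isOpen_ball.preimage (continuous_snd.comp continuous_snd)
    filter_upwards [self_mem_nhdsWithin, mem_nhdsWithin_of_mem_nhds (ho.mem_nhds hpN.2.2)]
      with q hq hq2 using ⟨trivial, hq.1, hq2⟩
  exact ((hF.congr hEq) _ hpN).mono_of_mem_nhdsWithin hmem

variable {c : SF M}

/-- On Λ the operator `invLap` turns the equation into u + c·`invLap` u = 0, and the contraction
bound forces u = 0. -/
theorem eq_zero_of_lap_add (hc : Radial c) (hb : ∀ p, |c.val p| ≤ 2) {u : SF M} (hu : Lam u)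
    (h : lap u + c * u = 0) : u = 0 := by
  refine SF.ext (funext fun p => ?_)
  have h1 : (lap u).sl p.1 p.2.1 + c.val p • u.sl p.1 p.2.1 = 0 := by
    ext y
    have := congrFun (congrArg SF.val h) (p.1, p.2.1, y)
    rw [← hc p y]
    exact this
  have h2 := congrArg invLap h1
  rw [map_add, invLap_lap hu, map_smul, map_zero] at h2
  exact congrArg (fun v : C(S2, ℝ) => v p.2.2) (eq_zero_of_add_invLap (hb p) h2)

theorem exists_lap_add (hc : Radial c) (hb : ∀ p, |c.val p| ≤ 2) {f : SF M} (hf : Lam f) :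
    ∃ u, Lam u ∧ lap u + c * u = f := by
  obtain ⟨u, hu⟩ : ∃ u : SF M, u.val = sol c f := ⟨⟨_, smooth_sol hb⟩, rfl⟩
  have hsl : ∀ p : Ext M, u.sl p.1 p.2.1 = resolvent (c.val p) (f.sl p.1 p.2.1) := fun p => by
    ext y
    rw [sl_apply, hu, sol, hc p y]
  have hL : Lam u := (lam_iff_sl u).mpr fun t r => by
    have h := hsl (t, r, Classical.arbitrary S2)
    simp only at h
    rw [h]
    refine ⟨?_, fun i => ?_⟩
    · have := sphereInt_resolvent (hb (t, r, Classical.arbitrary S2)) (f := f.sl t r) invLap_one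
        (by rw [one_mul]; exact hf.sphereInt_sl t r)
      rwa [one_mul] at this
    · exact sphereInt_resolvent (hb _) (invLap_coord i) (hf.sphereInt_coord_sl t r i)
  refine ⟨u, hL, ?_⟩
  -- The resolvent equation only gives `invLap` g = 0 for the residual g. As g lies in Λ,
  -- self-adjointness yields ∫ g² = ∫ g·`invLap`(Δg) = ∫ Δg·`invLap` g = 0.
  set g := lap u + c * u - f with hg
  have hgL : Lam g := (hL.lap.add (hL.radial_mul hc)).sub hf
  have hK : ∀ p : Ext M, invLap (g.sl p.1 p.2.1) = 0 := fun p => by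
    have h1 : g.sl p.1 p.2.1 = (lap u).sl p.1 p.2.1 + c.val p • u.sl p.1 p.2.1 - f.sl p.1 p.2.1 := by
      ext y
      rw [← hc p y]
      rfl
    rw [h1, map_sub, map_add, map_smul, invLap_lap hL, hsl, resolvent_spec (hb p), sub_self]
  have hJ : J (g * g) = 0 := by
    refine SF.ext (funext fun p => ?_)
    have h1 : (J (g * g)).val p = sphereInt (g.sl p.1 p.2.1 * g.sl p.1 p.2.1) := rfl
    have h2 : sphereInt (g.sl p.1 p.2.1 * invLap ((lap g).sl p.1 p.2.1)) = 0 := by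
      rw [invLap_symm, hK, mul_zero, map_zero]
    rw [invLap_lap hgL] at h2
    rw [h1, h2]
    rfl
  exact sub_eq_zero.mp (eq_zero_of_J_sq hJ)

end SF

end

end LinGrav

namespace LinGrav

noncomputable section

namespace SF

variable {M : ℝ}

/-! ### From scalar fields to the algebra of smooth functions -/

/-- The `pull_` lemmas move `val` outwards, so that an equation between scalar fields becomes the
image of an equation in `SF M`, where `linear_combination` applies. -/
theorem pull_add (f g : SF M) : f.val + g.val = (f + g).val := rfl
theorem pull_sub (f g : SF M) : f.val - g.val = (f - g).val := rfl
theorem pull_mul (f g : SF M) : f.val * g.val = (f * g).val := rfl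
theorem pull_neg (f : SF M) : -f.val = (-f).val := rfl
theorem pull_zero : (0 : Scal M) = (0 : SF M).val := rfl
theorem pull_one : (1 : Scal M) = (1 : SF M).val := rfl
theorem pull_pow (f : SF M) (k : ℕ) : f.val ^ k = (f ^ k).val := rfl
theorem pull_mass : (mass : Scal M) = (m : SF M).val := rfl
theorem pull_rad : (rad : Scal M) = (r : SF M).val := rfl
theorem pull_pos (i : Fin 3) : (pos i : Scal M) = (x i : SF M).val := rfl
theorem pull_ofNat (k : ℕ) [k.AtLeastTwo] :
    (ofNat(k) : Scal M) = (ofNat(k) : SF M).val := by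
  have h1 : (ofNat(k) : Scal M) = algebraMap ℝ (Scal M) (ofNat(k)) :=
    (map_ofNat _ k).symm
  have h2 : (ofNat(k) : SF M) = algebraMap ℝ (SF M) (ofNat(k)) := (map_ofNat _ k).symm
  rw [h1, h2]; rfl

/-- The constant `1/2`. -/
def hf : SF M := algebraMap ℝ (SF M) (1 / 2)

theorem two_hf : 2 * hf = (1 : SF M) := by
  rw [hf, ← map_ofNat (algebraMap ℝ (SF M)) 2, ← map_mul, ← map_one (algebraMap ℝ (SF M))]
  norm_num

theorem pull_inv_two : ((2 : Scal M)⁻¹) = (hf : SF M).val := by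
  funext p
  change ((2 : Scal M) p)⁻¹ = (1 / 2 : ℝ)
  rw [one_div]; rfl

theorem radial_hf : Radial (hf : SF M) := radial_algebraMap _

theorem deriv_hf (d : Derivation ℝ (SF M) (SF M)) : d hf = 0 := Derivation.map_algebraMap _ _
theorem deriv_m (d : Derivation ℝ (SF M) (SF M)) : d m = 0 := Derivation.map_algebraMap _ _

theorem deriv_ofNat (d : Derivation ℝ (SF M) (SF M)) (k : ℕ) [k.AtLeastTwo] :
    d (ofNat(k)) = 0 := by
  rw [← map_ofNat (algebraMap ℝ (SF M)) k]; exact Derivation.map_algebraMap _ _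

/-- The coordinate derivatives along `𝒬`. -/
def dq (a : Fin 2) : Derivation ℝ (SF M) (SF M) := ![T, R] a

theorem pull_dQ (a : Fin 2) (f : SF M) : dQ a f.val = (dq a f).val := by fin_cases a <;> rfl

theorem pull_dS (i : Fin 3) (f : SF M) : dS i f.val = (D i f).val := rfl

/-- The components of `dr`. -/
def rho (a : Fin 2) : SF M := ![0, 1] a

theorem dr_eq (a : Fin 2) : (dr a : Scal M) = (rho a).val := by fin_cases a <;> rfl

theorem dq_r (a : Fin 2) : dq a (r : SF M) = rho a := by
  fin_cases a
  · exact T_r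
  · exact R_r

/-- The null vector field `∂_t - ∂_r`. -/
def K : Derivation ℝ (SF M) (SF M) := T - R

theorem K_apply (f : SF M) : K f = T f - R f := rfl

variable [Fact (0 < M)]

theorem pull_inv_rad : (rad : Scal M)⁻¹ = (w : SF M).val := rfl

/-! ### The metric and the Christoffel symbols -/

theorem mu_eq : (mu : Scal M) = (2 * m * w : SF M).val := by
  rw [mu, div_eq_mul_inv, pull_inv_rad, pull_mass, pull_ofNat, pull_mul, pull_mul]

/-- The `𝒬`-metric. -/
def g (a b : Fin 2) : SF M :=
  (!![-(1 - 2 * m * w), 2 * m * w; 2 * m * w, 1 + 2 * m * w] : Matrix (Fin 2) (Fin 2) (SF M)) a b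

/-- The inverse of the `𝒬`-metric. -/
def ginv (a b : Fin 2) : SF M :=
  (!![-(1 + 2 * m * w), 2 * m * w; 2 * m * w, 1 - 2 * m * w] : Matrix (Fin 2) (Fin 2) (SF M)) a b

theorem gQ_eq (a b : Fin 2) : (gQ a b : Scal M) = (g a b).val := by
  fin_cases a <;> fin_cases b <;> simp [gQ, g, mu_eq] <;> rfl

theorem gQinv_eq (a b : Fin 2) : (gQinv a b : Scal M) = (ginv a b).val := by
  fin_cases a <;> fin_cases b <;> simp [gQinv, ginv, mu_eq] <;> rfl

theorem dq_w (a : Fin 2) : dq a (w : SF M) = -(w * w * rho a) := by rw [deriv_w, dq_r]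

theorem dq_g (a b c : Fin 2) : dq a (g b c : SF M) = -(2 * (m * w ^ 2) * rho a) := by
  have h : dq a (2 * m * w : SF M) = -(2 * (m * w ^ 2) * rho a) := by
    simp only [Derivation.leibniz, smul_eq_mul, deriv_m, deriv_ofNat, dq_w]
    ring
  fin_cases b <;> fin_cases c <;>
    simp only [g, Matrix.of_apply, Matrix.cons_val', Matrix.cons_val_zero, Matrix.cons_val_one,
      Matrix.cons_val_fin_one, Fin.zero_eta, Fin.mk_one, map_neg, map_sub, map_add,
      Derivation.map_one_eq_zero, h] <;> ring

/-- The Christoffel symbols. -/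
def chr (c a b : Fin 2) : SF M :=
  ![m * w ^ 2 * (rho a + rho b + 2 * m * w), -(m * w ^ 2 * (rho a + rho b - 1 + 2 * m * w))] c

theorem christoffel_eq (c a b : Fin 2) : (christoffel c a b : Scal M) = (chr c a b).val := by
  have hr : (rho 0 : SF M) = 0 ∧ (rho 1 : SF M) = 1 := ⟨rfl, rfl⟩
  simp only [christoffel, gQ_eq, gQinv_eq, pull_dQ, dq_g, div_eq_mul_inv, pull_inv_two, pull_mul,
    pull_add, pull_sub, Fin.sum_univ_two, hr]
  congr 1
  have h2 := two_hf (M := M)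
  fin_cases c
  · simp only [Fin.zero_eta, ginv, chr, Matrix.of_apply, Matrix.cons_val', Matrix.cons_val_zero, Matrix.cons_val_one,
      Matrix.cons_val_fin_one]
    linear_combination (m * w ^ 2 * (rho a + rho b + 2 * m * w)) * h2
  · simp only [Fin.mk_one, ginv, chr, Matrix.of_apply, Matrix.cons_val', Matrix.cons_val_zero, Matrix.cons_val_one,
      Matrix.cons_val_fin_one]
    linear_combination (-(m * w ^ 2 * (rho a + rho b - 1 + 2 * m * w))) * h2

/-! ### The null frame -/

/-- The null vector field `(1 + μ) ∂_t + (1 - μ) ∂_r`. -/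
def N : Derivation ℝ (SF M) (SF M) := (1 + 2 * m * w : SF M) • T + (1 - 2 * m * w : SF M) • R

theorem N_apply (f : SF M) : N f = (1 + 2 * m * w) * T f + (1 - 2 * m * w) * R f := rfl

theorem K_w : K (w : SF M) = w ^ 2 := by rw [K_apply, T_w, R_w]; ring
theorem N_w : N (w : SF M) = -((1 - 2 * m * w) * w ^ 2) := by rw [N_apply, T_w, R_w]; ring
omit [Fact (0 < M)] in
theorem K_r : K (r : SF M) = -1 := by rw [K_apply, T_r, R_r]; ring
theorem N_r : N (r : SF M) = 1 - 2 * m * w := by rw [N_apply, T_r, R_r]; ring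

/-- The commutator of the two null derivations. As a rewriting rule it puts K outside N; with
`lap_K` and `lap_N` moving the Laplacian inside, expressions reach a normal form in which identities
are polynomial. -/
theorem N_K (f : SF M) : N (K f) = K (N f) - 2 * (m * w ^ 2) * K f := by
  have h := T_R f
  simp only [N_apply, K_apply, map_add, map_sub, Derivation.leibniz, smul_eq_mul,
    Derivation.map_one_eq_zero, deriv_m, deriv_ofNat, T_w, R_w]
  linear_combination (-2 : SF M) * h

/-- The coframe dual to the null frame. -/
def e (i a : Fin 2) : SF M :=
  (!![hf - m * w, -(hf + m * w); hf, hf] : Matrix (Fin 2) (Fin 2) (SF M)) i a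

theorem dq_eq (a : Fin 2) (f : SF M) : dq a f = K f * e 0 a + N f * e 1 a := by
  have h := two_hf (M := M)
  rw [K_apply, N_apply]
  fin_cases a
  · change T f = _ * (hf - m * w) + _ * hf
    linear_combination (-(T f) - (T f - R f) * m * w) * h
  · change R f = _ * (-(hf + m * w)) + _ * hf
    linear_combination (-(R f) - (T f - R f) * m * w) * h

/-- The terms with `chr` are the Christoffel terms, so ∇̃e^i = ±(2M/r²) e¹ ⊗ e^i: the connection
does not mix the two null directions. This is where the boost weight in `cov` originates. -/
theorem dq_e (i a b : Fin 2) : dq a (e i b : SF M) = chr 0 a b * e i 0 + chr 1 a b * e i 1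
    + ![1, -1] i * (2 * (m * w ^ 2)) * e 1 a * e i b := by
  have h := two_hf (M := M)
  have h0 : (rho 0 : SF M) = 0 := rfl
  have h1 : (rho 1 : SF M) = 1 := rfl
  fin_cases i <;> fin_cases a <;> fin_cases b <;>
    simp only [Fin.zero_eta, Fin.mk_one, e, chr, Matrix.of_apply, Matrix.cons_val',
      Matrix.cons_val_zero, Matrix.cons_val_one, Matrix.cons_val_fin_one, map_add, map_sub, map_neg,
      Derivation.leibniz, smul_eq_mul, deriv_m, deriv_hf, dq_w, h0, h1]
  · linear_combination (-(m * w ^ 2 * (hf + m * w))) * h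
  · linear_combination (-(m * w ^ 2 * (m * w - hf))) * h
  · linear_combination (-(m * w ^ 2 * (hf + 1 + m * w))) * h
  · linear_combination (-(m * w ^ 2 * (1 - hf + m * w))) * h
  all_goals linear_combination (m * w ^ 2 * hf) * h

/-! ### Frame components -/

/-- The 1-form with given frame components. -/
def f1 (u : Fin 2 → SF M) (a : Fin 2) : SF M := u 0 * e 0 a + u 1 * e 1 a

/-- The 2-tensor with given frame components. -/
def f2 (t : Fin 2 → Fin 2 → SF M) (a b : Fin 2) : SF M := f1 (t 0) b * e 0 a + f1 (t 1) b * e 1 a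

/-- The 3-tensor with given frame components. -/
def f3 (t : Fin 2 → Fin 2 → Fin 2 → SF M) (a b c : Fin 2) : SF M :=
  f2 (t 0) b c * e 0 a + f2 (t 1) b c * e 1 a

/-- The 4-tensor with given frame components. -/
def f4 (t : Fin 2 → Fin 2 → Fin 2 → Fin 2 → SF M) (a b c d : Fin 2) : SF M :=
  f3 (t 0) b c d * e 0 a + f3 (t 1) b c d * e 1 a

/-- The frame components of the covariant derivative of a quantity of boost weight `s`. -/
def cov (s f : SF M) (a : Fin 2) : SF M := ![K f, N f + s * (2 * (m * w ^ 2)) * f] a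

/-- The boost weight of a frame index. -/
def bw (i : Fin 2) : SF M := ![1, -1] i

theorem qNabla1_f1 (u : Fin 2 → SF M) (a b : Fin 2) :
    qNabla1 (fun a => (f1 u a).val) a b = (f2 (fun a i => cov (bw i) (u i) a) a b).val := by
  simp only [qNabla1, pull_dQ, christoffel_eq, Fin.sum_univ_two, pull_mul, pull_add, pull_sub]
  congr 1
  simp only [f1, f2, map_add, Derivation.leibniz, smul_eq_mul, dq_e, dq_eq a (u _), cov, bw,
    Matrix.cons_val_zero, Matrix.cons_val_one, Matrix.cons_val_fin_one]
  ring

theorem qNabla2_f2 (t : Fin 2 → Fin 2 → SF M) (a b c : Fin 2) :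
    qNabla2 (fun a b => (f2 t a b).val) a b c
      = (f3 (fun a i j => cov (bw i + bw j) (t i j) a) a b c).val := by
  simp only [qNabla2, pull_dQ, christoffel_eq, Fin.sum_univ_two, pull_mul, pull_add, pull_sub]
  congr 1
  simp only [f1, f2, f3, map_add, Derivation.leibniz, smul_eq_mul, dq_e, dq_eq a (t _ _), cov, bw,
    Matrix.cons_val_zero, Matrix.cons_val_one, Matrix.cons_val_fin_one]
  ring

theorem qNabla3_f3 (t : Fin 2 → Fin 2 → Fin 2 → SF M) (a b c d : Fin 2) :
    qNabla3 (fun a b c => (f3 t a b c).val) a b c d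
      = (f4 (fun a i j k => cov (bw i + bw j + bw k) (t i j k) a) a b c d).val := by
  simp only [qNabla3, pull_dQ, christoffel_eq, Fin.sum_univ_two, pull_mul, pull_add, pull_sub]
  congr 1
  simp only [f1, f2, f3, f4, map_add, Derivation.leibniz, smul_eq_mul, dq_e, dq_eq a (t _ _ _), cov, bw,
    Matrix.cons_val_zero, Matrix.cons_val_one, Matrix.cons_val_fin_one]
  ring

theorem qTr_f2 (t : Fin 2 → Fin 2 → SF M) :
    qTr (fun a b => (f2 t a b).val) = (-(hf * (t 0 1 + t 1 0))).val := by
  simp only [qTr, gQinv_eq, Fin.sum_univ_two, pull_mul, pull_add]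
  congr 1
  have h := two_hf (M := M)
  simp only [f1, f2, ginv, e, Matrix.of_apply, Matrix.cons_val', Matrix.cons_val_zero, Matrix.cons_val_one,
      Matrix.cons_val_fin_one]
  linear_combination (-(4 * hf * (m * w) * t 0 0 + hf * (t 0 1 + t 1 0))) * h

theorem qTr_f3 (t : Fin 2 → Fin 2 → Fin 2 → SF M) (c : Fin 2) :
    qTr (fun a b => (f3 t a b c).val) = (f1 (fun k => -(hf * (t 0 1 k + t 1 0 k))) c).val := by
  have h : (fun a b => (f3 t a b c).val) = fun a b => (f2 (fun i j => f1 (t i j) c) a b).val := by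
    funext a b; simp only [f3, f2, f1]
  rw [h, qTr_f2]
  congr 1
  simp only [f1]; ring

theorem qTr_f4 (t : Fin 2 → Fin 2 → Fin 2 → Fin 2 → SF M) (c d : Fin 2) :
    qTr (fun a b => (f4 t a b c d).val)
      = (f2 (fun k l => -(hf * (t 0 1 k l + t 1 0 k l))) c d).val := by
  have h : (fun a b => (f4 t a b c d).val)
      = fun a b => (f2 (fun i j => f2 (t i j) c d) a b).val := by
    funext a b; simp only [f4, f3, f2, f1]
  rw [h, qTr_f2]
  congr 1
  simp only [f2, f1]; ring

/-- The metric in the null frame. -/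
theorem g_eq (a b : Fin 2) : (g a b : SF M) = f2 ![![0, -2], ![-2, 0]] a b := by
  have h := two_hf (M := M)
  have h' : 4 * (hf * hf) = (1 : SF M) := by linear_combination (2 * hf + 1) * h
  fin_cases a <;> fin_cases b <;>
    simp only [Fin.zero_eta, Fin.mk_one, g, f2, f1, e, Matrix.of_apply, Matrix.cons_val',
      Matrix.cons_val_zero, Matrix.cons_val_one, Matrix.cons_val_fin_one]
  · linear_combination h' - 2 * m * w * h
  · linear_combination -2 * m * w * h
  · linear_combination -2 * m * w * h
  · linear_combination -h' - 2 * m * w * h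

theorem rho_eq (a : Fin 2) : (rho a : SF M) = f1 ![-1, 1 - 2 * m * w] a := by
  have h := two_hf (M := M)
  fin_cases a <;>
    simp only [Fin.zero_eta, Fin.mk_one, rho, f1, e, Matrix.of_apply, Matrix.cons_val',
      Matrix.cons_val_zero, Matrix.cons_val_one, Matrix.cons_val_fin_one]
  · linear_combination m * w * h
  · linear_combination (m * w - 1) * h

/-- The frame components of the gradient. -/
def df (f : SF M) : Fin 2 → SF M := ![K f, N f]

theorem qGrad_eq (f : SF M) (a : Fin 2) : qGrad f.val a = (f1 (df f) a).val := by
  rw [qGrad, pull_dQ, dq_eq]; rfl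

theorem vecP_eq (a : Fin 2) : (vecP a : Scal M) = (ginv a 1).val := by
  have h0 : (rho 0 : SF M) = 0 := rfl
  have h1 : (rho 1 : SF M) = 1 := rfl
  simp only [vecP, gQinv_eq, dr_eq, pull_mul, pull_add, Fin.sum_univ_two, h0, h1]
  congr 1; ring

/-- Twice the contraction with `P`. -/
def cP (u : Fin 2 → SF M) : SF M := u 1 - (1 - 2 * m * w) * u 0

theorem sum_vecP_f1 (u : Fin 2 → SF M) :
    ginv 0 1 * f1 u 0 + ginv 1 1 * f1 u 1 = hf * cP u := by
  have h := two_hf (M := M)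
  simp only [ginv, cP, f1, e, Matrix.of_apply, Matrix.cons_val', Matrix.cons_val_zero,
    Matrix.cons_val_one, Matrix.cons_val_fin_one]
  linear_combination (m * w * u 0) * h

theorem contrP_f1 (u : Fin 2 → SF M) : contrP (fun a => (f1 u a).val) = (hf * cP u).val := by
  simp only [contrP, vecP_eq, Fin.sum_univ_two, pull_mul, pull_add]
  rw [sum_vecP_f1]

theorem contrP2_f2 (t : Fin 2 → Fin 2 → SF M) (b : Fin 2) :
    contrP2 (fun a b => (f2 t a b).val) b = (f1 (fun j => hf * cP (fun i => t i j)) b).val := by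
  simp only [contrP2, vecP_eq, Fin.sum_univ_two, pull_mul, pull_add]
  congr 1
  have h := sum_vecP_f1 (fun i => f1 (t i) b)
  simp only [f1, f2, cP] at h ⊢
  linear_combination h

theorem contr_f3_left (t : Fin 2 → Fin 2 → Fin 2 → SF M) (b c : Fin 2) :
    (∑ a, vecP a * (f3 t a b c).val) = (f2 (fun j k => hf * cP (fun i => t i j k)) b c).val := by
  simp only [vecP_eq, Fin.sum_univ_two, pull_mul, pull_add]
  congr 1
  have h := sum_vecP_f1 (fun i => f2 (t i) b c)
  simp only [f1, f2, f3, cP] at h ⊢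
  linear_combination h

theorem contr_f2_right (t : Fin 2 → Fin 2 → SF M) (a : Fin 2) :
    (∑ b, vecP b * (f2 t a b).val) = (f1 (fun i => hf * cP (t i)) a).val := by
  simp only [vecP_eq, Fin.sum_univ_two, pull_mul, pull_add]
  congr 1
  have h0 := sum_vecP_f1 (t 0)
  have h1 := sum_vecP_f1 (t 1)
  simp only [f1, f2, cP] at h0 h1 ⊢
  linear_combination e 0 a * h0 + e 1 a * h1

theorem contr_f3_right (t : Fin 2 → Fin 2 → Fin 2 → SF M) (a b : Fin 2) :
    (∑ c, vecP c * (f3 t a b c).val) = (f2 (fun i j => hf * cP (t i j)) a b).val := by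
  simp only [vecP_eq, Fin.sum_univ_two, pull_mul, pull_add]
  congr 1
  have h00 := sum_vecP_f1 (t 0 0)
  have h01 := sum_vecP_f1 (t 0 1)
  have h10 := sum_vecP_f1 (t 1 0)
  have h11 := sum_vecP_f1 (t 1 1)
  simp only [f1, f2, f3, cP] at h00 h01 h10 h11 ⊢
  linear_combination e 0 a * e 0 b * h00 + e 0 a * e 1 b * h01 + e 1 a * e 0 b * h10
    + e 1 a * e 1 b * h11

/-- The coframe is invertible, so equations between 𝒬-tensors may be compared component by component
in the null frame. -/
theorem f1_inj {u v : Fin 2 → SF M} (h : ∀ a, (f1 u a).val = (f1 v a).val) : u = v := by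
  have h0 : f1 u 0 = f1 v 0 := SF.ext (h 0)
  have h1 : f1 u 1 = f1 v 1 := SF.ext (h 1)
  have hh := two_hf (M := M)
  simp only [f1, e, Matrix.of_apply, Matrix.cons_val', Matrix.cons_val_zero,
    Matrix.cons_val_one, Matrix.cons_val_fin_one] at h0 h1
  funext i
  fin_cases i
  · change u 0 = v 0
    linear_combination h0 - h1 - (u 0 - v 0) * hh
  · change u 1 = v 1
    linear_combination (1 + 2 * m * w) * h0 + (1 - 2 * m * w) * h1 - (u 1 - v 1) * hh
      - 2 * m * w * (u 0 - v 0) * hh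

theorem f2_inj {s t : Fin 2 → Fin 2 → SF M} (h : ∀ a b, (f2 s a b).val = (f2 t a b).val) :
    s = t := by
  have h1 : ∀ b, (fun i => f1 (s i) b) = fun i => f1 (t i) b := fun b =>
    f1_inj fun a => h a b
  funext i
  exact f1_inj fun b => congrArg SF.val (congrFun (h1 b) i)

theorem exists_f1 (u : Fin 2 → SF M) : ∃ v, ∀ a, u a = f1 v a := by
  have h := two_hf (M := M)
  refine ⟨![u 0 - u 1, (1 + 2 * m * w) * u 0 + (1 - 2 * m * w) * u 1], fun a => ?_⟩
  fin_cases a <;>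
    simp only [Fin.zero_eta, Fin.mk_one, f1, e, Matrix.of_apply, Matrix.cons_val',
      Matrix.cons_val_zero, Matrix.cons_val_one, Matrix.cons_val_fin_one]
  · linear_combination (-(u 0)) * h - m * w * (u 0 - u 1) * h
  · linear_combination (-(u 1)) * h - m * w * (u 0 - u 1) * h

theorem exists_f2 (t : Fin 2 → Fin 2 → SF M) : ∃ s, ∀ a b, t a b = f2 s a b := by
  choose v hv using fun b => exists_f1 (fun a => t a b)
  choose s hs using fun i => exists_f1 (fun b => v b i)
  exact ⟨s, fun a b => by rw [hv b a, f1, f2, hs, hs]⟩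

end SF

end

end LinGrav

namespace LinGrav

noncomputable section

namespace SF

variable {M : ℝ}

open SphereCalculus

/-! ### The operators on the spheres of symmetry -/

theorem proj_eq (i j : Fin 3) : (proj i j : Scal M) = (sphere.proj i j : SF M).val := by
  rw [LinGrav.proj, SphereCalculus.proj]
  split_ifs <;> rfl

theorem sNabla1_eq {ξ : Fin 3 → SF M} (h : sphere.Tan ξ) (i j : Fin 3) :
    sNabla1 (fun i => (ξ i).val) i j = (sphere.nab ξ i j).val := by
  rw [SphereCalculus.nab, ← h.proj_D i j]
  simp only [sNabla1, proj_eq, pull_dS, Fin.sum_univ_three, pull_mul, pull_add]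
  rfl

theorem sNabla2_eq {θ : Fin 3 → Fin 3 → SF M} (h1 : ∀ k, sphere.Tan (fun j => θ j k))
    (h2 : ∀ j, sphere.Tan (θ j)) (i j k : Fin 3) :
    sNabla2 (fun i j => (θ i j).val) i j k = (sphere.nab₂ θ i j k).val := by
  rw [SphereCalculus.nab₂, ← proj_D₂ h1 h2 i j k]
  simp only [sNabla2, proj_eq, pull_dS, Fin.sum_univ_three, pull_mul, pull_add]
  rfl

theorem sNabla3_eq {U : Fin 3 → Fin 3 → Fin 3 → SF M} (h1 : ∀ k l, sphere.Tan (fun j => U j k l))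
    (h2 : ∀ j l, sphere.Tan (fun k => U j k l)) (h3 : ∀ j k, sphere.Tan (U j k))
    (i j k l : Fin 3) :
    sNabla3 (fun i j k => (U i j k).val) i j k l = (D i (U j k l) + x j * U i k l
      + x k * U j i l + x l * U j k i).val := by
  have h := proj_D₃ h1 h2 h3 i j k l
  refine Eq.trans ?_ (congrArg SF.val h)
  simp only [sNabla3, proj_eq, pull_dS, Fin.sum_univ_three, pull_mul, pull_add]
  rfl

/-- The conformal Killing operator of the unit sphere. -/
def conf (ξ : Fin 3 → SF M) (i j : Fin 3) : SF M :=
  sphere.nab ξ i j + sphere.nab ξ j i - sphere.proj i j * sphere.div ξ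

theorem tan_proj (k : Fin 3) : sphere.Tan (fun j => (sphere.proj j k : SF M)) := by
  have h := sphere.x_sq (A := SF M)
  have h1 := sum_delta k (fun i => (sphere.x i : SF M))
  simp only [SphereCalculus.Tan, SphereCalculus.proj]
  linear_combination h1 - sphere.x k * h

theorem conf_symm (ξ : Fin 3 → SF M) (i j : Fin 3) : conf ξ i j = conf ξ j i := by
  have h : (sphere.proj i j : SF M) = sphere.proj j i := by
    simp only [SphereCalculus.proj, eq_comm (a := i), mul_comm]
  rw [conf, conf, h]; ring

theorem tan_conf {ξ : Fin 3 → SF M} (h : sphere.Tan ξ) (k : Fin 3) :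
    sphere.Tan (fun j => conf ξ j k) := by
  have h1 : sphere.x 0 * sphere.nab ξ 0 k + sphere.x 1 * sphere.nab ξ 1 k
    + sphere.x 2 * sphere.nab ξ 2 k = 0 := h.nab_left k
  have h2 : sphere.x 0 * sphere.nab ξ k 0 + sphere.x 1 * sphere.nab ξ k 1
    + sphere.x 2 * sphere.nab ξ k 2 = 0 := h.nab_right k
  have h3 : sphere.x 0 * sphere.proj 0 k + sphere.x 1 * sphere.proj 1 k
    + sphere.x 2 * sphere.proj 2 k = (0 : SF M) := tan_proj k
  simp only [SphereCalculus.Tan, conf]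
  linear_combination h1 + h2 - sphere.div ξ * h3

theorem tr_conf {ξ : Fin 3 → SF M} (h : sphere.Tan ξ) :
    conf ξ 0 0 + conf ξ 1 1 + conf ξ 2 2 = 0 := by
  have h1 := h.tr_nab
  have h2 := sphere.x_sq (A := SF M)
  simp only [conf, SphereCalculus.proj, if_true]
  linear_combination 2 * h1 + sphere.div ξ * h2

/-- The divergence of `conf ξ`. -/
def divConf (ξ : Fin 3 → SF M) (k : Fin 3) : SF M :=
  lap (ξ k) + ((2 : ℕ) : SF M) * ξ k + 2 * (x k * sphere.div ξ)

theorem divConf_eq {ξ : Fin 3 → SF M} (h : sphere.Tan ξ) (k : Fin 3) :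
    sphere.div₂ (conf ξ) k = divConf ξ k := by
  refine (h.div_conformal k).trans ?_
  rw [divConf, Nat.cast_ofNat]; rfl

theorem tan_divConf {ξ : Fin 3 → SF M} (h : sphere.Tan ξ) : sphere.Tan (divConf ξ) := by
  have h2 : ∀ j, sphere.Tan (conf ξ j) := fun j => by
    have := tan_conf h j; simp only [conf_symm ξ _ j] at this; exact this
  have := tan_div₂ h2 (tr_conf h)
  rwa [show sphere.div₂ (conf ξ) = divConf ξ from funext fun k => divConf_eq h k] at this

theorem Tan_mul {ξ : Fin 3 → SF M} (h : sphere.Tan ξ) (c : SF M) :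
    sphere.Tan (fun k => c * ξ k) := by
  have h1 : sphere.x 0 * ξ 0 + sphere.x 1 * ξ 1 + sphere.x 2 * ξ 2 = 0 := h
  simp only [SphereCalculus.Tan]
  linear_combination c * h1

/-! ### Commuting the Laplacian with other operators -/

theorem lap_mul_radial {c : SF M} (hc : Radial c) (f : SF M) : lap (c * f) = c * lap f := by
  have h : ∀ i, sphere.D i c = 0 := fun i => hc.D i
  simp only [SphereCalculus.lap, Derivation.leibniz, smul_eq_mul, h, mul_zero, add_zero]
  ring

theorem lap_radial {c : SF M} (hc : Radial c) : lap c = 0 := by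
  have h : ∀ i, sphere.D i c = 0 := fun i => hc.D i
  simp only [SphereCalculus.lap, h, map_zero, add_zero]

variable [Fact (0 < M)]

theorem sTr_eq (θ : Fin 3 → Fin 3 → SF M) :
    sTr (fun i j => (θ i j).val) = (w ^ 2 * (θ 0 0 + θ 1 1 + θ 2 2)).val := by
  have h : ((rad : Scal M) ^ 2)⁻¹ = (w ^ 2 : SF M).val := by rw [← inv_pow, pull_inv_rad, pull_pow]
  rw [sTr, div_eq_mul_inv, h, mul_comm]
  simp only [Fin.sum_univ_three, pull_add, pull_mul]

theorem sDiv1_eq {ξ : Fin 3 → SF M} (h : sphere.Tan ξ) :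
    sDiv1 (fun i => (ξ i).val) = (w ^ 2 * sphere.div ξ).val := by
  rw [sDiv1, show sNabla1 (fun i => (ξ i).val) = fun i j => (sphere.nab ξ i j).val from
    funext fun i => funext fun j => sNabla1_eq h i j, sTr_eq, h.tr_nab]

theorem sCurl_eq {ξ : Fin 3 → SF M} (h : sphere.Tan ξ) :
    sCurl (fun i => (ξ i).val) = (w ^ 2 * sphere.curl ξ).val := by
  have h2 : ((rad : Scal M) ^ 2)⁻¹ = (w ^ 2 : SF M).val := by rw [← inv_pow, pull_inv_rad, pull_pow]
  rw [← curl_nab, sCurl, div_eq_mul_inv, h2, mul_comm]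
  simp only [sNabla1_eq h, pull_pos, pull_sub, pull_mul, pull_add]
  rfl

theorem sLap0_eq (f : SF M) : sLap0 f.val = (w ^ 2 * lap f).val :=
  sDiv1_eq (ξ := fun i => D i f) (sphere.tan_grad f)

theorem sDiv2_eq {θ : Fin 3 → Fin 3 → SF M} (h1 : ∀ k, sphere.Tan (fun j => θ j k))
    (h2 : ∀ j, sphere.Tan (θ j)) (htr : θ 0 0 + θ 1 1 + θ 2 2 = 0) (k : Fin 3) :
    sDiv2 (fun i j => (θ i j).val) k = (w ^ 2 * sphere.div₂ θ k).val := by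
  rw [sDiv2, show (fun i j => sNabla2 (fun i j => (θ i j).val) i j k)
    = fun i j => (sphere.nab₂ θ i j k).val from
    funext fun i => funext fun j => sNabla2_eq h1 h2 i j k, sTr_eq, tr_nab₂ h1 htr]

theorem sLap1_eq {ξ : Fin 3 → SF M} (h : sphere.Tan ξ) (k : Fin 3) :
    sLap1 (fun i => (ξ i).val) k
      = (w ^ 2 * (lap (ξ k) + ξ k + 2 * (x k * sphere.div ξ))).val := by
  rw [sLap1, show sNabla1 (fun i => (ξ i).val) = fun i j => (sphere.nab ξ i j).val from
    funext fun i => funext fun j => sNabla1_eq h i j,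
    show (fun i j => sNabla2 (fun i j => (sphere.nab ξ i j).val) i j k)
    = fun i j => (sphere.nab₂ (sphere.nab ξ) i j k).val from
    funext fun i => funext fun j => sNabla2_eq h.nab_left h.nab_right i j k, sTr_eq]
  rw [h.lap_form k]
  rfl

theorem sLap2_eq {θ : Fin 3 → Fin 3 → SF M} (h1 : ∀ k, sphere.Tan (fun j => θ j k))
    (hs : ∀ i j, θ i j = θ j i) (htr : θ 0 0 + θ 1 1 + θ 2 2 = 0) (k l : Fin 3) :
    sLap2 (fun i j => (θ i j).val) k l
      = (w ^ 2 * (lap (θ k l) + 2 * θ k l + 2 * (x k * sphere.div₂ θ l)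
          + 2 * (x l * sphere.div₂ θ k))).val := by
  have h2 : ∀ j, sphere.Tan (θ j) := fun j => by
    have := h1 j; simp only [SphereCalculus.Tan, hs _ j] at this; exact this
  have e1 : sNabla2 (fun i j => (θ i j).val) = fun i j k => (sphere.nab₂ θ i j k).val :=
    funext fun i => funext fun j => funext fun k => sNabla2_eq h1 h2 i j k
  have e2 : (fun i j => sNabla3 (fun i j k => (sphere.nab₂ θ i j k).val) i j k l)
      = fun i j => (D i (sphere.nab₂ θ j k l) + x j * sphere.nab₂ θ i k l
        + x k * sphere.nab₂ θ j i l + x l * sphere.nab₂ θ j k i).val :=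
    funext fun i => funext fun j => sNabla3_eq (nab₂_left h1 h2) (nab₂_mid h1) (nab₂_right h2) i j k l
  have e3 := lap_tensor h1 hs htr k l
  rw [Fin.sum_univ_three] at e3
  rw [sLap2, e1, e2, sTr_eq]
  exact congrArg (fun f => (w ^ 2 * f : SF M).val) e3

theorem radial_w_sq : Radial (w ^ 2 : SF M) := fun _ _ => rfl

theorem D_w_sq (i : Fin 3) : sphere.D i (w ^ 2 : SF M) = 0 := radial_w_sq.D i

theorem sNablaHat_eq {ξ : Fin 3 → SF M} (h : sphere.Tan ξ) (i j : Fin 3) :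
    sNablaHat (fun i => (ξ i).val) i j = (conf ξ i j).val := by
  simp only [sNablaHat, gS, sNabla1_eq h, sDiv1_eq h, proj_eq, pull_rad, pull_pow, pull_mul,
    pull_add, pull_sub]
  congr 1
  rw [conf]
  linear_combination (-(sphere.proj i j * sphere.div ξ) * (r * w + 1)) * r_mul_w (M := M)

theorem sDiv2_sNablaHat {ξ : Fin 3 → SF M} (h : sphere.Tan ξ) :
    sDiv2 (sNablaHat (fun i => (ξ i).val)) = fun k => (w ^ 2 * divConf ξ k).val := by
  have h2 : ∀ j, sphere.Tan (conf ξ j) := fun j => by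
    have := tan_conf h j; simp only [conf_symm ξ _ j] at this; exact this
  have e1 : sNablaHat (fun i => (ξ i).val) = fun i j => (conf ξ i j).val :=
    funext fun i => funext fun j => sNablaHat_eq h i j
  funext k
  rw [e1, sDiv2_eq (tan_conf h) h2 (tr_conf h), divConf_eq h]

theorem sDiv1_sDiv2_sNablaHat {ξ : Fin 3 → SF M} (h : sphere.Tan ξ) :
    sDiv1 (sDiv2 (sNablaHat (fun i => (ξ i).val)))
      = (w ^ 4 * (lap (sphere.div ξ) + 2 * sphere.div ξ)).val := by
  rw [sDiv2_sNablaHat h, sDiv1_eq (Tan_mul (tan_divConf h) _), sphere.div_mul _ D_w_sq]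
  have e : sphere.div (divConf ξ) = lap (sphere.div ξ) + ((2 : ℕ) : SF M) * sphere.div ξ := h.div_lap_add 2
  rw [e, Nat.cast_ofNat]
  congr 1; ring

theorem sCurl_sDiv2_sNablaHat {ξ : Fin 3 → SF M} (h : sphere.Tan ξ) :
    sCurl (sDiv2 (sNablaHat (fun i => (ξ i).val)))
      = (w ^ 4 * (lap (sphere.curl ξ) + 2 * sphere.curl ξ)).val := by
  rw [sDiv2_sNablaHat h, sCurl_eq (Tan_mul (tan_divConf h) _), sphere.curl_mul _ D_w_sq]
  have e : sphere.curl (divConf ξ) = lap (sphere.curl ξ) + ((2 : ℕ) : SF M) * sphere.curl ξ :=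
    curl_lap_add ξ (sphere.div ξ) 2
  rw [e, Nat.cast_ofNat]
  congr 1; ring

theorem piS_eq (f : SF M) : piS f.val = (lap (lap f) + 2 * lap f).val := by
  have e : sGrad f.val = fun i => (D i f).val := rfl
  rw [piS, e, sDiv1_sDiv2_sNablaHat (ξ := fun i => D i f) (sphere.tan_grad f), pull_rad, pull_pow,
    pull_mul]
  have h : sphere.div (fun i => D i f) = lap f := rfl
  rw [h, ← mul_assoc, ← mul_pow, r_mul_w, one_pow, one_mul]

end SF

end

end LinGrav

namespace LinGrav

noncomputable section

namespace SF

variable {M : ℝ}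

/-! ### Preliminaries -/

theorem deriv_sq (d : Derivation ℝ (SF M) (SF M)) (f : SF M) : d (f ^ 2) = 2 * f * d f := by
  rw [pow_two, Derivation.leibniz, smul_eq_mul]; ring

theorem deriv_cube (d : Derivation ℝ (SF M) (SF M)) (f : SF M) : d (f ^ 3) = 3 * f ^ 2 * d f := by
  rw [pow_succ, Derivation.leibniz, deriv_sq, smul_eq_mul, smul_eq_mul]; ring

/-- The frame components of a symmetric trace-free tensor. -/
def dg (a b : SF M) : Fin 2 → Fin 2 → SF M := ![![a, 0], ![0, b]]

theorem dg_zero_zero (a b : SF M) : dg a b 0 0 = a := rfl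
theorem dg_zero_one (a b : SF M) : dg a b 0 1 = 0 := rfl
theorem dg_one_zero (a b : SF M) : dg a b 1 0 = 0 := rfl
theorem dg_one_one (a b : SF M) : dg a b 1 1 = b := rfl
theorem bw_zero : bw 0 = (1 : SF M) := rfl
theorem bw_one : bw 1 = (-1 : SF M) := rfl

theorem deriv_bw (d : Derivation ℝ (SF M) (SF M)) (i : Fin 2) : d (bw i) = 0 := by
  fin_cases i
  · exact d.map_one_eq_zero
  · change d (-1) = 0
    rw [map_neg, d.map_one_eq_zero, neg_zero]

theorem Radial_sub {f g : SF M} (hf : Radial f) (hg : Radial g) : Radial (f - g) := fun p y => by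
  change f.val _ - g.val _ = f.val _ - g.val _
  rw [hf, hg]

variable [Fact (0 < M)]

/-! ### The operators of the `𝒬`-metric in the null frame -/

/-- The wave operator on a component of boost weight `s`. -/
def bx (s f : SF M) : SF M := -(K (N f) + s * (2 * (m * w ^ 2) * K f + 2 * (m * w ^ 3) * f))

theorem df_zero (f : SF M) : df f 0 = K f := rfl
theorem df_one (f : SF M) : df f 1 = N f := rfl
theorem cov_zero (s f : SF M) : cov s f 0 = K f := rfl
theorem cov_one (s f : SF M) : cov s f 1 = N f + s * (2 * (m * w ^ 2)) * f := rfl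

/-- The inverse metric pairs only K with N, so the trace of the second covariant derivative is the
symmetrised product of the two. The derivative index itself contributes the weights ±1. -/
theorem box_comp {s : SF M} (hs : ∀ d : Derivation ℝ (SF M) (SF M), d s = 0) (f : SF M) :
    -(hf * (cov (-1 + s) (cov s f 1) 0 + cov (1 + s) (cov s f 0) 1)) = bx s f := by
  have h := two_hf (M := M)
  simp only [cov_zero, cov_one, bx, map_add, Derivation.leibniz, smul_eq_mul, hs, deriv_ofNat,
    deriv_m, deriv_sq, K_w, N_K]
  linear_combination (-(K (N f) + s * (2 * (m * w ^ 2) * K f + 2 * (m * w ^ 3) * f))) * h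

theorem qBox0_eq (f : SF M) : qBox0 f.val = (bx 0 f).val := by
  rw [qBox0, show qGrad f.val = fun a => (f1 (df f) a).val from funext (qGrad_eq f),
    show qNabla1 (fun a => (f1 (df f) a).val) = _ from
      funext fun a => funext fun b => qNabla1_f1 _ a b, qTr_f2]
  congr 1
  rw [← box_comp (fun d => map_zero d) f]
  simp only [cov_zero, cov_one, df_zero, df_one, bw_zero, bw_one, add_zero, zero_mul]

theorem qNabla1_eq (u : Fin 2 → SF M) : qNabla1 (fun a => (f1 u a).val)
    = fun a b => (f2 (fun a i => cov (bw i) (u i) a) a b).val :=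
  funext fun a => funext fun b => qNabla1_f1 _ a b

theorem qNabla2_eq (t : Fin 2 → Fin 2 → SF M) : qNabla2 (fun a b => (f2 t a b).val)
    = fun a b c => (f3 (fun a i j => cov (bw i + bw j) (t i j) a) a b c).val :=
  funext fun a => funext fun b => funext fun c => qNabla2_f2 _ a b c

theorem qNabla3_eq (t : Fin 2 → Fin 2 → Fin 2 → SF M) : qNabla3 (fun a b c => (f3 t a b c).val)
    = fun a b c d => (f4 (fun a i j k => cov (bw i + bw j + bw k) (t i j k) a) a b c d).val :=
  funext fun a => funext fun b => funext fun c => funext fun d => qNabla3_f3 _ a b c d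

theorem qBox1_eq (u : Fin 2 → SF M) (c : Fin 2) :
    qBox1 (fun a => (f1 u a).val) c = (f1 (fun k => bx (bw k) (u k)) c).val := by
  rw [qBox1, qNabla1_eq, qNabla2_eq, qTr_f3]
  simp only [← box_comp (fun d => deriv_bw d _), bw_zero, bw_one]

theorem qBox2_eq (t : Fin 2 → Fin 2 → SF M) (c d : Fin 2) :
    qBox2 (fun a b => (f2 t a b).val) c d
      = (f2 (fun k l => bx (bw k + bw l) (t k l)) c d).val := by
  have h : ∀ k l (d : Derivation ℝ (SF M) (SF M)), d (bw k + bw l) = 0 := fun k l d => by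
    rw [map_add, deriv_bw, deriv_bw, add_zero]
  rw [qBox2, qNabla2_eq, qNabla3_eq, qTr_f4]
  simp only [← box_comp (h _ _), bw_zero, bw_one, add_assoc]

theorem qDelta1_eq (u : Fin 2 → SF M) : qDelta1 (fun a => (f1 u a).val)
    = (hf * (N (u 0) + 2 * (m * w ^ 2) * u 0 + K (u 1))).val := by
  rw [qDelta1, qNabla1_eq, qTr_f2, pull_neg]
  congr 1
  simp only [cov_zero, cov_one, bw_zero, bw_one]; ring

theorem qDelta2_eq (t : Fin 2 → Fin 2 → SF M) (c : Fin 2) :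
    qDelta2 (fun a b => (f2 t a b).val) c = (f1 (fun k =>
      hf * (N (t 0 k) + (1 + bw k) * (2 * (m * w ^ 2)) * t 0 k + K (t 1 k))) c).val := by
  rw [qDelta2, qNabla2_eq, qTr_f3, pull_neg]
  congr 1
  simp only [f1, cov_zero, cov_one, bw_zero, bw_one]; ring

/-- In the null frame the metric is purely off-diagonal, so taking twice the symmetric trace-free
part means doubling the diagonal components and dropping the others. The operators written with ⊗̂
all reduce to this. -/
theorem stf_eq (t : Fin 2 → Fin 2 → SF M) (a b : Fin 2) :
    (f2 t a b).val + (f2 t b a).val - gQ a b * qTr (fun a b => (f2 t a b).val)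
      = (f2 (dg (2 * t 0 0) (2 * t 1 1)) a b).val := by
  have h := two_hf (M := M)
  rw [qTr_f2, gQ_eq, pull_add, pull_mul, pull_sub, g_eq]
  congr 1
  simp only [f1, f2, dg, Matrix.cons_val_zero, Matrix.cons_val_one, Matrix.cons_val_fin_one]
  linear_combination (-(t 0 1 + t 1 0) * (e 0 a * e 1 b + e 0 b * e 1 a)) * h

theorem qHat_dr_eq (v : Fin 2 → SF M) (a b : Fin 2) :
    qHat dr (fun a => (f1 v a).val) a b
      = (f2 (dg (-(2 * v 0)) (2 * ((1 - 2 * m * w) * v 1))) a b).val := by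
  have h : ∀ c d, dr c * (f1 v d).val
      = (f2 (fun i j => (![-1, 1 - 2 * m * w] : Fin 2 → SF M) i * v j) c d).val := fun c d => by
    rw [dr_eq, rho_eq, pull_mul]
    congr 1
    simp only [f1, f2]; ring
  have h2 := stf_eq (fun i j => (![-1, 1 - 2 * m * w] : Fin 2 → SF M) i * v j) a b
  rw [qHat, show (fun c d => dr c * (f1 v d).val) = _ from funext fun c => funext fun d => h c d,
    h, h, h2]
  congr 3
  simp only [Matrix.cons_val_zero]; ring

theorem qNablaHat_eq (v : Fin 2 → SF M) (a b : Fin 2) :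
    qNablaHat (fun a => (f1 v a).val) a b
      = (f2 (dg (2 * K (v 0)) (2 * (N (v 1) - 2 * (m * w ^ 2) * v 1))) a b).val := by
  have h2 := stf_eq (fun a i => cov (bw i) (v i) a) a b
  rw [qNablaHat, qDelta1, qNabla1_eq, mul_neg, ← sub_eq_add_neg, h2]
  congr 3
  simp only [cov_one, bw_one]; ring

theorem qNablaP0_eq (f : SF M) : qNablaP0 f.val = (hf * cP (df f)).val := by
  rw [qNablaP0, show qGrad f.val = fun a => (f1 (df f) a).val from funext (qGrad_eq f), contrP_f1]

theorem qNablaP2_eq (t : Fin 2 → Fin 2 → SF M) (b c : Fin 2) :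
    qNablaP2 (fun a b => (f2 t a b).val) b c
      = (f2 (fun j k => hf * cP (cov (bw j + bw k) (t j k))) b c).val := by
  rw [qNablaP2, qNabla2_eq, contr_f3_left]

theorem qNablaContrP1_eq (u : Fin 2 → SF M) (a : Fin 2) :
    qNablaContrP1 (fun a => (f1 u a).val) a
      = (f1 (fun i => hf * cP (fun k => cov (bw k) (u k) i)) a).val := by
  rw [qNablaContrP1, qNabla1_eq, contr_f2_right]

theorem qNablaContrP2_eq (t : Fin 2 → Fin 2 → SF M) :
    qNablaContrP2 (fun a b => (f2 t a b).val) = fun a b =>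
      (f2 (fun i j => hf * cP (fun k => cov (bw j + bw k) (t j k) i)) a b).val := by
  funext a b
  rw [qNablaContrP2, qNabla2_eq, contr_f3_right]

theorem qNablaHatP_eq (t : Fin 2 → Fin 2 → SF M) (a b : Fin 2) :
    qNablaHatP (fun a b => (f2 t a b).val) a b
      = (f2 (dg (cP (fun k => cov (bw 0 + bw k) (t 0 k) 0))
          (cP (fun k => cov (bw 1 + bw k) (t 1 k) 1))) a b).val := by
  have h := two_hf (M := M)
  rw [qNablaHatP, qNablaContrP2_eq, stf_eq, ← mul_assoc, ← mul_assoc, h, one_mul, one_mul]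

/-! ### Linearity of the frame expansions -/

theorem f1_add (u v : Fin 2 → SF M) (a : Fin 2) :
    f1 u a + f1 v a = f1 (fun i => u i + v i) a := by simp only [f1]; ring
theorem f1_sub (u v : Fin 2 → SF M) (a : Fin 2) :
    f1 u a - f1 v a = f1 (fun i => u i - v i) a := by simp only [f1]; ring
theorem f1_neg (u : Fin 2 → SF M) (a : Fin 2) : -f1 u a = f1 (fun i => -u i) a := by
  simp only [f1]; ring
theorem mul_f1 (c : SF M) (u : Fin 2 → SF M) (a : Fin 2) :
    c * f1 u a = f1 (fun i => c * u i) a := by simp only [f1]; ring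
theorem f1_mul (c : SF M) (u : Fin 2 → SF M) (a : Fin 2) :
    f1 u a * c = f1 (fun i => c * u i) a := by simp only [f1]; ring
theorem f2_add (s t : Fin 2 → Fin 2 → SF M) (a b : Fin 2) :
    f2 s a b + f2 t a b = f2 (fun i j => s i j + t i j) a b := by simp only [f1, f2]; ring
theorem f2_sub (s t : Fin 2 → Fin 2 → SF M) (a b : Fin 2) :
    f2 s a b - f2 t a b = f2 (fun i j => s i j - t i j) a b := by simp only [f1, f2]; ring
theorem mul_f2 (c : SF M) (t : Fin 2 → Fin 2 → SF M) (a b : Fin 2) :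
    c * f2 t a b = f2 (fun i j => c * t i j) a b := by simp only [f1, f2]; ring

/-! ### The frame and the operators along the spheres -/

theorem radial_e (i a : Fin 2) : Radial (e i a : SF M) := by
  have h1 := radial_hf (M := M)
  have h2 := (radial_m (M := M)).mul radial_w
  have h3 := h1.add h2
  have h4 := Radial_sub h1 h2
  have h5 : Radial (-(hf + m * w) : SF M) := by
    rw [← zero_sub]
    exact Radial_sub (by rw [← map_zero (algebraMap ℝ (SF M))]; exact radial_algebraMap _) h3
  fin_cases i <;> fin_cases a
  · exact h4
  · exact h5
  · exact h1
  · exact h1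

end SF

end

end LinGrav

/-! ### Commuting the operators along the spheres with the null frame, and the components of a
perturbation. -/

namespace LinGrav

noncomputable section

namespace SF

variable {M : ℝ}

theorem radial_ofNat (k : ℕ) [k.AtLeastTwo] : Radial (ofNat(k) : SF M) := by
  rw [← map_ofNat (algebraMap ℝ (SF M)) k]; exact radial_algebraMap _

theorem radial_one : Radial (1 : SF M) := by
  rw [← map_one (algebraMap ℝ (SF M))]; exact radial_algebraMap _

theorem radial_zero : Radial (0 : SF M) := fun _ _ => rfl

theorem Radial.pow {c : SF M} (hc : Radial c) (k : ℕ) : Radial (c ^ k) := fun p y => by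
  change c.val _ ^ k = c.val _ ^ k
  rw [hc]

theorem Radial.neg {c : SF M} (hc : Radial c) : Radial (-c) := fun p y =>
  congrArg Neg.neg (hc p y)

theorem D_radial {c : SF M} (hc : Radial c) (i : Fin 3) : sphere.D i c = 0 := hc.D i

theorem lap_add (f g : SF M) : lap (f + g) = lap f + lap g := sphere.lap_add f g

theorem lap_neg (f : SF M) : lap (-f) = -lap f := by
  rw [eq_neg_iff_add_eq_zero, ← lap_add, neg_add_cancel]; exact sphere.lap_zero

theorem lap_sub (f g : SF M) : lap (f - g) = lap f - lap g := by
  rw [sub_eq_add_neg, lap_add, lap_neg, sub_eq_add_neg]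

theorem D_K (i : Fin 3) (f : SF M) : sphere.D i (K f) = K (sphere.D i f) := by
  change D i (K f) = K (D i f)
  rw [K_apply, K_apply, map_sub, D_T, D_R]

theorem lap_K (f : SF M) : lap (K f) = K (lap f) := by
  simp only [SphereCalculus.lap, D_K, map_add]

theorem div_K (ξ : Fin 3 → SF M) : sphere.div (fun i => K (ξ i)) = K (sphere.div ξ) := by
  simp only [SphereCalculus.div, D_K, map_add]

theorem K_x (i : Fin 3) : K (x i : SF M) = 0 := by rw [K_apply, T_x, R_x, sub_zero]

theorem curl_K (ξ : Fin 3 → SF M) : sphere.curl (fun i => K (ξ i)) = K (sphere.curl ξ) := by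
  have h : ∀ i, K (sphere.x i : SF M) = 0 := K_x
  simp only [SphereCalculus.curl, D_K, map_add, map_sub, Derivation.leibniz, smul_eq_mul, h,
    mul_zero, add_zero]

theorem div_neg (ξ : Fin 3 → SF M) : sphere.div (fun i => -ξ i) = -sphere.div ξ := by
  simp only [SphereCalculus.div, map_neg]; ring

theorem div_sub (ξ η : Fin 3 → SF M) :
    sphere.div (fun i => ξ i - η i) = sphere.div ξ - sphere.div η := by
  simp only [SphereCalculus.div, map_sub]; ring

theorem curl_neg (ξ : Fin 3 → SF M) : sphere.curl (fun i => -ξ i) = -sphere.curl ξ := by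
  simp only [SphereCalculus.curl, map_neg]; ring

theorem curl_sub (ξ η : Fin 3 → SF M) :
    sphere.curl (fun i => ξ i - η i) = sphere.curl ξ - sphere.curl η := by
  simp only [SphereCalculus.curl, map_sub]; ring

theorem div_radial_mul {c : SF M} (hc : Radial c) (ξ : Fin 3 → SF M) :
    sphere.div (fun i => c * ξ i) = c * sphere.div ξ := sphere.div_mul c hc.D ξ

theorem curl_radial_mul {c : SF M} (hc : Radial c) (ξ : Fin 3 → SF M) :
    sphere.curl (fun i => c * ξ i) = c * sphere.curl ξ := sphere.curl_mul c hc.D ξ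

theorem sMean_eq (f : SF M) :
    sMean f.val = (algebraMap ℝ (SF M) (sphereMeasure.real Set.univ)⁻¹ * J f).val := by
  funext p
  change ⨍ y, f.val (p.1, p.2.1, y) ∂sphereMeasure = _ * ∫ y, f.val (p.1, p.2.1, y) ∂sphereMeasure
  rw [MeasureTheory.average_eq]; rfl

theorem radial_bw (i : Fin 2) : Radial (bw i : SF M) := by
  fin_cases i
  · exact radial_one
  · exact radial_one.neg

variable [Fact (0 < M)]

theorem D_N (i : Fin 3) (f : SF M) : sphere.D i (N f) = N (sphere.D i f) := by
  change D i (N f) = N (D i f)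
  have h : ∀ c : SF M, Radial c → ∀ i, D i c = 0 := fun c hc => hc.D
  simp only [N_apply, map_add, map_sub, Derivation.leibniz, smul_eq_mul, D_T, D_R, deriv_ofNat,
    deriv_m, h _ radial_w, Derivation.map_one_eq_zero]
  ring

theorem lap_N (f : SF M) : lap (N f) = N (lap f) := by
  simp only [SphereCalculus.lap, D_N, map_add]

theorem div_N (ξ : Fin 3 → SF M) : sphere.div (fun i => N (ξ i)) = N (sphere.div ξ) := by
  simp only [SphereCalculus.div, D_N, map_add]

theorem N_x (i : Fin 3) : N (x i : SF M) = 0 := by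
  rw [N_apply, T_x, R_x, mul_zero, mul_zero, add_zero]

theorem curl_N (ξ : Fin 3 → SF M) : sphere.curl (fun i => N (ξ i)) = N (sphere.curl ξ) := by
  have h : ∀ i, N (sphere.x i : SF M) = 0 := N_x
  simp only [SphereCalculus.curl, D_N, map_add, map_sub, Derivation.leibniz, smul_eq_mul, h,
    mul_zero, add_zero]

/-- The frame components of `dr`. -/
def drc : Fin 2 → SF M := ![-1, 1 - 2 * m * w]

theorem drc_zero : (drc 0 : SF M) = -1 := rfl
theorem drc_one : (drc 1 : SF M) = 1 - 2 * m * w := rfl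

theorem radial_mass_aspect : Radial (1 - 2 * m * w : SF M) :=
  Radial_sub radial_one (((radial_ofNat 2).mul radial_m).mul radial_w)

theorem radial_drc (i : Fin 2) : Radial (drc i : SF M) := by
  fin_cases i
  · exact radial_one.neg
  · exact radial_mass_aspect

theorem div_bx {s : SF M} (hs : Radial s) (ξ : Fin 3 → SF M) :
    sphere.div (fun i => bx s (ξ i)) = bx s (sphere.div ξ) := by
  have h1 := (radial_ofNat (M := M) 2).mul (radial_m.mul (radial_w.pow 2))
  have h2 := (radial_ofNat (M := M) 2).mul (radial_m.mul (radial_w.pow 3))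
  simp only [bx, div_neg, sphere.div_add, div_K, div_N, div_radial_mul h1, div_radial_mul h2,
    div_radial_mul hs]

theorem curl_bx {s : SF M} (hs : Radial s) (ξ : Fin 3 → SF M) :
    sphere.curl (fun i => bx s (ξ i)) = bx s (sphere.curl ξ) := by
  have h1 := (radial_ofNat (M := M) 2).mul (radial_m.mul (radial_w.pow 2))
  have h2 := (radial_ofNat (M := M) 2).mul (radial_m.mul (radial_w.pow 3))
  simp only [bx, curl_neg, sphere.curl_add, curl_K, curl_N, curl_radial_mul h1, curl_radial_mul h2,
    curl_radial_mul hs]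

theorem div_cov {s : SF M} (hs : Radial s) (a : Fin 2) (ξ : Fin 3 → SF M) :
    sphere.div (fun i => cov s (ξ i) a) = cov s (sphere.div ξ) a := by
  have h1 := hs.mul ((radial_ofNat (M := M) 2).mul (radial_m.mul (radial_w.pow 2)))
  fin_cases a
  · exact div_K ξ
  · change sphere.div (fun i => N (ξ i) + s * (2 * (m * w ^ 2)) * ξ i) = _ + _
    rw [sphere.div_add, div_N, div_radial_mul h1]

theorem curl_cov {s : SF M} (hs : Radial s) (a : Fin 2) (ξ : Fin 3 → SF M) :
    sphere.curl (fun i => cov s (ξ i) a) = cov s (sphere.curl ξ) a := by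
  have h1 := hs.mul ((radial_ofNat (M := M) 2).mul (radial_m.mul (radial_w.pow 2)))
  fin_cases a
  · exact curl_K ξ
  · change sphere.curl (fun i => N (ξ i) + s * (2 * (m * w ^ 2)) * ξ i) = _ + _
    rw [sphere.curl_add, curl_N, curl_radial_mul h1]

theorem div_cP (u : Fin 2 → Fin 3 → SF M) :
    sphere.div (fun i => cP (fun h => u h i)) = cP (fun h => sphere.div (u h)) := by
  simp only [cP, div_sub, div_radial_mul radial_mass_aspect]

theorem curl_cP (u : Fin 2 → Fin 3 → SF M) :
    sphere.curl (fun i => cP (fun h => u h i)) = cP (fun h => sphere.curl (u h)) := by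
  simp only [cP, curl_sub, curl_radial_mul radial_mass_aspect]

theorem div_f1 (u : Fin 2 → Fin 3 → SF M) (a : Fin 2) :
    sphere.div (fun i => f1 (fun h => u h i) a) = f1 (fun h => sphere.div (u h)) a := by
  simp only [f1, SphereCalculus.div, map_add, Derivation.leibniz, smul_eq_mul,
    D_radial (radial_e _ _)]
  ring

theorem curl_f1 (u : Fin 2 → Fin 3 → SF M) (a : Fin 2) :
    sphere.curl (fun i => f1 (fun h => u h i) a) = f1 (fun h => sphere.curl (u h)) a := by
  simp only [f1, SphereCalculus.curl, map_add, Derivation.leibniz, smul_eq_mul,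
    D_radial (radial_e _ _)]
  ring

theorem lap_mul_e (f : SF M) (i a : Fin 2) : lap (f * e i a) = lap f * e i a := by
  rw [mul_comm, lap_mul_radial (radial_e i a), mul_comm]

theorem lap_f1 (u : Fin 2 → SF M) (a : Fin 2) : lap (f1 u a) = f1 (fun h => lap (u h)) a := by
  simp only [f1, lap_add, lap_mul_e]

theorem lap_f2 (t : Fin 2 → Fin 2 → SF M) (a b : Fin 2) :
    lap (f2 t a b) = f2 (fun i j => lap (t i j)) a b := by
  simp only [f2, f1, lap_add, lap_mul_e]

theorem tan_f1 {u : Fin 2 → Fin 3 → SF M} (h : ∀ k, sphere.Tan (u k)) (a : Fin 2) :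
    sphere.Tan (fun i => f1 (fun k => u k i) a) := by
  have h0 := h 0
  have h1 := h 1
  simp only [SphereCalculus.Tan, f1] at h0 h1 ⊢
  linear_combination e 0 a * h0 + e 1 a * h1

/-! ### Perturbations in the null frame -/

variable (M) in
/-- The components of a perturbation in the null frame. -/
structure Comp where
  al : SF M
  be : SF M
  tg : SF M
  u : Fin 2 → Fin 3 → SF M
  th : Fin 3 → Fin 3 → SF M
  ts : SF M
  tan_u : ∀ h, sphere.Tan (u h)
  tan_th : ∀ k, sphere.Tan (fun j => th j k)
  symm_th : ∀ i j, th i j = th j i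
  tr_th : th 0 0 + th 1 1 + th 2 2 = 0

/-- The perturbation with given components. -/
def Comp.pert (c : Comp M) : Perturbation M where
  gHat a b := (f2 (dg c.al c.be) a b).val
  trG := c.tg.val
  gMix a i := (f1 (fun h => c.u h i) a).val
  sHat i j := (c.th i j).val
  trS := c.ts.val

/-- Symmetry equates the KN and NK components and tracelessness makes their sum vanish, so the
trace-free 𝒬-part retains only its components of boost weight ±2. -/
theorem exists_comp {S : Perturbation M} (hS : IsSmoothSolution S) : ∃ c : Comp M, S = c.pert := by
  obtain ⟨t, ht⟩ := exists_f2 (fun a b => (⟨S.gHat a b, hS.smooth_gHat a b⟩ : SF M))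
  have ht' : S.gHat = fun a b => (f2 t a b).val :=
    funext fun a => funext fun b => congrArg SF.val (ht a b)
  have hv : ∀ i, ∃ v : Fin 2 → SF M, ∀ a, S.gMix a i = (f1 v a).val := fun i => by
    obtain ⟨v, hv⟩ := exists_f1 (fun a => (⟨S.gMix a i, hS.smooth_gMix a i⟩ : SF M))
    exact ⟨v, fun a => congrArg SF.val (hv a)⟩
  choose v hv using hv
  have hsym : (fun i j => t i j) = fun i j => t j i := by
    refine f2_inj fun a b => ?_
    have h := hS.gHat_symm a b
    rw [ht'] at h
    refine h.trans ?_
    refine congrArg SF.val ?_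
    simp only [f1, f2]; ring
  have htr : t 0 1 + t 1 0 = 0 := by
    have h := hS.gHat_traceless
    rw [ht', qTr_f2] at h
    have h2 : -(hf * (t 0 1 + t 1 0)) = (0 : SF M) := SF.ext h
    linear_combination (-2 : SF M) * h2 - (t 0 1 + t 1 0) * two_hf (M := M)
  have h01 : t 0 1 = t 1 0 := congrFun (congrFun hsym 0) 1
  have h10 : t 1 0 = 0 := by
    linear_combination hf * htr - hf * h01 - t 1 0 * two_hf (M := M)
  have htd : t = dg (t 0 0) (t 1 1) := by
    funext i j
    fin_cases i <;> fin_cases j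
    · rfl
    · exact h01.trans h10
    · exact h10
    · rfl
  have htan : (fun h => x 0 * v 0 h + x 1 * v 1 h + x 2 * v 2 h) = fun _ => (0 : SF M) := by
    refine f1_inj fun a => ?_
    have h := hS.gMix_tangential a
    rw [Fin.sum_univ_three, hv, hv, hv] at h
    have h2 : x 0 * f1 (v 0) a + x 1 * f1 (v 1) a + x 2 * f1 (v 2) a = 0 := SF.ext h
    congr 1
    simp only [f1] at h2 ⊢
    linear_combination h2
  let c : Comp M :=
    { al := t 0 0
      be := t 1 1
      tg := ⟨S.trG, hS.smooth_trG⟩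
      u := fun h i => v i h
      th := fun i j => ⟨S.sHat i j, hS.smooth_sHat i j⟩
      ts := ⟨S.trS, hS.smooth_trS⟩
      tan_u := fun h => congrFun htan h
      tan_th := fun k => SF.ext (by
        have h := hS.sHat_tangential k
        rw [Fin.sum_univ_three] at h
        exact h)
      symm_th := fun i j => SF.ext (hS.sHat_symm i j)
      tr_th := SF.ext (by
        have h := hS.sHat_traceless
        funext p
        have hp := congrFun h p
        have hr : (rad p : ℝ) ^ 2 ≠ 0 := by
          have hM : 0 < M := Fact.out
          have : 2 * M ≤ rad p := p.2.1.2
          have : 0 < rad p := by linarith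
          positivity
        simp only [sTr, Fin.sum_univ_three, Pi.div_apply, Pi.pow_apply, Pi.zero_apply,
          div_eq_zero_iff, hr, or_false] at hp
        exact hp) }
  refine ⟨c, ?_⟩
  have e1 : S.gHat = c.pert.gHat := by
    rw [ht', htd]; rfl
  have e2 : S.gMix = c.pert.gMix := funext fun a => funext fun i => hv i a
  cases S
  simp only [Comp.pert] at e1 e2 ⊢
  rw [e1, e2]
  rfl

/-- The frame coefficients are radial, hence averaging acts on frame components. Only the radiality
of k is used later, since `Pi` annihilates it. -/
theorem exists_gHatZeroP (c : Comp M) : ∃ k : Fin 2 → SF M, (∀ i, Radial (k i)) ∧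
    c.pert.gHatZeroP = fun a => (f1 k a).val := by
  set κ : SF M := algebraMap ℝ (SF M) (sphereMeasure.real Set.univ)⁻¹
  have hκ : Radial κ := radial_algebraMap _
  have h : ∀ a b, sMean (c.pert.gHat a b) = (f2 (dg (κ * J c.al) (κ * J c.be)) a b).val := by
    intro a b
    change sMean (f2 (dg c.al c.be) a b).val = _
    have he : ∀ (f : SF M) i a, J (f * e i a) = e i a * J f := fun f i a => by
      rw [mul_comm, J_mul (radial_e i a)]
    rw [sMean_eq]
    congr 1
    simp only [f2, f1, dg, Matrix.cons_val_zero, Matrix.cons_val_one, Matrix.cons_val_fin_one,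
      zero_mul, zero_add, add_zero, map_add, he]
    ring
  have hm := hκ.mul (radial_J c.al)
  have hn := hκ.mul (radial_J c.be)
  refine ⟨fun j => hf * cP (fun i => dg (κ * J c.al) (κ * J c.be) i j), fun i => ?_, ?_⟩
  · fin_cases i
    · exact radial_hf.mul (Radial_sub radial_zero (radial_mass_aspect.mul hm))
    · exact radial_hf.mul (Radial_sub hn (radial_mass_aspect.mul radial_zero))
  · funext a
    rw [Perturbation.gHatZeroP, show (fun a b => sMean (c.pert.gHat a b)) = _ from
      funext fun a => funext fun b => h a b, contrP2_f2]

end SF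

end

end LinGrav

/-! ### The equations of linearised gravity in the null frame. -/

namespace LinGrav

noncomputable section

namespace SF

variable {M : ℝ}

/-- The operator `Δ + 2` on the unit sphere. -/
def Q (f : SF M) : SF M := lap f + 2 * f

/-- The operator `(Δ + 2) Δ` on the unit sphere. -/
def Pi (f : SF M) : SF M := Q (lap f)

theorem Q_add (f g : SF M) : Q (f + g) = Q f + Q g := by simp only [Q, lap_add]; ring
theorem Q_sub (f g : SF M) : Q (f - g) = Q f - Q g := by simp only [Q, lap_sub]; ring
theorem Q_neg (f : SF M) : Q (-f) = -Q f := by simp only [Q, lap_neg]; ring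
theorem Q_mul {c : SF M} (hc : Radial c) (f : SF M) : Q (c * f) = c * Q f := by
  simp only [Q, lap_mul_radial hc]; ring
theorem lap_zero : lap (0 : SF M) = 0 := sphere.lap_zero
theorem Q_zero : Q (0 : SF M) = 0 := by rw [Q, lap_zero, mul_zero, add_zero]
theorem Q_K (f : SF M) : Q (K f) = K (Q f) := by
  simp only [Q, lap_K, map_add, Derivation.leibniz, smul_eq_mul, deriv_ofNat]; ring
theorem Q_lap (f : SF M) : Q (lap f) = lap (Q f) := by
  simp only [Q, lap_add, lap_mul_radial (radial_ofNat 2)]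
theorem Pi_add (f g : SF M) : Pi (f + g) = Pi f + Pi g := by rw [Pi, lap_add, Q_add]; rfl
theorem Pi_sub (f g : SF M) : Pi (f - g) = Pi f - Pi g := by rw [Pi, lap_sub, Q_sub]; rfl
theorem Pi_neg (f : SF M) : Pi (-f) = -Pi f := by rw [Pi, lap_neg, Q_neg]; rfl
theorem Pi_mul {c : SF M} (hc : Radial c) (f : SF M) : Pi (c * f) = c * Pi f := by
  rw [Pi, lap_mul_radial hc, Q_mul hc]; rfl
theorem Pi_zero : Pi (0 : SF M) = 0 := by rw [Pi, lap_zero, Q_zero]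
theorem Pi_K (f : SF M) : Pi (K f) = K (Pi f) := by rw [Pi, lap_K, Q_K]; rfl
theorem Pi_lap (f : SF M) : Pi (lap f) = lap (Pi f) := by rw [Pi, Q_lap]; rfl
theorem Pi_radial {c : SF M} (hc : Radial c) : Pi c = 0 := by rw [Pi, lap_radial hc, Q_zero]

variable [Fact (0 < M)]

theorem Q_N (f : SF M) : Q (N f) = N (Q f) := by
  simp only [Q, lap_N, map_add, Derivation.leibniz, smul_eq_mul, deriv_ofNat]; ring
theorem Pi_N (f : SF M) : Pi (N f) = N (Pi f) := by rw [Pi, lap_N, Q_N]; rfl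

theorem radial_two_n : Radial (2 * (m * w ^ 2) : SF M) :=
  (radial_ofNat 2).mul (radial_m.mul (radial_w.pow 2))

theorem Q_bx {s : SF M} (hs : Radial s) (f : SF M) : Q (bx s f) = bx s (Q f) := by
  have h2 := (radial_ofNat (M := M) 2).mul (radial_m.mul (radial_w.pow 3))
  simp only [bx, Q_neg, Q_add, Q_K, Q_N, Q_mul hs, Q_mul radial_two_n, Q_mul h2]

theorem Pi_bx {s : SF M} (hs : Radial s) (f : SF M) : Pi (bx s f) = bx s (Pi f) := by
  have h2 := (radial_ofNat (M := M) 2).mul (radial_m.mul (radial_w.pow 3))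
  simp only [bx, Pi_neg, Pi_add, Pi_K, Pi_N, Pi_mul hs, Pi_mul radial_two_n, Pi_mul h2]

/-- The even part of the linearised equations in the null frame. -/
structure EvenSystem (al be t ts p q C : SF M) : Prop where
  gHat_K : bx 2 al + w ^ 2 * lap al + w * (N al + 4 * (m * w ^ 2) * al + (1 - 2 * m * w) * K al)
    - 8 * (m * w ^ 3) * al = -(2 * w * K t) - 4 * w ^ 3 * lap p + 2 * w * K ts
  gHat_N : bx (-2) be + w ^ 2 * lap be
    - w * (N be - 4 * (m * w ^ 2) * be + (1 - 2 * m * w) * K be) - 8 * (m * w ^ 3) * be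
      = (1 - 2 * m * w) * (2 * w * N t + 4 * w ^ 3 * lap q - 2 * w * N ts)
  gMix_K : bx 1 p + w ^ 2 * lap p - w * (K q - (1 - 2 * m * w) * K p)
    - w ^ 2 * (q - (1 - 2 * m * w) * p) = -(2 * w ^ 3 * Q C)
  gMix_N : bx (-1) q + w ^ 2 * lap q
    - w * (N q - 2 * (m * w ^ 2) * q - (1 - 2 * m * w) * (N p + 2 * (m * w ^ 2) * p))
    + w ^ 2 * (1 - 2 * m * w) * (q - (1 - 2 * m * w) * p) = 2 * w ^ 3 * (1 - 2 * m * w) * Q C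
  sHat : bx 0 C + w ^ 2 * lap C + 4 * w ^ 2 * C - w * (N C - (1 - 2 * m * w) * K C)
    - 8 * (m * w ^ 3) * C = 0
  trS : bx 0 ts + w ^ 2 * lap ts + w * (N ts - (1 - 2 * m * w) * K ts) + 2 * w ^ 2 * ts
    - w ^ 2 * (be + (1 - 2 * m * w) ^ 2 * al) - 2 * w ^ 2 * t = 0
  gauge_K : N al + 4 * (m * w ^ 2) * al = 2 * w ^ 2 * lap p - K ts
  gauge_N : K be = 2 * w ^ 2 * lap q - N ts
  gauge_S : N p + 2 * (m * w ^ 2) * p + K q = 2 * w ^ 2 * Q C - t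

/-- The odd part of the linearised equations in the null frame. -/
structure OddSystem (p q C : SF M) : Prop where
  gMix_K : bx 1 p + w ^ 2 * lap p - w * (K q - (1 - 2 * m * w) * K p)
    - w ^ 2 * (q - (1 - 2 * m * w) * p) = -(2 * w ^ 3 * Q C)
  gMix_N : bx (-1) q + w ^ 2 * lap q
    - w * (N q - 2 * (m * w ^ 2) * q - (1 - 2 * m * w) * (N p + 2 * (m * w ^ 2) * p))
    + w ^ 2 * (1 - 2 * m * w) * (q - (1 - 2 * m * w) * p) = 2 * w ^ 3 * (1 - 2 * m * w) * Q C
  gauge_S : N p + 2 * (m * w ^ 2) * p + K q = 2 * w ^ 2 * Q C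

namespace Comp

variable {c : Comp M}

/-- The scalar potential `div div` of the trace-free part along the spheres. -/
def C (c : Comp M) : SF M := sphere.div (sphere.div₂ c.th)

/-- The scalar potential `curl div` of the trace-free part along the spheres. -/
def Cc (c : Comp M) : SF M := sphere.curl (sphere.div₂ c.th)

omit [Fact (0 < M)] in
theorem tan_th_right (c : Comp M) (j : Fin 3) : sphere.Tan (c.th j) := by
  have := c.tan_th j; simp only [SphereCalculus.Tan, c.symm_th _ j] at this; exact this

omit [Fact (0 < M)] in
theorem tan_div₂ (c : Comp M) : sphere.Tan (sphere.div₂ c.th) :=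
  SphereCalculus.tan_div₂ c.tan_th_right c.tr_th

theorem sDiv1_gMix (c : Comp M) (a : Fin 2) :
    sDiv1 (c.pert.gMix a) = (f1 (fun h => w ^ 2 * sphere.div (c.u h)) a).val := by
  refine (sDiv1_eq (tan_f1 c.tan_u a)).trans ?_
  rw [div_f1, mul_f1]

theorem sDiv2_sHat (c : Comp M) (k : Fin 3) :
    sDiv2 c.pert.sHat k = (w ^ 2 * sphere.div₂ c.th k).val :=
  sDiv2_eq c.tan_th c.tan_th_right c.tr_th k

variable (hS : IsSmoothSolution c.pert)
include hS

/-- Expanded in the frame, the equation has the radial source −(2/r²)`cP k`. Applying Δ(Δ+2) removes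
it and commutes with all the other operators; the same device serves in `eq_gauge_Q` and `eq_gHat`.
-/
theorem eq_trS : bx 0 (Pi c.ts) + w ^ 2 * lap (Pi c.ts)
    + w * (N (Pi c.ts) - (1 - 2 * m * w) * K (Pi c.ts)) + 2 * w ^ 2 * Pi c.ts
    - w ^ 2 * (Pi c.be + (1 - 2 * m * w) ^ 2 * Pi c.al) - 2 * w ^ 2 * Pi c.tg = 0 := by
  obtain ⟨k, hk, he⟩ := exists_gHatZeroP c
  have h := hS.eq_trS
  rw [he] at h
  change qBox0 c.ts.val + sLap0 c.ts.val + 2 / rad * qNablaP0 c.ts.val + 2 / rad ^ 2 * c.ts.val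
    = 4 / rad ^ 2 * contrP (contrP2 (fun a b => (f2 (dg c.al c.be) a b).val))
      + 2 / rad ^ 2 * c.tg.val - _ at h
  rw [show contrP2 (fun a b => (f2 (dg c.al c.be) a b).val) = _ from
    funext fun b => contrP2_f2 _ b] at h
  simp only [qBox0_eq, sLap0_eq, qNablaP0_eq, contrP_f1, div_eq_mul_inv, ← inv_pow, pull_inv_rad,
    pull_pow, pull_ofNat, pull_mul, pull_add, pull_sub] at h
  have h1 := SF.ext h
  have hh := two_hf (M := M)
  have h2 : bx 0 c.ts + w ^ 2 * lap c.ts + w * (N c.ts - (1 - 2 * m * w) * K c.ts)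
      + 2 * w ^ 2 * c.ts - w ^ 2 * (c.be + (1 - 2 * m * w) ^ 2 * c.al) - 2 * w ^ 2 * c.tg
      = -(2 * w ^ 2 * cP k) := by
    simp only [cP, dg_zero_zero, dg_zero_one, dg_one_zero, dg_one_one, df_zero, df_one] at h1 ⊢
    linear_combination h1 - w * (N c.ts - (1 - 2 * m * w) * K c.ts) * hh
      + w ^ 2 * (c.be + (1 - 2 * m * w) ^ 2 * c.al) * (2 * hf + 1) * hh
      - 2 * w ^ 2 * (k 1 - (1 - 2 * m * w) * k 0) * hh
  have hr : Radial (2 * w ^ 2 : SF M) := (radial_ofNat 2).mul (radial_w.pow 2)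
  have hck : Radial (cP k) := Radial_sub (hk 1) (radial_mass_aspect.mul (hk 0))
  have h3 := congrArg Pi h2
  simp only [Pi_add, Pi_sub, Pi_neg, Pi_bx radial_zero, Pi_mul hr, Pi_mul (radial_w.pow 2), Pi_lap,
    Pi_mul radial_w, Pi_mul radial_mass_aspect, Pi_mul (radial_mass_aspect.pow 2), Pi_N, Pi_K,
    Pi_radial hck, mul_zero, neg_zero] at h3
  exact h3

theorem eq_gauge_Q (i : Fin 2) :
    N (dg (Pi c.al) (Pi c.be) 0 i) + (1 + bw i) * (2 * (m * w ^ 2)) * dg (Pi c.al) (Pi c.be) 0 i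
      + K (dg (Pi c.al) (Pi c.be) 1 i)
      = 2 * w ^ 2 * lap (Q (sphere.div (c.u i))) - df (Pi c.ts) i := by
  obtain ⟨k, hk, he⟩ := exists_gHatZeroP c
  have h : ∀ a, _ := hS.gauge_Q
  simp only [he, sDiv1_gMix] at h
  change ∀ a, -qDelta2 (fun a b => (f2 (dg c.al c.be) a b).val) a
    + (f1 (fun h => w ^ 2 * sphere.div (c.u h)) a).val - 1 / 2 * qGrad c.ts.val a
    = -(1 / rad * (f1 k a).val) at h
  simp only [qDelta2_eq, qGrad_eq, one_div, pull_inv_two, pull_inv_rad, pull_mul, pull_add,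
    pull_sub, pull_neg, f1_add, f1_sub, mul_f1, f1_neg] at h
  have h1 := congrFun (f1_inj h) i
  have hh := two_hf (M := M)
  have h2 : N (dg c.al c.be 0 i) + (1 + bw i) * (2 * (m * w ^ 2)) * dg c.al c.be 0 i
      + K (dg c.al c.be 1 i)
      = 2 * (w ^ 2 * sphere.div (c.u i)) - df c.ts i + 2 * (w * k i) := by
    linear_combination (-2 : SF M) * h1
      - (N (dg c.al c.be 0 i) + (1 + bw i) * (2 * (m * w ^ 2)) * dg c.al c.be 0 i
      + K (dg c.al c.be 1 i) + df c.ts i) * hh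
  have hr : Radial ((1 + bw i) * (2 * (m * w ^ 2)) : SF M) :=
    (radial_one.add (radial_bw i)).mul radial_two_n
  have hd : ∀ i j, Pi (dg c.al c.be i j) = dg (Pi c.al) (Pi c.be) i j := fun i j => by
    fin_cases i <;> fin_cases j
    · rfl
    · exact Pi_zero
    · exact Pi_zero
    · rfl
  have hdf : Pi (df c.ts i) = df (Pi c.ts) i := by
    fin_cases i
    · exact Pi_K _
    · exact Pi_N _
  have h3 := congrArg Pi h2
  simp only [Pi_add, Pi_sub, Pi_mul (radial_w.pow 2), Pi_mul (radial_ofNat 2), Pi_mul hr,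
    Pi_mul radial_w, Pi_N, Pi_K, Pi_radial (hk i), hd, hdf, mul_zero, add_zero] at h3
  rw [h3, Pi, Q_lap, mul_assoc]

theorem eq_gHat :
    bx 2 (Pi c.al) + w ^ 2 * lap (Pi c.al)
      + w * (N (Pi c.al) + 4 * (m * w ^ 2) * Pi c.al + (1 - 2 * m * w) * K (Pi c.al))
      - 8 * (m * w ^ 3) * Pi c.al
      = -(2 * w * K (Pi c.tg)) - 4 * w ^ 3 * lap (Q (sphere.div (c.u 0))) + 2 * w * K (Pi c.ts) ∧
    bx (-2) (Pi c.be) + w ^ 2 * lap (Pi c.be)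
      - w * (N (Pi c.be) - 4 * (m * w ^ 2) * Pi c.be + (1 - 2 * m * w) * K (Pi c.be))
      - 8 * (m * w ^ 3) * Pi c.be
      = (1 - 2 * m * w) * (2 * w * N (Pi c.tg) + 4 * w ^ 3 * lap (Q (sphere.div (c.u 1)))
        - 2 * w * N (Pi c.ts)) := by
  obtain ⟨k, hk, he⟩ := exists_gHatZeroP c
  have h : ∀ a b, _ := hS.eq_gHat
  rw [he] at h
  simp only [funext (sDiv1_gMix c)] at h
  change ∀ a b, qBox2 (fun a b => (f2 (dg c.al c.be) a b).val) a b
    + sLap0 (f2 (dg c.al c.be) a b).val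
    + 2 / rad * qNablaP2 (fun a b => (f2 (dg c.al c.be) a b).val) a b
    - 2 / rad * qNablaHatP (fun a b => (f2 (dg c.al c.be) a b).val) a b
    - 4 / rad * (mu / rad) * (f2 (dg c.al c.be) a b).val
    = 1 / rad * qHat dr (qGrad c.tg.val) a b
      + 2 / rad * qHat dr (fun a => (f1 (fun h => w ^ 2 * sphere.div (c.u h)) a).val) a b
      - 1 / rad * qHat dr (qGrad c.ts.val) a b - _ at h
  rw [show qGrad c.tg.val = _ from funext (qGrad_eq c.tg),
    show qGrad c.ts.val = _ from funext (qGrad_eq c.ts)] at h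
  simp only [qBox2_eq, sLap0_eq, lap_f2, qNablaP2_eq, qNablaHatP_eq, qHat_dr_eq, div_eq_mul_inv,
    one_mul, pull_inv_rad, mu_eq, pull_ofNat, pull_mul, mul_f1, qNablaHat_eq, pull_add, pull_sub,
    f2_add, f2_sub, mul_f2] at h
  have h1 := f2_inj h
  have h00 := congrFun (congrFun h1 0) 0
  have h11 := congrFun (congrFun h1 1) 1
  simp only [dg_zero_zero, dg_zero_one, dg_one_zero, dg_one_one, cP, cov_zero, cov_one, bw_zero,
    bw_one, df_zero, df_one, one_add_one_eq_two, map_zero, mul_zero] at h00 h11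
  have hh := two_hf (M := M)
  have e0 : bx 2 c.al + w ^ 2 * lap c.al
      + w * (N c.al + 4 * (m * w ^ 2) * c.al + (1 - 2 * m * w) * K c.al) - 8 * (m * w ^ 3) * c.al
      = -(2 * w * K c.tg) - 4 * w ^ 3 * sphere.div (c.u 0) + 2 * w * K c.ts
        - 2 * K (w * k 0) := by
    linear_combination h00
      - w * (N c.al + 4 * (m * w ^ 2) * c.al - (1 - 2 * m * w) * K c.al) * hh
  have e1 : bx (-2) c.be + w ^ 2 * lap c.be
      - w * (N c.be - 4 * (m * w ^ 2) * c.be + (1 - 2 * m * w) * K c.be) - 8 * (m * w ^ 3) * c.be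
      = (1 - 2 * m * w) * (2 * w * N c.tg + 4 * w ^ 3 * sphere.div (c.u 1) - 2 * w * N c.ts)
        - 2 * (N (w * k 1) - 2 * (m * w ^ 2) * (w * k 1)) := by
    rw [show (-1 + -1 : SF M) = -2 by ring] at h11
    linear_combination h11
      - w * (N c.be - 4 * (m * w ^ 2) * c.be - (1 - 2 * m * w) * K c.be) * hh
  have r1 : Radial (4 * (m * w ^ 2) : SF M) := (radial_ofNat 4).mul (radial_m.mul (radial_w.pow 2))
  have r2 : Radial (8 * (m * w ^ 3) : SF M) := (radial_ofNat 8).mul (radial_m.mul (radial_w.pow 3))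
  have r3 : Radial (2 * w : SF M) := (radial_ofNat 2).mul radial_w
  have r4 : Radial (4 * w ^ 3 : SF M) := (radial_ofNat 4).mul (radial_w.pow 3)
  have r5 : Radial (2 : SF M) := radial_ofNat 2
  have h2 := congrArg Pi e0
  have h3 := congrArg Pi e1
  simp only [Pi_add, Pi_sub, Pi_neg, Pi_bx r5, Pi_bx r5.neg, Pi_mul r1, Pi_mul r2, Pi_mul r3,
    Pi_mul r4, Pi_mul r5, Pi_mul radial_w, Pi_mul (radial_w.pow 2), Pi_mul radial_two_n,
    Pi_mul radial_mass_aspect, Pi_N, Pi_K, Pi_lap, Pi_radial (hk _), mul_zero, map_zero, sub_zero]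
    at h2 h3
  constructor
  · rw [h2, show Pi (sphere.div (c.u 0)) = _ from Q_lap _]
  · rw [h3, show Pi (sphere.div (c.u 1)) = _ from Q_lap _]

theorem eq_gMix (h : Fin 2) (i : Fin 3) :
    bx (bw h) (c.u h i) + w ^ 2 * (lap (c.u h i) + c.u h i + 2 * (x i * sphere.div (c.u h)))
      - w * cP (fun k => cov (bw k) (c.u k i) h) - w ^ 2 * c.u h i
      + w ^ 2 * drc h * cP (fun k => c.u k i) = 2 * w ^ 3 * drc h * sphere.div₂ c.th i := by
  have h0 : ∀ a, _ := fun a => hS.eq_gMix a i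
  have e : c.pert.gMixP i = contrP (fun a => (f1 (fun h => c.u h i) a).val) := rfl
  simp only [sDiv2_sHat, e] at h0
  change ∀ a, qBox1 (fun a => (f1 (fun h => c.u h i) a).val) a
    + sLap1 (fun i => (f1 (fun h => c.u h i) a).val) i
    - 2 / rad * qNablaContrP1 (fun a => (f1 (fun h => c.u h i) a).val) a
    - 1 / rad ^ 2 * (f1 (fun h => c.u h i) a).val + _ = _ at h0
  simp only [qBox1_eq, sLap1_eq (tan_f1 c.tan_u _), lap_f1, div_f1, qNablaContrP1_eq, contrP_f1,
    dr_eq, rho_eq, div_eq_mul_inv, one_mul, ← inv_pow, pull_inv_rad, pull_pow, pull_ofNat, pull_mul,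
    pull_add, pull_sub, mul_f1, f1_mul, f1_add, f1_sub] at h0
  have h1 := congrFun (f1_inj h0) h
  have hh := two_hf (M := M)
  have hd : drc h = (![-1, 1 - 2 * m * w] : Fin 2 → SF M) h := rfl
  rw [← hd] at h1
  linear_combination h1 + (w * cP (fun k => cov (bw k) (c.u k i) h)
    - w ^ 2 * drc h * cP (fun k => c.u k i)) * hh

theorem eq_sHat (i j : Fin 3) :
    bx 0 (c.th i j) + w ^ 2 * (lap (c.th i j) + 2 * c.th i j + 2 * (x i * sphere.div₂ c.th j)
      + 2 * (x j * sphere.div₂ c.th i)) - w * (N (c.th i j) - (1 - 2 * m * w) * K (c.th i j))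
      - 8 * (m * w ^ 3) * c.th i j = 0 := by
  have h := hS.eq_sHat i j
  change qBox0 (c.th i j).val + sLap2 (fun i j => (c.th i j).val) i j
    - 2 / rad * qNablaP0 (c.th i j).val - 4 / rad * (mu / rad) * (c.th i j).val = 0 at h
  simp only [qBox0_eq, sLap2_eq c.tan_th c.symm_th c.tr_th, qNablaP0_eq, div_eq_mul_inv, mu_eq,
    pull_inv_rad, pull_ofNat, pull_mul, pull_add, pull_sub] at h
  have h1 : (_ : SF M) = 0 := SF.ext h
  have hh := two_hf (M := M)
  simp only [cP, df_zero, df_one] at h1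
  linear_combination h1 + w * (N (c.th i j) - (1 - 2 * m * w) * K (c.th i j)) * hh

theorem eq_gauge_S (i : Fin 3) :
    N (c.u 0 i) + 2 * (m * w ^ 2) * c.u 0 i + K (c.u 1 i) + D i c.tg
      = 2 * w ^ 2 * sphere.div₂ c.th i := by
  have h := hS.gauge_S i
  rw [sDiv2_sHat] at h
  change -qDelta1 (fun a => (f1 (fun h => c.u h i) a).val) - 1 / 2 * (D i c.tg).val + _ = 0 at h
  simp only [qDelta1_eq, one_div, pull_inv_two, pull_mul, pull_add, pull_sub, pull_neg] at h
  have h1 : (_ : SF M) = 0 := SF.ext h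
  have hh := two_hf (M := M)
  linear_combination (-2 : SF M) * h1
    - (N (c.u 0 i) + 2 * (m * w ^ 2) * c.u 0 i + K (c.u 1 i) + D i c.tg) * hh

end Comp

end SF

end

end LinGrav

/-! ### Divergence and curl of the equations: the even and the odd system. -/

namespace LinGrav

noncomputable section

namespace SF

variable {M : ℝ} [Fact (0 < M)]

theorem Q_cP (u : Fin 2 → SF M) : Q (cP u) = cP (fun h => Q (u h)) := by
  simp only [cP, Q_sub, Q_mul radial_mass_aspect]

theorem Q_cov {s : SF M} (hs : Radial s) (f : SF M) (a : Fin 2) :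
    Q (cov s f a) = cov s (Q f) a := by
  fin_cases a
  · exact Q_K f
  · change Q (N f + s * (2 * (m * w ^ 2)) * f) = _ + _
    rw [Q_add, Q_N, Q_mul (hs.mul radial_two_n)]

/-- The zeroth-order term of the connection Laplacian on 1-forms cancels the explicit −r⁻² term of
the equation, and Δ + 2 commutes with what is left. -/
theorem Q_gMix {A : Fin 2 → SF M} {C : SF M} {h : Fin 2}
    (h1 : bx (bw h) (A h) + w ^ 2 * (lap (A h) + A h) - w * cP (fun k => cov (bw k) (A k) h)
      - w ^ 2 * A h + w ^ 2 * drc h * cP A = 2 * w ^ 3 * drc h * C) :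
    bx (bw h) (Q (A h)) + w ^ 2 * lap (Q (A h)) - w * cP (fun k => cov (bw k) (Q (A k)) h)
      + w ^ 2 * drc h * cP (fun k => Q (A k)) = 2 * w ^ 3 * drc h * Q C := by
  have r1 : Radial (w ^ 2 : SF M) := radial_w.pow 2
  have r2 := r1.mul (radial_drc h)
  have r3 : Radial (2 * w ^ 3 * drc h : SF M) :=
    ((radial_ofNat 2).mul (radial_w.pow 3)).mul (radial_drc h)
  have h2 := congrArg Q h1
  simp only [Q_add, Q_sub, Q_bx (radial_bw h), Q_mul r1, Q_mul r2, Q_mul r3, Q_mul radial_w,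
    Q_cP (fun k => cov (bw k) (A k) h), Q_cP A, Q_cov (radial_bw _), Q_lap] at h2
  linear_combination h2

namespace Comp

variable {c : Comp M}

variable (hS : IsSmoothSolution c.pert)
include hS

theorem eq_div_gMix (h : Fin 2) :
    bx (bw h) (Q (sphere.div (c.u h))) + w ^ 2 * lap (Q (sphere.div (c.u h)))
      - w * cP (fun k => cov (bw k) (Q (sphere.div (c.u k))) h)
      + w ^ 2 * drc h * cP (fun k => Q (sphere.div (c.u k))) = 2 * w ^ 3 * drc h * Q c.C := by
  have h1 := congrArg sphere.div (funext fun i => eq_gMix hS h i)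
  have r1 : Radial (w ^ 2 : SF M) := radial_w.pow 2
  have r2 := r1.mul (radial_drc h)
  have r3 : Radial (2 * w ^ 3 * drc h : SF M) :=
    ((radial_ofNat 2).mul (radial_w.pow 3)).mul (radial_drc h)
  have e := (c.tan_u h).div_lap_add 1
  simp only [Nat.cast_one, one_mul] at e
  have e' : sphere.div (fun k => lap (c.u h k) + c.u h k + 2 * (x k * sphere.div (c.u h)))
    = lap (sphere.div (c.u h)) + sphere.div (c.u h) := e
  simp only [sphere.div_add (fun i => _ - _), div_sub, sphere.div_add (fun i => bx _ _),
    div_bx (radial_bw h), div_radial_mul r1, div_radial_mul r2, div_radial_mul r3,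
    div_radial_mul radial_w, e', div_cP (fun k i => cov (bw k) (c.u k i) h), div_cP c.u,
    div_cov (radial_bw _)] at h1
  refine Q_gMix (A := fun k => sphere.div (c.u k)) (C := c.C) ?_
  simp only [C]
  linear_combination h1

theorem eq_curl_gMix (h : Fin 2) :
    bx (bw h) (Q (sphere.curl (c.u h))) + w ^ 2 * lap (Q (sphere.curl (c.u h)))
      - w * cP (fun k => cov (bw k) (Q (sphere.curl (c.u k))) h)
      + w ^ 2 * drc h * cP (fun k => Q (sphere.curl (c.u k))) = 2 * w ^ 3 * drc h * Q c.Cc := by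
  have h1 := congrArg sphere.curl (funext fun i => eq_gMix hS h i)
  have r1 : Radial (w ^ 2 : SF M) := radial_w.pow 2
  have r2 := r1.mul (radial_drc h)
  have r3 : Radial (2 * w ^ 3 * drc h : SF M) :=
    ((radial_ofNat 2).mul (radial_w.pow 3)).mul (radial_drc h)
  have e := sphere.curl_lap_add (c.u h) (sphere.div (c.u h)) 1
  simp only [Nat.cast_one, one_mul] at e
  have e' : sphere.curl (fun k => lap (c.u h k) + c.u h k + 2 * (x k * sphere.div (c.u h)))
    = lap (sphere.curl (c.u h)) + sphere.curl (c.u h) := e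
  simp only [sphere.curl_add (fun i => _ - _), curl_sub, sphere.curl_add (fun i => bx _ _),
    curl_bx (radial_bw h), curl_radial_mul r1, curl_radial_mul r2, curl_radial_mul r3,
    curl_radial_mul radial_w, e', curl_cP (fun k i => cov (bw k) (c.u k i) h), curl_cP c.u,
    curl_cov (radial_bw _)] at h1
  refine Q_gMix (A := fun k => sphere.curl (c.u k)) (C := c.Cc) ?_
  simp only [Cc]
  linear_combination h1

/-- Two divergences are taken: the first carries the tensor Laplacian to the form with c = 4
(`div₂_lap_tensor`), the second carries that to Δ + 4 on scalars (`div_lap_add`). -/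
theorem eq_C : bx 0 c.C + w ^ 2 * lap c.C + 4 * w ^ 2 * c.C - w * (N c.C - (1 - 2 * m * w) * K c.C)
    - 8 * (m * w ^ 3) * c.C = 0 := by
  have h1 : ∀ j, sphere.div (fun i => _) = sphere.div (fun _ => 0) := fun j =>
    congrArg sphere.div (funext fun i => eq_sHat hS i j)
  have r1 : Radial (w ^ 2 : SF M) := radial_w.pow 2
  have r2 : Radial (8 * (m * w ^ 3) : SF M) := (radial_ofNat 8).mul (radial_m.mul (radial_w.pow 3))
  have e := SphereCalculus.div₂_lap_tensor c.tan_th c.symm_th c.tr_th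
  have e' : ∀ l, sphere.div (fun k => lap (c.th k l) + 2 * c.th k l
      + 2 * (x k * sphere.div₂ c.th l) + 2 * (x l * sphere.div₂ c.th k))
    = lap (sphere.div₂ c.th l) + 4 * sphere.div₂ c.th l
      + 2 * (x l * sphere.div (sphere.div₂ c.th)) := e
  have z : sphere.div (fun _ => (0 : SF M)) = 0 := by simp only [SphereCalculus.div, map_zero, add_zero]
  have ed : ∀ l, sphere.div (fun k => c.th k l) = sphere.div₂ c.th l := fun _ => rfl
  simp only [div_sub, sphere.div_add (fun i => bx _ _), div_bx radial_zero, div_radial_mul r1,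
    div_radial_mul r2, div_radial_mul radial_w, div_radial_mul radial_mass_aspect, e', div_N, div_K,
    z, ed] at h1
  have h2 := congrArg sphere.div (funext h1)
  have e2 := c.tan_div₂.div_lap_add 4
  simp only [Nat.cast_ofNat] at e2
  have e2' : sphere.div (fun l => lap (sphere.div₂ c.th l) + 4 * sphere.div₂ c.th l
      + 2 * (x l * sphere.div (sphere.div₂ c.th)))
    = lap (sphere.div (sphere.div₂ c.th)) + 4 * sphere.div (sphere.div₂ c.th) := e2
  simp only [div_sub, sphere.div_add (fun i => bx _ _), div_bx radial_zero, div_radial_mul r1,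
    div_radial_mul r2, div_radial_mul radial_w, div_radial_mul radial_mass_aspect, e2', div_N,
    div_K, z] at h2
  simp only [C]
  linear_combination h2

theorem eq_div_gauge_S :
    N (Q (sphere.div (c.u 0))) + 2 * (m * w ^ 2) * Q (sphere.div (c.u 0))
      + K (Q (sphere.div (c.u 1))) = 2 * w ^ 2 * Q c.C - Pi c.tg := by
  have h1 := congrArg sphere.div (funext fun i => eq_gauge_S hS i)
  have r1 : Radial (2 * w ^ 2 : SF M) := (radial_ofNat 2).mul (radial_w.pow 2)
  have e : sphere.div (fun i => D i c.tg) = lap c.tg := rfl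
  simp only [sphere.div_add, div_N, div_K, div_radial_mul radial_two_n, div_radial_mul r1, e] at h1
  have h2 := congrArg Q h1
  simp only [Q_add, Q_N, Q_K, Q_mul radial_two_n, Q_mul r1] at h2
  simp only [Pi, C]
  linear_combination h2

/-- The trace enters the gauge condition as a gradient, and the curl of a gradient vanishes by the
commutator of the D_i. -/
theorem eq_curl_gauge_S :
    N (Q (sphere.curl (c.u 0))) + 2 * (m * w ^ 2) * Q (sphere.curl (c.u 0))
      + K (Q (sphere.curl (c.u 1))) = 2 * w ^ 2 * Q c.Cc := by
  have h1 := congrArg sphere.curl (funext fun i => eq_gauge_S hS i)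
  have r1 : Radial (2 * w ^ 2 : SF M) := (radial_ofNat 2).mul (radial_w.pow 2)
  have e : sphere.curl (fun i => D i c.tg) = 0 := by
    have h := fun i j => D_D i j c.tg
    change x 0 * (D 1 (D 2 c.tg) - D 2 (D 1 c.tg)) + x 1 * (D 2 (D 0 c.tg) - D 0 (D 2 c.tg))
      + x 2 * (D 0 (D 1 c.tg) - D 1 (D 0 c.tg)) = 0
    linear_combination x 0 * h 1 2 + x 1 * h 2 0 + x 2 * h 0 1
  simp only [sphere.curl_add, curl_N, curl_K, curl_radial_mul radial_two_n, curl_radial_mul r1, e]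
    at h1
  have h2 := congrArg Q h1
  simp only [Q_add, Q_N, Q_K, Q_mul radial_two_n, Q_mul r1, Q_zero] at h2
  simp only [Cc]
  linear_combination h2

theorem evenSystem : EvenSystem (Pi c.al) (Pi c.be) (Pi c.tg) (Pi c.ts) (Q (sphere.div (c.u 0)))
    (Q (sphere.div (c.u 1))) c.C where
  gHat_K := (eq_gHat hS).1
  gHat_N := (eq_gHat hS).2
  gMix_K := by
    have h := eq_div_gMix hS 0
    simp only [cP, drc_zero, bw_zero, cov_zero] at h
    linear_combination h
  gMix_N := by
    have h := eq_div_gMix hS 1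
    simp only [cP, drc_one, bw_zero, bw_one, cov_one] at h
    linear_combination h
  sHat := eq_C hS
  trS := eq_trS hS
  gauge_K := by
    have h := eq_gauge_Q hS 0
    simp only [dg_zero_zero, dg_one_zero, bw_zero, df_zero, map_zero] at h
    linear_combination h
  gauge_N := by
    have h := eq_gauge_Q hS 1
    simp only [dg_zero_one, dg_one_one, bw_one, df_one, map_zero] at h
    linear_combination h
  gauge_S := eq_div_gauge_S hS

theorem oddSystem : OddSystem (Q (sphere.curl (c.u 0))) (Q (sphere.curl (c.u 1))) c.Cc where
  gMix_K := by
    have h := eq_curl_gMix hS 0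
    simp only [cP, drc_zero, bw_zero, cov_zero] at h
    linear_combination h
  gMix_N := by
    have h := eq_curl_gMix hS 1
    simp only [cP, drc_one, bw_zero, bw_one, cov_one] at h
    linear_combination h
  gauge_S := eq_curl_gauge_S hS

end Comp

end SF

end

end LinGrav

/-! ### The closed system for the even gauge-invariant quantities. -/

namespace LinGrav

noncomputable section

namespace SF

variable {M : ℝ}

theorem lap_mul_radial' {c : SF M} (hc : Radial c) (f : SF M) : lap (f * c) = lap f * c := by
  rw [mul_comm, lap_mul_radial hc, mul_comm]

variable [Fact (0 < M)]

/-- The equations satisfied by the even gauge-invariant quantities. -/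
structure TauSystem (a b s : SF M) : Prop where
  tau_K : bx 2 a + w ^ 2 * lap a + w * (N a + 4 * (m * w ^ 2) * a + (1 - 2 * m * w) * K a)
    - 8 * (m * w ^ 3) * a = 2 * w * K s
  tau_N : bx (-2) b + w ^ 2 * lap b - w * (N b - 4 * (m * w ^ 2) * b + (1 - 2 * m * w) * K b)
    - 8 * (m * w ^ 3) * b = -((1 - 2 * m * w) * (2 * w * N s))
  sigma : bx 0 s + w ^ 2 * lap s + w * (N s - (1 - 2 * m * w) * K s) + 2 * w ^ 2 * s
    - w ^ 2 * (b + (1 - 2 * m * w) ^ 2 * a) = 0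
  div_K : N a + 4 * (m * w ^ 2) * a = -K s
  div_N : K b = -N s

/-- The outgoing and ingoing components of `h`. -/
def hK (p C : SF M) : SF M := p - K C - 2 * w * C
def hN (q C : SF M) : SF M := q - N C + 2 * w * (1 - 2 * m * w) * C

variable {al be t ts p q C : SF M}

/-- The terms of 2δ̃h in C form its wave operator, so twice the equation for C added to the
divergence of the gauge condition gives zero. -/
theorem EvenSystem.trTau (h : EvenSystem al be t ts p q C) :
    t + N (hK p C) + 2 * (m * w ^ 2) * hK p C + K (hN q C) = 0 := by
  have h1 := h.sHat
  have h2 := h.gauge_S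
  simp only [hK, hN, Q, bx, map_add, map_sub, Derivation.leibniz, smul_eq_mul, deriv_m,
    deriv_ofNat, Derivation.map_one_eq_zero, K_w, N_w, N_K] at *
  linear_combination 2 * h1 + h2

/-- The gauge condition for the KK component is combined with the mixed equation, and the terms in C
are removed by their equation and its K-derivative. -/
theorem EvenSystem.div_K (h : EvenSystem al be t ts p q C) :
    N (al - 2 * K (hK p C)) + 4 * (m * w ^ 2) * (al - 2 * K (hK p C))
      = -K (ts - 2 * w * (hN q C - (1 - 2 * m * w) * hK p C) - 2 * w ^ 2 * lap C) := by
  have h1 := h.gMix_K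
  have h2 := h.sHat
  have h3 := congrArg K h.sHat
  have h4 := h.gauge_K
  simp only [hK, hN, Q, bx, map_add, map_sub, map_neg, map_zero, Derivation.leibniz, smul_eq_mul,
    deriv_m, deriv_ofNat, Derivation.map_one_eq_zero, deriv_sq, deriv_cube, K_w, N_w, N_K] at *
  linear_combination 2 * h1 - 4 * w * h2 - 2 * h3 + h4

theorem EvenSystem.div_N (h : EvenSystem al be t ts p q C) :
    K (be - 2 * (N (hN q C) - 2 * (m * w ^ 2) * hN q C))
      = -N (ts - 2 * w * (hN q C - (1 - 2 * m * w) * hK p C) - 2 * w ^ 2 * lap C) := by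
  have h1 := h.gMix_N
  have h2 := h.sHat
  have h3 := congrArg N h.sHat
  have h4 := h.gauge_N
  simp only [hK, hN, Q, bx, map_add, map_sub, map_neg, map_zero, Derivation.leibniz, smul_eq_mul,
    deriv_m, deriv_ofNat, Derivation.map_one_eq_zero, deriv_sq, deriv_cube, K_w, N_w, N_K] at *
  linear_combination 2 * h1 + (4 * w - 8 * m * w ^ 2) * h2 - 2 * h3 + h4

theorem EvenSystem.sigma (h : EvenSystem al be t ts p q C) {a b s : SF M}
    (ha : a = al - 2 * K (hK p C)) (hb : b = be - 2 * (N (hN q C) - 2 * (m * w ^ 2) * hN q C))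
    (hs : s = ts - 2 * w * (hN q C - (1 - 2 * m * w) * hK p C) - 2 * w ^ 2 * lap C) :
    bx 0 s + w ^ 2 * lap s + w * (N s - (1 - 2 * m * w) * K s) + 2 * w ^ 2 * s
      - w ^ 2 * (b + (1 - 2 * m * w) ^ 2 * a) = 0 := by
  subst ha hb hs
  have h1 := h.gMix_K
  have h2 := h.gMix_N
  have h3 := h.sHat
  have h4 := congrArg N h.sHat
  have h5 := congrArg K h.sHat
  have h6 := congrArg lap h.sHat
  have h7 := h.trS
  have h8 := h.gauge_S
  -- Pulling a coefficient out of the Laplacian requires a proof that it is radial, built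
  -- recursively over nested products; hence the discharge depth.
  simp (maxDischargeDepth := 20) only [hK, hN, Q, bx, map_add, map_sub, map_neg, map_zero, Derivation.leibniz, smul_eq_mul,
    deriv_m, deriv_ofNat, Derivation.map_one_eq_zero, deriv_sq, deriv_cube, K_w, N_w, N_K, lap_add,
    lap_sub, lap_neg, lap_K, lap_N, lap_zero, lap_mul_radial, radial_zero, radial_one,
    radial_ofNat, radial_m, radial_w, Radial.mul, Radial_sub, Radial.pow] at *
  linear_combination (2 * w - 4 * m * w ^ 2) * h1 - 2 * w * h2
    + (-4 * w ^ 2 + 16 * m * w ^ 3) * h3 + 2 * w * h4 + (-2 * w + 4 * m * w ^ 2) * h5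
    - 2 * w ^ 2 * h6 + h7 + 2 * w ^ 2 * h8

/-- The correction −2K h_K is of gauge type: its wave equation comes from the K-derivative of the
mixed equation and the second K-derivative of the equation for C, while the K-derivative of the
gauge condition removes the trace t. -/
theorem EvenSystem.tau_K (h : EvenSystem al be t ts p q C) {a s : SF M}
    (ha : a = al - 2 * K (hK p C))
    (hs : s = ts - 2 * w * (hN q C - (1 - 2 * m * w) * hK p C) - 2 * w ^ 2 * lap C) :
    bx 2 a + w ^ 2 * lap a + w * (N a + 4 * (m * w ^ 2) * a + (1 - 2 * m * w) * K a)
      - 8 * (m * w ^ 3) * a = 2 * w * K s := by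
  subst ha hs
  have h1 := h.gHat_K
  have h2 := congrArg K h.gMix_K
  have h3 := h.sHat
  have h4 := congrArg K (congrArg K h.sHat)
  have h5 := congrArg K h.gauge_S
  simp (maxDischargeDepth := 20) only [hK, hN, Q, bx, map_add, map_sub, map_neg, map_zero, Derivation.leibniz, smul_eq_mul,
    deriv_m, deriv_ofNat, Derivation.map_one_eq_zero, deriv_sq, deriv_cube, K_w, N_w, N_K, lap_add,
    lap_sub, lap_K, lap_mul_radial, lap_mul_radial', radial_zero,
    radial_ofNat, radial_w, Radial.mul, Radial.add, Radial.pow] at *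
  linear_combination h1 - 2 * h2 + 4 * w ^ 2 * h3 + 2 * h4 - 2 * w * h5

theorem EvenSystem.tau_N (h : EvenSystem al be t ts p q C) {b s : SF M}
    (hb : b = be - 2 * (N (hN q C) - 2 * (m * w ^ 2) * hN q C))
    (hs : s = ts - 2 * w * (hN q C - (1 - 2 * m * w) * hK p C) - 2 * w ^ 2 * lap C) :
    bx (-2) b + w ^ 2 * lap b - w * (N b - 4 * (m * w ^ 2) * b + (1 - 2 * m * w) * K b)
      - 8 * (m * w ^ 3) * b = -((1 - 2 * m * w) * (2 * w * N s)) := by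
  subst hb hs
  have h1 := h.gHat_N
  have h2 := h.gMix_N
  have h3 := congrArg N h.gMix_N
  have h4 := h.sHat
  have h5 := congrArg N h.sHat
  have h6 := congrArg N (congrArg N h.sHat)
  have h7 := congrArg N h.gauge_S
  simp (maxDischargeDepth := 20) only [hK, hN, Q, bx, map_add, map_sub, map_neg, map_zero, Derivation.leibniz, smul_eq_mul,
    deriv_m, deriv_ofNat, Derivation.map_one_eq_zero, deriv_sq, deriv_cube, K_w, N_w, N_K, lap_add,
    lap_sub, lap_N, lap_mul_radial, lap_mul_radial', radial_zero, radial_one,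
    radial_ofNat, radial_m, radial_w, Radial.mul, Radial.add, Radial_sub, Radial.neg, Radial.pow] at *
  linear_combination h1 + 4 * m * w ^ 2 * h2 - 2 * h3
    + (4 * w ^ 2 - 16 * m * w ^ 3 + 16 * m ^ 2 * w ^ 4) * h4 - 4 * m * w ^ 2 * h5 + 2 * h6
    - (-2 * w + 4 * m * w ^ 2) * h7

/-- The result is the even system for the data (a, b, 0, s, 0, 0, 0): subtracting the terms in h
amounts to passing to a gauge in which the mixed and trace-free sphere parts vanish. -/
theorem EvenSystem.tauSystem (h : EvenSystem al be t ts p q C) :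
    TauSystem (al - 2 * K (hK p C)) (be - 2 * (N (hN q C) - 2 * (m * w ^ 2) * hN q C))
      (ts - 2 * w * (hN q C - (1 - 2 * m * w) * hK p C) - 2 * w ^ 2 * lap C) where
  tau_K := h.tau_K rfl rfl
  tau_N := h.tau_N rfl rfl
  sigma := h.sigma rfl rfl rfl
  div_K := h.div_K
  div_N := h.div_N

end SF

end

end LinGrav

/-! ### Differential identities for the even master quantity. -/

namespace LinGrav

noncomputable section

namespace SF

variable {M : ℝ} [Fact (0 < M)]

variable {a b s : SF M}

/-- The combination of the even gauge-invariant quantities which determines the potential. -/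
def master (a b s : SF M) : SF M :=
  w * (lap s + (2 - 6 * m * w) * s) - w * ((1 - 2 * m * w) ^ 2 * a + b) + N s
    - (1 - 2 * m * w) * K s

/-- In tensor form `master` is X = r⁻¹(Δ + 2 − 6M/r)σ − (4/r)τ_PP + 2∇_Pσ. This identity recovers
Δ(Δ + 2 − 6M/r)σ from X, so X determines σ on Λ. In normal form it is a linear combination of the
equations of the system and their derivatives. -/
theorem TauSystem.master_sigma (h : TauSystem a b s) :
    w ^ 2 * lap (lap s + (2 - 6 * m * w) * s) - w * lap (master a b s) + N (master a b s)
      - (1 - 2 * m * w) * K (master a b s) + 4 * w * (1 - 2 * m * w) * master a b s = 0 := by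
  have h1 := h.tau_K
  have h2 := h.tau_N
  have h3 := h.div_K
  have h4 := congrArg K h.div_K
  have h5 := h.div_N
  have h6 := congrArg N h.div_N
  have h7 := h.sigma
  simp (maxDischargeDepth := 20) only [bx, master, map_add, map_sub, map_neg, Derivation.leibniz, smul_eq_mul,
    deriv_m, deriv_ofNat, Derivation.map_one_eq_zero, deriv_sq, K_w, N_w, N_K, lap_add,
    lap_sub, lap_K, lap_N, lap_mul_radial, radial_one,
    radial_ofNat, radial_m, radial_w, Radial.mul, Radial_sub, Radial.pow] at *
  linear_combination (1 - 4 * m * w + 4 * m ^ 2 * w ^ 2) * h1 + h2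
    + (-2 * w + 8 * m * w ^ 2 - 8 * m ^ 2 * w ^ 3) * h3
    + (1 - 4 * m * w + 4 * m ^ 2 * w ^ 2) * h4 + (2 * w - 6 * m * w ^ 2) * h5 + h6
    + (2 - 4 * m * w) * h7

/-- Recovers the KK component of τ̂ from X = `master a b s`, again up to Δ(Δ + 2 − 6M/r). The KK
part requires two K-derivatives of X. -/
theorem TauSystem.master_K (h : TauSystem a b s) :
    w ^ 3 * lap (lap a + (2 - 6 * m * w) * a) + K (K (master a b s)) - 6 * w * K (master a b s)
      + 6 * w ^ 2 * master a b s = 0 := by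
  have h1 := h.tau_K
  have h2 := congrArg N h.tau_K
  have h3 := congrArg K h.tau_K
  have h4 := congrArg lap h.tau_K
  have h5 := h.div_K
  have h6 := congrArg N h.div_K
  have h7 := congrArg K h.div_K
  have h8 := congrArg K (congrArg N h.div_K)
  have h9 := congrArg K (congrArg K h.div_K)
  have h10 := congrArg lap h.div_K
  have h11 := congrArg K (congrArg lap h.div_K)
  have h12 := h.div_N
  have h13 := congrArg K h.div_N
  have h14 := h.sigma
  simp (maxDischargeDepth := 20) only [bx, master, map_add, map_sub, map_neg, map_zero, Derivation.leibniz, smul_eq_mul,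
    deriv_m, deriv_ofNat, Derivation.map_one_eq_zero, deriv_sq, deriv_cube, K_w, N_w, N_K, lap_add,
    lap_sub, lap_neg, lap_K, lap_N, lap_mul_radial, radial_one,
    radial_ofNat, radial_m, radial_w, Radial.mul, Radial_sub, Radial.pow] at *
  linear_combination (6 * w - 6 * m * w ^ 2) * h1 + h2 + (-1 + 2 * m * w) * h3 + (w) * h4
    + (-4 * w ^ 2 + 6 * m * w ^ 3) * h5 + (-w) * h6 + (6 * w - 8 * m * w ^ 2) * h7 + h8
    + (-1 + 2 * m * w) * h9 + (-2 * w ^ 2) * h10 + (w) * h11 + (4 * w ^ 2) * h12 + (-w) * h13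
    + (2 * w) * h14

/-- The counterpart for the NN component, with two N-derivatives; the coefficients differ from those
of `master_K` because N is normalised differently. -/
theorem TauSystem.master_N (h : TauSystem a b s) :
    w ^ 3 * lap (lap b + (2 - 6 * m * w) * b) + N (N (master a b s))
      + (6 * w - 14 * m * w ^ 2) * N (master a b s) + 6 * w ^ 2 * (1 - 2 * m * w) ^ 2 * master a b s = 0 := by
  have h1 := h.tau_N
  have h2 := congrArg N h.tau_N
  have h3 := congrArg K h.tau_N
  have h4 := congrArg lap h.tau_N
  have h5 := h.div_K
  have h6 := congrArg N h.div_K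
  have h7 := h.div_N
  have h8 := congrArg N h.div_N
  have h9 := congrArg N (congrArg N h.div_N)
  have h10 := congrArg K h.div_N
  have h11 := congrArg K (congrArg N h.div_N)
  have h12 := congrArg lap h.div_N
  have h13 := congrArg N (congrArg lap h.div_N)
  have h14 := h.sigma
  simp (maxDischargeDepth := 20) only [bx, master, map_add, map_sub, map_neg, map_zero, Derivation.leibniz, smul_eq_mul,
    deriv_m, deriv_ofNat, Derivation.map_one_eq_zero, deriv_sq, deriv_cube, K_w, N_w, N_K, lap_add,
    lap_sub, lap_neg, lap_K, lap_N, lap_mul_radial, radial_one,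
    radial_ofNat, radial_m, radial_w, Radial.mul, Radial_sub, Radial.neg, Radial.pow] at *
  linear_combination (6 * w - 14 * m * w ^ 2) * h1 + h2 + (-1 + 2 * m * w) * h3 + (w) * h4
    + (-4 * w ^ 2 + 22 * m * w ^ 3 - 40 * m ^ 2 * w ^ 4 + 24 * m ^ 3 * w ^ 5) * h5
    + (-w + 4 * m * w ^ 2 - 4 * m ^ 2 * w ^ 3) * h6
    + (4 * w ^ 2 - 20 * m * w ^ 3 + 28 * m ^ 2 * w ^ 4) * h7 + (6 * w - 16 * m * w ^ 2) * h8
    + h9 + (-w + 6 * m * w ^ 2 - 8 * m ^ 2 * w ^ 3) * h10 + (-1 + 2 * m * w) * h11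
    + (2 * w ^ 2 - 6 * m * w ^ 3) * h12 + (w) * h13
    + (2 * w - 8 * m * w ^ 2 + 8 * m ^ 2 * w ^ 3) * h14

/-- A wave equation for X whose only remaining source is Δσ. Once σ is expressed through Ψ, it
becomes the Zerilli equation. -/
theorem TauSystem.master_box (h : TauSystem a b s) :
    K (N (master a b s)) - 2 * w * N (master a b s) + 2 * w * (1 - 2 * m * w) * K (master a b s)
      - 2 * w ^ 2 * (1 - 2 * m * w) * master a b s - 4 * m * w ^ 3 * master a b s
      - w ^ 2 * lap (master a b s) - 6 * m * w ^ 4 * lap s = 0 := by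
  have h1 := h.tau_K
  have h2 := congrArg N h.tau_K
  have h3 := h.tau_N
  have h4 := congrArg K h.tau_N
  have h5 := h.div_K
  have h6 := congrArg N h.div_K
  have h7 := congrArg K h.div_K
  have h8 := congrArg K (congrArg N h.div_K)
  have h9 := congrArg lap h.div_K
  have h10 := h.div_N
  have h11 := congrArg N h.div_N
  have h12 := congrArg K h.div_N
  have h13 := congrArg K (congrArg N h.div_N)
  have h14 := congrArg lap h.div_N
  have h15 := h.sigma
  have h16 := congrArg lap h.sigma
  simp (maxDischargeDepth := 20) only [bx, master, map_add, map_sub, map_neg, map_zero, Derivation.leibniz, smul_eq_mul,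
    deriv_m, deriv_ofNat, Derivation.map_one_eq_zero, deriv_sq, deriv_cube, K_w, N_w, N_K, lap_add,
    lap_sub, lap_neg, lap_K, lap_N, lap_zero, lap_mul_radial, radial_zero, radial_one,
    radial_ofNat, radial_m, radial_w, Radial.mul, Radial_sub, Radial.pow] at *
  linear_combination (-2 * w + 4 * m * w ^ 2) * h1 + (-1 + 2 * m * w) * h2 + (-2 * w) * h3 + h4
    + (2 * w ^ 2 - 4 * m * w ^ 3) * h5 + (w - 2 * m * w ^ 2) * h6
    + (-2 * w + 6 * m * w ^ 2 - 4 * m ^ 2 * w ^ 3) * h7 + (-1 + 2 * m * w) * h8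
    + (w ^ 2 - 2 * m * w ^ 3) * h9 + (-2 * w ^ 2 + 2 * m * w ^ 3) * h10 + (-2 * w) * h11
    + (w - 4 * m * w ^ 2) * h12 + h13 + (-w ^ 2) * h14 + (-2 * m * w ^ 2) * h15 + (-w) * h16

end SF

end

end LinGrav

/-! ### The even potential: existence, Zerilli equation and uniqueness. -/

namespace LinGrav

noncomputable section

namespace SF

variable {M : ℝ}

theorem Lam.K {f : SF M} (h : Lam f) : Lam (K f) := h.T.sub h.R

variable [Fact (0 < M)]

theorem Lam.N {f : SF M} (h : Lam f) : Lam (N f) :=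
  (h.T.radial_mul (radial_one.add (((radial_ofNat 2).mul radial_m).mul radial_w))).add
    (h.R.radial_mul radial_mass_aspect)

theorem radial_c : Radial (2 - 6 * m * w : SF M) :=
  Radial_sub (radial_ofNat 2) (((radial_ofNat 6).mul radial_m).mul radial_w)

/-- Up to the boundary r ≥ 2M, so 2 − 6M/r lies between −1 and 2, within the range where Δ + c has
been inverted. -/
theorem abs_c_le (p : Ext M) : |(2 - 6 * m * w : SF M).val p| ≤ 2 := by
  have hM : 0 < M := Fact.out
  have h1 : 2 * M ≤ rad p := p.2.1.2
  have h2 : 0 < rad p := by linarith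
  have e : (2 - 6 * m * w : SF M).val p = 2 - 6 * M * (rad p)⁻¹ := by
    have h6 : (6 : SF M) = algebraMap ℝ (SF M) 6 := (map_ofNat _ 6).symm
    have h2 : (2 : SF M) = algebraMap ℝ (SF M) 2 := (map_ofNat _ 2).symm
    rw [h6, h2]; rfl
  have h3 : 0 ≤ M * (rad p)⁻¹ := by positivity
  have h4 : 2 * (M * (rad p)⁻¹) ≤ 1 := by
    rw [← mul_assoc, ← div_eq_mul_inv, div_le_one h2]; exact h1
  rw [e, abs_le]
  constructor <;> linarith

theorem eq_zero_of_w_pow_mul {f : SF M} (k : ℕ) (h : w ^ k * f = 0) : f = 0 := by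
  have h1 : r * w = (1 : SF M) := r_mul_w
  have h2 : r ^ k * w ^ k = (1 : SF M) := by rw [← mul_pow, h1, one_pow]
  linear_combination r ^ k * h - f * h2

omit [Fact (0 < M)] in
theorem eq_zero_of_two_mul {f : SF M} (h : 2 * f = 0) : f = 0 := by
  linear_combination hf * h - f * two_hf (M := M)

omit [Fact (0 < M)] in
theorem eq_zero_of_lap {f : SF M} (hf : Lam f) (h : lap f = 0) : f = 0 :=
  eq_zero_of_lap_add radial_zero (fun p => by change |(0 : ℝ)| ≤ 2; norm_num) hf
    (by rw [zero_mul, add_zero]; exact h)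

theorem eq_zero_of_lap_lap_add {f : SF M} (hf : Lam f)
    (h : lap (lap f + (2 - 6 * m * w) * f) = 0) : f = 0 :=
  eq_zero_of_lap_add radial_c abs_c_le hf
    (eq_zero_of_lap (hf.lap.add (hf.radial_mul radial_c)) h)

/-- The representation of the even gauge-invariant quantities by a potential `Ψ`, where
`χ = ζΨ` and `Ω = ζ²Ψ`. -/
structure EvenRep (a b s Ψ χ Ω : SF M) : Prop where
  zerilli : -K (N Ψ) + w ^ 2 * lap Ψ = -(6 * m * w ^ 3 * Ψ)
    + 24 * m * w ^ 3 * (1 - 3 * m * w) * χ + 72 * m ^ 2 * w ^ 4 * (1 - 2 * m * w) * Ω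
  tau_K : w * a = 2 * K (K Ψ) - 4 * w * K Ψ - 24 * m * w ^ 2 * (K χ - 6 * m * w ^ 2 * Ω)
  tau_N : w * b = 2 * N (N Ψ) + 2 * w * (2 - 6 * m * w) * N Ψ
    + 24 * m * w ^ 2 * (1 - 2 * m * w) * (N χ + 6 * m * w ^ 2 * (1 - 2 * m * w) * Ω)
  sigma : s = -(2 * w * lap Ψ) + 2 * (N Ψ - (1 - 2 * m * w) * K Ψ)
    + 24 * m * w ^ 2 * (1 - 2 * m * w) * χ

variable {a b s Ψ χ Ω : SF M}

/-- Insert the representation into `master`. The second-order terms and the terms in Ω = ζ²Ψ coming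
from a and b are eliminated by the Zerilli equation, so only the defining equation of χ = ζΨ is
needed. -/
theorem EvenRep.master (h : EvenRep a b s Ψ χ Ω) (hχ : lap χ + (2 - 6 * m * w) * χ = Ψ) :
    2 * w ^ 2 * lap (lap Ψ + (2 - 6 * m * w) * Ψ) + master a b s = 0 := by
  have h1 := h.zerilli
  have h2 := h.tau_K
  have h3 := h.tau_N
  have h4 := h.sigma
  have h5 := congrArg lap h.sigma
  have h6 := congrArg N h.sigma
  have h7 := congrArg K h.sigma
  simp (maxDischargeDepth := 20) only [SF.master, map_add, map_sub, map_neg,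
    Derivation.leibniz, smul_eq_mul,
    deriv_m, deriv_ofNat, Derivation.map_one_eq_zero, deriv_sq, K_w, N_w, N_K, lap_add,
    lap_sub, lap_neg, lap_K, lap_N, lap_mul_radial, radial_one,
    radial_ofNat, radial_m, radial_w, Radial.mul, Radial_sub, Radial.pow] at *
  linear_combination w * h5 + w * (2 - 6 * m * w) * h4 + h6 - (1 - 2 * m * w) * h7
    - (1 - 2 * m * w) ^ 2 * h2 - h3 + 4 * (1 - 2 * m * w) * h1
    + 24 * m * w ^ 3 * (1 - 2 * m * w) * hχ

/-- Let G be the difference of the two sides. By `master_sigma` and the equation defining Ψ, Δ(Δ + 2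
− 6M/r)G vanishes; G lies in Λ, where this operator is injective. The formulas for a and b and the
Zerilli equation are obtained in the same way. -/
theorem sigma_of_master (h : TauSystem a b s) (ls : Lam s) (lΨ : Lam Ψ) (lχ : Lam χ)
    (hχ : lap χ + (2 - 6 * m * w) * χ = Ψ)
    (h0 : 2 * w ^ 2 * lap (lap Ψ + (2 - 6 * m * w) * Ψ) + master a b s = 0) :
    s = -(2 * w * lap Ψ) + 2 * (N Ψ - (1 - 2 * m * w) * K Ψ)
      + 24 * m * w ^ 2 * (1 - 2 * m * w) * χ := by
  rw [← sub_eq_zero]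
  set G := s - (-(2 * w * lap Ψ) + 2 * (N Ψ - (1 - 2 * m * w) * K Ψ)
      + 24 * m * w ^ 2 * (1 - 2 * m * w) * χ) with hG
  have lG : Lam G := by
    have r1 : Radial (2 * w : SF M) := (radial_ofNat 2).mul radial_w
    have r2 : Radial (24 * m * w ^ 2 * (1 - 2 * m * w) : SF M) :=
      (((radial_ofNat 24).mul radial_m).mul (radial_w.pow 2)).mul radial_mass_aspect
    exact ls.sub ((((lΨ.lap.radial_mul r1).neg).add ((lΨ.N.sub
      (lΨ.K.radial_mul radial_mass_aspect)).radial_mul (radial_ofNat 2))).add (lχ.radial_mul r2))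
  have h1 := h.master_sigma
  have h2 := congrArg lap h0
  have h3 := congrArg N h0
  have h4 := congrArg K h0
  have h5 := congrArg lap hχ
  have key : w ^ 2 * lap (lap G + (2 - 6 * m * w) * G) = 0 := by
    rw [hG]
    -- From here on only the four identities matter, so the master quantity stays opaque and is not
    -- expanded.
    generalize SF.master a b s = q at *
    clear hG lG ls lΨ lχ h
    simp (maxDischargeDepth := 20) only [map_add, map_sub, map_zero,
      Derivation.leibniz, smul_eq_mul,
      deriv_m, deriv_ofNat, deriv_sq, K_w, N_w, lap_add,
      lap_sub, lap_neg, lap_K, lap_N, lap_zero, lap_mul_radial, radial_one,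
      radial_ofNat, radial_m, radial_w, Radial.mul, Radial_sub, Radial.pow] at *
    linear_combination h1 + w * h2 - h3 + (1 - 2 * m * w) * h4 - 4 * w * (1 - 2 * m * w) * h0
      - 24 * m * w ^ 4 * (1 - 2 * m * w) * h5
  have k1 := eq_zero_of_w_pow_mul 2 key
  exact eq_zero_of_lap_lap_add lG (eq_zero_of_w_pow_mul 2 key)

theorem tau_K_of_master (h : TauSystem a b s) (la : Lam a) (lΨ : Lam Ψ) (lχ : Lam χ) (lΩ : Lam Ω)
    (hχ : lap χ + (2 - 6 * m * w) * χ = Ψ) (hΩ : lap Ω + (2 - 6 * m * w) * Ω = χ)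
    (h0 : 2 * w ^ 2 * lap (lap Ψ + (2 - 6 * m * w) * Ψ) + master a b s = 0) :
    w * a = 2 * K (K Ψ) - 4 * w * K Ψ - 24 * m * w ^ 2 * (K χ - 6 * m * w ^ 2 * Ω) := by
  rw [← sub_eq_zero]
  set G := w * a - (2 * K (K Ψ) - 4 * w * K Ψ - 24 * m * w ^ 2 * (K χ - 6 * m * w ^ 2 * Ω)) with hG
  have lG : Lam G := by
    have r1 : Radial (4 * w : SF M) := (radial_ofNat 4).mul radial_w
    have r2 : Radial (24 * m * w ^ 2 : SF M) :=
      ((radial_ofNat 24).mul radial_m).mul (radial_w.pow 2)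
    have r3 : Radial (6 * m * w ^ 2 : SF M) :=
      ((radial_ofNat 6).mul radial_m).mul (radial_w.pow 2)
    exact (la.radial_mul radial_w).sub (((lΨ.K.K.radial_mul (radial_ofNat 2)).sub
      (lΨ.K.radial_mul r1)).sub ((lχ.K.sub (lΩ.radial_mul r3)).radial_mul r2))
  have h1 := h.master_K
  have h2 := congrArg K (congrArg K h0)
  have h3 := congrArg K h0
  have h4 := congrArg K (congrArg lap hχ)
  have h5 := congrArg lap hΩ
  have key : w ^ 2 * lap (lap G + (2 - 6 * m * w) * G) = 0 := by
    rw [hG]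
    generalize SF.master a b s = q at *
    clear hG lG la lΨ lχ lΩ h
    simp (maxDischargeDepth := 20) only [map_add, map_sub, map_zero,
      Derivation.leibniz, smul_eq_mul,
      deriv_m, deriv_ofNat, deriv_sq, K_w, lap_add,
      lap_sub, lap_K, lap_mul_radial,
      radial_ofNat, radial_m, radial_w, Radial.mul, Radial_sub, Radial.pow] at *
    linear_combination h1 - h2 + 6 * w * h3 - 6 * w ^ 2 * h0 + 24 * m * w ^ 4 * h4
      - 144 * m ^ 2 * w ^ 6 * h5
  exact eq_zero_of_lap_lap_add lG (eq_zero_of_w_pow_mul 2 key)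

theorem tau_N_of_master (h : TauSystem a b s) (lb : Lam b) (lΨ : Lam Ψ) (lχ : Lam χ) (lΩ : Lam Ω)
    (hχ : lap χ + (2 - 6 * m * w) * χ = Ψ) (hΩ : lap Ω + (2 - 6 * m * w) * Ω = χ)
    (h0 : 2 * w ^ 2 * lap (lap Ψ + (2 - 6 * m * w) * Ψ) + master a b s = 0) :
    w * b = 2 * N (N Ψ) + 2 * w * (2 - 6 * m * w) * N Ψ
      + 24 * m * w ^ 2 * (1 - 2 * m * w) * (N χ + 6 * m * w ^ 2 * (1 - 2 * m * w) * Ω) := by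
  rw [← sub_eq_zero]
  set G := w * b - (2 * N (N Ψ) + 2 * w * (2 - 6 * m * w) * N Ψ
      + 24 * m * w ^ 2 * (1 - 2 * m * w) * (N χ + 6 * m * w ^ 2 * (1 - 2 * m * w) * Ω)) with hG
  have lG : Lam G := by
    have r1 : Radial (2 * w * (2 - 6 * m * w) : SF M) := ((radial_ofNat 2).mul radial_w).mul radial_c
    have r2 : Radial (24 * m * w ^ 2 * (1 - 2 * m * w) : SF M) :=
      (((radial_ofNat 24).mul radial_m).mul (radial_w.pow 2)).mul radial_mass_aspect
    have r3 : Radial (6 * m * w ^ 2 * (1 - 2 * m * w) : SF M) :=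
      (((radial_ofNat 6).mul radial_m).mul (radial_w.pow 2)).mul radial_mass_aspect
    exact (lb.radial_mul radial_w).sub (((lΨ.N.N.radial_mul (radial_ofNat 2)).add
      (lΨ.N.radial_mul r1)).add ((lχ.N.add (lΩ.radial_mul r3)).radial_mul r2))
  have h1 := h.master_N
  have h2 := congrArg N (congrArg N h0)
  have h3 := congrArg N h0
  have h4 := congrArg N (congrArg lap hχ)
  have h5 := congrArg lap hΩ
  have key : w ^ 2 * lap (lap G + (2 - 6 * m * w) * G) = 0 := by
    rw [hG]
    generalize SF.master a b s = q at *
    clear hG lG lb lΨ lχ lΩ h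
    simp (maxDischargeDepth := 20) only [map_add, map_sub, map_neg, map_zero,
      Derivation.leibniz, smul_eq_mul,
      deriv_m, deriv_ofNat, Derivation.map_one_eq_zero, deriv_sq, N_w, lap_add,
      lap_sub, lap_N, lap_mul_radial, radial_one,
      radial_ofNat, radial_m, radial_w, Radial.mul, Radial_sub, Radial.pow] at *
    linear_combination h1 - h2 + (-6 * w + 14 * m * w ^ 2) * h3
      - 6 * w ^ 2 * (1 - 2 * m * w) ^ 2 * h0 - 24 * m * w ^ 4 * (1 - 2 * m * w) * h4
      - 144 * m ^ 2 * w ^ 6 * (1 - 2 * m * w) ^ 2 * h5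
  exact eq_zero_of_lap_lap_add lG (eq_zero_of_w_pow_mul 2 key)

/-- The source Δσ in `master_box` is replaced through the formula for σ, which must therefore be
available first. -/
theorem zerilli_of_master (h : TauSystem a b s) (lΨ : Lam Ψ) (lχ : Lam χ) (lΩ : Lam Ω)
    (hχ : lap χ + (2 - 6 * m * w) * χ = Ψ) (hΩ : lap Ω + (2 - 6 * m * w) * Ω = χ)
    (h0 : 2 * w ^ 2 * lap (lap Ψ + (2 - 6 * m * w) * Ψ) + master a b s = 0)
    (hs : s = -(2 * w * lap Ψ) + 2 * (N Ψ - (1 - 2 * m * w) * K Ψ)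
      + 24 * m * w ^ 2 * (1 - 2 * m * w) * χ) :
    -K (N Ψ) + w ^ 2 * lap Ψ = -(6 * m * w ^ 3 * Ψ)
      + 24 * m * w ^ 3 * (1 - 3 * m * w) * χ + 72 * m ^ 2 * w ^ 4 * (1 - 2 * m * w) * Ω := by
  rw [← sub_eq_zero]
  set G := -K (N Ψ) + w ^ 2 * lap Ψ - (-(6 * m * w ^ 3 * Ψ)
      + 24 * m * w ^ 3 * (1 - 3 * m * w) * χ + 72 * m ^ 2 * w ^ 4 * (1 - 2 * m * w) * Ω) with hG
  have lG : Lam G := by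
    have r1 : Radial (6 * m * w ^ 3 : SF M) :=
      ((radial_ofNat 6).mul radial_m).mul (radial_w.pow 3)
    have r2 : Radial (24 * m * w ^ 3 * (1 - 3 * m * w) : SF M) :=
      (((radial_ofNat 24).mul radial_m).mul (radial_w.pow 3)).mul
        (Radial_sub radial_one (((radial_ofNat 3).mul radial_m).mul radial_w))
    have r3 : Radial (72 * m ^ 2 * w ^ 4 * (1 - 2 * m * w) : SF M) :=
      (((radial_ofNat 72).mul (radial_m.pow 2)).mul (radial_w.pow 4)).mul radial_mass_aspect
    exact (lΨ.N.K.neg.add (lΨ.lap.radial_mul (radial_w.pow 2))).sub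
      ((((lΨ.radial_mul r1).neg).add (lχ.radial_mul r2)).add (lΩ.radial_mul r3))
  have h1 := h.master_box
  have h2 := congrArg K (congrArg N h0)
  have h3 := congrArg N h0
  have h4 := congrArg K h0
  have h5 := congrArg lap h0
  have h6 := congrArg lap hs
  have h7 := congrArg lap hχ
  have h8 := congrArg lap hΩ
  have key : w ^ 2 * (2 * lap (lap G + (2 - 6 * m * w) * G)) = 0 := by
    rw [hG]
    generalize SF.master a b s = q at *
    clear hG lG lΨ lχ lΩ h hs
    simp (maxDischargeDepth := 20) only [map_add, map_sub, map_neg, map_zero,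
      Derivation.leibniz, smul_eq_mul,
      deriv_m, deriv_ofNat, Derivation.map_one_eq_zero, deriv_sq, K_w, N_w, lap_add,
      lap_sub, lap_neg, lap_K, lap_N, lap_zero, lap_mul_radial, radial_one,
      radial_ofNat, radial_m, radial_w, Radial.mul, Radial_sub, Radial.pow] at *
    linear_combination h1 - h2 + 2 * w * h3 - 2 * w * (1 - 2 * m * w) * h4 + 2 * w ^ 2 * h0
      + w ^ 2 * h5 + 6 * m * w ^ 4 * h6 - 48 * m * w ^ 5 * (1 - 3 * m * w) * h7
      - 144 * m ^ 2 * w ^ 6 * (1 - 2 * m * w) * h8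
  exact eq_zero_of_lap_lap_add lG (eq_zero_of_two_mul (eq_zero_of_w_pow_mul 2 key))

theorem lam_master (la : Lam a) (lb : Lam b) (ls : Lam s) : Lam (master a b s) :=
  ((((ls.lap.add (ls.radial_mul radial_c)).radial_mul radial_w).sub
    (((la.radial_mul (radial_mass_aspect.pow 2)).add lb).radial_mul radial_w)).add ls.N).sub
    (ls.K.radial_mul radial_mass_aspect)

theorem TauSystem.exists_rep (h : TauSystem a b s) (la : Lam a) (lb : Lam b) (ls : Lam s) :
    ∃ Ψ χ Ω, Lam Ψ ∧ Lam χ ∧ Lam Ω ∧ lap χ + (2 - 6 * m * w) * χ = Ψ ∧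
      lap Ω + (2 - 6 * m * w) * Ω = χ ∧ EvenRep a b s Ψ χ Ω := by
  -- The fourth-order equation is solved in two steps: Δv = −½r²X, then (Δ + 2 − 6M/r)Ψ = v. Two
  -- further inversions produce χ = ζΨ and Ω = ζ²Ψ.
  obtain ⟨v, lv, hv⟩ := exists_lap_add (M := M) radial_zero
    (fun p => by change |(0 : ℝ)| ≤ 2; norm_num)
    ((lam_master la lb ls).radial_mul (radial_hf.mul (radial_r.mul radial_r))).neg
  obtain ⟨Ψ, lΨ, hΨ⟩ := exists_lap_add radial_c abs_c_le lv
  obtain ⟨χ, lχ, hχ⟩ := exists_lap_add radial_c abs_c_le lΨ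
  obtain ⟨Ω, lΩ, hΩ⟩ := exists_lap_add radial_c abs_c_le lχ
  have h0 : 2 * w ^ 2 * lap (lap Ψ + (2 - 6 * m * w) * Ψ) + master a b s = 0 := by
    have h1 : r * w = (1 : SF M) := r_mul_w
    have h2 := two_hf (M := M)
    rw [hΨ]
    linear_combination 2 * w ^ 2 * hv - 2 * hf * master a b s * (r * w + 1) * h1
      - master a b s * h2
  have hs := sigma_of_master h ls lΨ lχ hχ h0
  exact ⟨Ψ, χ, Ω, lΨ, lχ, lΩ, hχ, hΩ, zerilli_of_master h lΨ lχ lΩ hχ hΩ h0 hs,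
    tau_K_of_master h la lΨ lχ lΩ hχ hΩ h0, tau_N_of_master h lb lΨ lχ lΩ hχ hΩ h0, hs⟩

/-- Both potentials satisfy the elliptic equation with the same master quantity, and its operator is
injective on Λ. -/
theorem EvenRep.unique {Ψ' χ' Ω' : SF M} (h : EvenRep a b s Ψ χ Ω) (h' : EvenRep a b s Ψ' χ' Ω')
    (hχ : lap χ + (2 - 6 * m * w) * χ = Ψ) (hχ' : lap χ' + (2 - 6 * m * w) * χ' = Ψ')
    (lΨ : Lam Ψ) (lΨ' : Lam Ψ') : Ψ = Ψ' := by
  have h1 := h.master hχ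
  have h2 := h'.master hχ'
  rw [← sub_eq_zero]
  refine eq_zero_of_lap_lap_add (lΨ.sub lΨ') (eq_zero_of_two_mul (eq_zero_of_w_pow_mul 2 ?_))
  have e : lap (lap (Ψ - Ψ') + (2 - 6 * m * w) * (Ψ - Ψ')) = lap (lap Ψ + (2 - 6 * m * w) * Ψ)
      - lap (lap Ψ' + (2 - 6 * m * w) * Ψ') := by
    rw [← lap_sub, lap_sub Ψ]
    congr 1; ring
  rw [e]
  linear_combination h1 - h2

end SF

end

end LinGrav

/-! ### The odd potential: existence, Regge–Wheeler equation and uniqueness. -/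

namespace LinGrav

noncomputable section

namespace SF

variable {M : ℝ} [Fact (0 < M)]

/-- The rotation of a 1-form on `𝒬` with given null components. -/
def oddMaster (u v : SF M) : SF M :=
  K v + 2 * w * v - N u + 2 * w * (1 - 2 * m * w) * u - 2 * (m * w ^ 2) * u

variable {p q C u v Φ : SF M}

/-- The mixed equation says that (Δ + 2)η is a rotated gradient of the curl X of r⁻²η, up to weights
in r; the divergence condition removes every other second-order term. `OddSystem.eq_N` is the other
component. -/
theorem OddSystem.eq_K (h : OddSystem p q C) (hu : u = hK p C) (hv : v = hN q C) :
    2 * w ^ 2 * Q u + K (oddMaster u v) - 2 * w * oddMaster u v = 0 := by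
  subst hu hv
  have h1 := h.gMix_K
  have h2 := h.gauge_S
  have h3 := congrArg K h.gauge_S
  simp (maxDischargeDepth := 20) only [hK, hN, oddMaster, bx, Q, map_add, map_sub, map_neg,
    map_zero, Derivation.leibniz, smul_eq_mul,
    deriv_m, deriv_ofNat, Derivation.map_one_eq_zero, deriv_sq, K_w, N_w, N_K,
    lap_sub, lap_K, lap_mul_radial,
    radial_ofNat, radial_w, Radial.mul] at *
  linear_combination 2 * h1 + 2 * w * h2 + h3

theorem OddSystem.eq_N (h : OddSystem p q C) (hu : u = hK p C) (hv : v = hN q C) :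
    2 * w ^ 2 * Q v - N (oddMaster u v) - 2 * w * (1 - 2 * m * w) * oddMaster u v = 0 := by
  subst hu hv
  have h1 := h.gMix_N
  have h2 := h.gauge_S
  have h3 := congrArg N h.gauge_S
  simp (maxDischargeDepth := 20) only [hK, hN, oddMaster, bx, Q, map_add, map_sub, map_neg,
    map_zero, Derivation.leibniz, smul_eq_mul,
    deriv_m, deriv_ofNat, Derivation.map_one_eq_zero, deriv_sq, K_w, N_w, N_K, lap_add,
    lap_sub, lap_N, lap_mul_radial, radial_one,
    radial_ofNat, radial_m, radial_w, Radial.mul, Radial_sub] at *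
  linear_combination 2 * h1 - (2 * w - 4 * m * w ^ 2) * h2 + h3

/-- The representation of the odd gauge-invariant quantity by a potential `Φ`. -/
structure OddRep (u v Φ : SF M) : Prop where
  reggeWheeler : -K (N Φ) + w ^ 2 * lap Φ = -(6 * m * w ^ 3 * Φ)
  eta_K : w * u = w * Φ - K Φ
  eta_N : w * v = N Φ + w * (1 - 2 * m * w) * Φ

/-- The curl of the formula η = −⋆d(rΦ) is a wave operator on Φ. Granted that formula, the
Regge–Wheeler equation and the elliptic equation defining Φ are therefore equivalent, which serves
both existence and uniqueness. -/
theorem reggeWheeler_sub_master (hK' : w * u = w * Φ - K Φ)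
    (hN' : w * v = N Φ + w * (1 - 2 * m * w) * Φ) :
    2 * (-K (N Φ) + w ^ 2 * lap Φ + 6 * m * w ^ 3 * Φ) = w * (2 * w * Q Φ - oddMaster u v) := by
  have h1 := congrArg K hN'
  have h2 := congrArg N hK'
  simp only [oddMaster, Q, map_add, map_sub, Derivation.leibniz, smul_eq_mul, deriv_m,
    deriv_ofNat, Derivation.map_one_eq_zero, K_w, N_w, N_K] at *
  linear_combination h1 + w * hN' - h2 + (w * (1 - 2 * m * w) - 2 * m * w ^ 2) * hK'

omit [Fact (0 < M)] in
theorem eq_zero_of_Q {f : SF M} (hf : Lam f) (h : Q f = 0) : f = 0 :=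
  eq_zero_of_lap_add (radial_ofNat 2) (fun p => by
    rw [← map_ofNat (algebraMap ℝ (SF M)) 2]; change |(2 : ℝ)| ≤ 2; norm_num) hf h

theorem OddRep.master (h : OddRep u v Φ) : 2 * w * Q Φ - oddMaster u v = 0 := by
  have h1 := reggeWheeler_sub_master h.eta_K h.eta_N
  have h2 : w ^ 1 * (2 * w * Q Φ - oddMaster u v) = 0 := by
    linear_combination -h1 + 2 * h.reggeWheeler
  exact eq_zero_of_w_pow_mul 1 h2

theorem OddRep.unique {Φ' : SF M} (h : OddRep u v Φ) (h' : OddRep u v Φ') (lΦ : Lam Φ)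
    (lΦ' : Lam Φ') : Φ = Φ' := by
  have h1 := h.master
  have h2 := h'.master
  rw [← sub_eq_zero]
  refine eq_zero_of_Q (lΦ.sub lΦ') (eq_zero_of_two_mul (eq_zero_of_w_pow_mul 1 ?_))
  rw [Q_sub]
  linear_combination h1 - h2

theorem OddSystem.exists_rep (h : OddSystem p q C) (hu : u = hK p C) (hv : v = hN q C)
    (lu : Lam u) (lv : Lam v) : ∃ Φ, Lam Φ ∧ OddRep u v Φ := by
  have lm : Lam (oddMaster u v) :=
    (((lv.K.add (lv.radial_mul ((radial_ofNat 2).mul radial_w))).sub lu.N).add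
      (lu.radial_mul (((radial_ofNat 2).mul radial_w).mul radial_mass_aspect))).sub
      (lu.radial_mul radial_two_n)
  -- The elliptic equation (2/r)(Δ + 2)Φ = X is solved in the form (Δ + 2)Φ = ½ r X.
  obtain ⟨Φ, lΦ, hΦ⟩ := exists_lap_add (M := M) (radial_ofNat 2) (fun p => by
    rw [← map_ofNat (algebraMap ℝ (SF M)) 2]; change |(2 : ℝ)| ≤ 2; norm_num)
    (lm.radial_mul (radial_hf.mul radial_r))
  have h0 : 2 * w * Q Φ - oddMaster u v = 0 := by
    have h1 : r * w = (1 : SF M) := r_mul_w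
    rw [Q]
    linear_combination 2 * w * hΦ + 2 * hf * oddMaster u v * h1 + oddMaster u v * two_hf (M := M)
  have r1 : Radial (w * (1 - 2 * m * w) : SF M) := radial_w.mul radial_mass_aspect
  have e1 := h.eq_K hu hv
  have e2 := h.eq_N hu hv
  have e3 := congrArg K h0
  have e4 := congrArg N h0
  -- After Δ + 2 is applied, the difference of the sides is a combination of the K-equation for η
  -- and the elliptic equation with its K-derivative.
  have hK' : w * u = w * Φ - K Φ := by
    rw [← sub_eq_zero]
    refine eq_zero_of_Q ((lu.radial_mul radial_w).sub ((lΦ.radial_mul radial_w).sub lΦ.K))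
      (eq_zero_of_two_mul (eq_zero_of_w_pow_mul 1 ?_))
    simp only [Q_sub, Q_mul radial_w, Q_K]
    generalize oddMaster u v = X at *
    simp only [map_sub, map_zero, Derivation.leibniz, smul_eq_mul, deriv_ofNat, K_w] at e3
    linear_combination e1 + e3 - 2 * w * h0
  have hN' : w * v = N Φ + w * (1 - 2 * m * w) * Φ := by
    rw [← sub_eq_zero]
    refine eq_zero_of_Q ((lv.radial_mul radial_w).sub (lΦ.N.add (lΦ.radial_mul r1)))
      (eq_zero_of_two_mul (eq_zero_of_w_pow_mul 1 ?_))
    simp only [Q_sub, Q_add, Q_mul radial_w, Q_mul r1, Q_N]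
    generalize oddMaster u v = X at *
    simp only [map_sub, map_zero, Derivation.leibniz, smul_eq_mul, deriv_ofNat, N_w] at e4
    linear_combination e2 - e4 - 2 * w * (1 - 2 * m * w) * h0
  refine ⟨Φ, lΦ, ?_, hK', hN'⟩
  have h3 := reggeWheeler_sub_master hK' hN'
  have h4 : 2 * (-K (N Φ) + w ^ 2 * lap Φ + 6 * m * w ^ 3 * Φ) = 0 := by
    rw [h3, h0, mul_zero]
  have h5 := eq_zero_of_two_mul h4
  linear_combination h5

end SF

end

end LinGrav

namespace LinGrav

noncomputable section

namespace SF

variable {M : ℝ} [Fact (0 < M)]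

/-! ### The gauge-invariant quantities in the null frame -/

theorem Lam.hK {p C : SF M} (hp : Lam p) (hC : Lam C) : Lam (hK p C) :=
  (hp.sub hC.K).sub (hC.radial_mul ((radial_ofNat 2).mul radial_w))

theorem Lam.hN {q C : SF M} (hq : Lam q) (hC : Lam C) : Lam (hN q C) :=
  (hq.sub hC.N).add (hC.radial_mul (((radial_ofNat 2).mul radial_w).mul radial_mass_aspect))

/-- The frame components of `v - r² d(r⁻² C)`. -/
theorem f1_sub_sq_mul_grad (v : Fin 2 → SF M) (C : SF M) (a : Fin 2) :
    rad ^ 4 * (w ^ 4 * f1 v a).val - rad ^ 2 * qGrad (rad ^ 2 * (w ^ 4 * C).val) a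
      = (f1 ![hK (v 0) C, hN (v 1) C] a).val := by
  have h1 := r_mul_w (M := M)
  have e1 : r ^ 4 * (w ^ 4 * f1 v a) = f1 v a := by
    rw [← mul_assoc, ← mul_pow, h1, one_pow, one_mul]
  have e2 : r ^ 2 * (w ^ 4 * C) = w ^ 2 * C := by
    linear_combination w ^ 2 * C * (r * w + 1) * h1
  rw [pull_rad, pull_pow, pull_pow, pull_mul, pull_mul, e1, e2, qGrad_eq, pull_mul, mul_f1,
    pull_sub, f1_sub]
  congr 2
  funext i
  fin_cases i
  · change v 0 - r ^ 2 * K (w ^ 2 * C) = v 0 - K C - 2 * w * C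
    simp only [Derivation.leibniz, smul_eq_mul, deriv_sq, K_w]
    linear_combination (-(K C) * (r * w + 1) - 2 * w * C * (r * w + 1)) * h1
  · change v 1 - r ^ 2 * N (w ^ 2 * C) = v 1 - N C + 2 * w * (1 - 2 * m * w) * C
    simp only [Derivation.leibniz, smul_eq_mul, deriv_sq, N_w]
    linear_combination (-(N C) * (r * w + 1) + 2 * w * (1 - 2 * m * w) * C * (r * w + 1)) * h1

theorem Q_f1 (u : Fin 2 → SF M) (a : Fin 2) : Q (f1 u a) = f1 (fun h => Q (u h)) a := by
  rw [Q, lap_f1, mul_f1, f1_add]; rfl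

theorem piS_eq_Pi (f : SF M) : piS f.val = (Pi f).val := piS_eq f

theorem f2_dg_sub (s t s' t' : SF M) (a b : Fin 2) :
    f2 (dg s t) a b - f2 (dg s' t') a b = f2 (dg (s - s') (t - t')) a b := by
  simp only [f2, f1, dg, Matrix.cons_val_zero, Matrix.cons_val_one, Matrix.cons_val_fin_one]
  ring

omit [Fact (0 < M)] in
theorem lam_Pi (f : SF M) : Lam (Pi f) := by
  rw [Pi, Q_lap]; exact lam_lap_lap_add_two f

namespace Comp

variable (c : Comp M)

theorem sDiv2_pert : sDiv2 c.pert.sHat = fun k => (w ^ 2 * sphere.div₂ c.th k).val :=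
  funext (sDiv2_sHat c)

theorem sDiv1_sDiv2_sHat : sDiv1 (sDiv2 c.pert.sHat) = (w ^ 4 * c.C).val := by
  rw [sDiv2_pert, sDiv1_eq (Tan_mul c.tan_div₂ _), sphere.div_mul _ D_w_sq]
  congr 1
  rw [C]; ring

theorem sCurl_sDiv2_sHat : sCurl (sDiv2 c.pert.sHat) = (w ^ 4 * c.Cc).val := by
  rw [sDiv2_pert, sCurl_eq (Tan_mul c.tan_div₂ _), sphere.curl_mul _ D_w_sq]
  congr 1
  rw [Cc]; ring

theorem h_eq : c.pert.h = fun a => (f1 ![hK (Q (sphere.div (c.u 0))) c.C,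
    hN (Q (sphere.div (c.u 1))) c.C] a).val := by
  funext a
  have e : sDiv1 (sDiv2 (sNablaHat (c.pert.gMix a)))
      = (w ^ 4 * f1 (fun h => Q (sphere.div (c.u h))) a).val := by
    refine (sDiv1_sDiv2_sNablaHat (tan_f1 c.tan_u a)).trans ?_
    rw [div_f1, ← Q_f1]; rfl
  rw [Perturbation.h, e, sDiv1_sDiv2_sHat, f1_sub_sq_mul_grad]

theorem eta_eq (a : Fin 2) : c.pert.eta a = (f1 ![hK (Q (sphere.curl (c.u 0))) c.Cc,
    hN (Q (sphere.curl (c.u 1))) c.Cc] a).val := by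
  have e : sCurl (sDiv2 (sNablaHat (c.pert.gMix a)))
      = (w ^ 4 * f1 (fun h => Q (sphere.curl (c.u h))) a).val := by
    refine (sCurl_sDiv2_sNablaHat (tan_f1 c.tan_u a)).trans ?_
    rw [curl_f1, ← Q_f1]; rfl
  rw [Perturbation.eta, e, sCurl_sDiv2_sHat, f1_sub_sq_mul_grad]

theorem trTau_eq : c.pert.trTau = (Pi c.tg + (N (hK (Q (sphere.div (c.u 0))) c.C)
    + 2 * (m * w ^ 2) * hK (Q (sphere.div (c.u 0))) c.C
    + K (hN (Q (sphere.div (c.u 1))) c.C))).val := by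
  change piS c.tg.val + _ = _
  rw [h_eq, qDelta1_eq, piS_eq_Pi, pull_ofNat, pull_mul, pull_add, ← mul_assoc, two_hf, one_mul]
  rfl

theorem piS_gHat (a b : Fin 2) :
    piS (c.pert.gHat a b) = (f2 (dg (Pi c.al) (Pi c.be)) a b).val := by
  refine (piS_eq_Pi (f2 (dg c.al c.be) a b)).trans (congrArg SF.val ?_)
  simp only [f2, f1, dg, Matrix.cons_val_zero, Matrix.cons_val_one, Matrix.cons_val_fin_one,
    mul_comm _ (e _ _), Pi_add, Pi_mul (radial_e _ _), Pi_zero]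

theorem tauHat_eq (a b : Fin 2) : c.pert.tauHat a b = (f2 (dg
    (Pi c.al - 2 * K (hK (Q (sphere.div (c.u 0))) c.C))
    (Pi c.be - 2 * (N (hN (Q (sphere.div (c.u 1))) c.C)
      - 2 * (m * w ^ 2) * hN (Q (sphere.div (c.u 1))) c.C))) a b).val := by
  rw [← f2_dg_sub, ← pull_sub, Perturbation.tauHat, h_eq, qNablaHat_eq, piS_gHat,
    Matrix.cons_val_zero, Matrix.cons_val_one, Matrix.cons_val_fin_one]

theorem sigma_eq : c.pert.sigma = (Pi c.ts - 2 * w * (hN (Q (sphere.div (c.u 1))) c.C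
    - (1 - 2 * m * w) * hK (Q (sphere.div (c.u 0))) c.C) - 2 * w ^ 2 * lap c.C).val := by
  have h1 := r_mul_w (M := M)
  change piS c.ts.val - _ - _ = _
  rw [h_eq, contrP_f1, piS_eq_Pi, sDiv1_sDiv2_sHat, sLap0_eq, div_eq_mul_inv, pull_inv_rad,
    pull_rad, pull_pow, pull_ofNat, pull_ofNat, pull_mul, pull_mul, pull_mul, pull_mul, pull_sub,
    pull_sub]
  congr 1
  rw [lap_mul_radial (radial_w.pow 4)]
  change Pi c.ts - 4 * w * (hf * (hN (Q (sphere.div (c.u 1))) c.C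
    - (1 - 2 * m * w) * hK (Q (sphere.div (c.u 0))) c.C)) - _ = _
  linear_combination -2 * w * (hN (Q (sphere.div (c.u 1))) c.C
    - (1 - 2 * m * w) * hK (Q (sphere.div (c.u 0))) c.C) * two_hf (M := M)
    - 2 * w ^ 2 * lap c.C * (r * w + 1) * (r ^ 2 * w ^ 2 + 1) * h1

omit [Fact (0 < M)] in
theorem lam_C : Lam c.C := lam_div_div₂ c.tan_th c.symm_th c.tr_th
omit [Fact (0 < M)] in
theorem lam_Cc : Lam c.Cc := lam_curl_div₂ c.tan_th c.symm_th
omit [Fact (0 < M)] in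
theorem lam_div (h : Fin 2) : Lam (Q (sphere.div (c.u h))) := lam_lap_add_two (J_div (c.tan_u h))
omit [Fact (0 < M)] in
theorem lam_curl (h : Fin 2) : Lam (Q (sphere.curl (c.u h))) := lam_lap_add_two (J_curl _)

end Comp

/-! ### The operator `ζ` -/

theorem rad_sq_mul_zSlap (f : SF M) :
    rad ^ 2 * zSlap f.val = (lap f + (2 - 6 * m * w) * f).val := by
  have h1 := r_mul_w (M := M)
  rw [zSlap, sLap0_eq]
  simp only [div_eq_mul_inv, ← inv_pow, pull_inv_rad]
  simp only [pull_rad, pull_mass, pull_one, pull_ofNat, pull_pow, pull_mul, pull_sub, pull_add]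
  congr 1
  linear_combination (lap f + 2 * (1 - 3 * m * w) * f) * (r * w + 1) * h1

/-- Once some u in Λ solves the equation, the choice behind `invFunOn` also returns a solution in Λ,
and injectivity identifies the two. -/
theorem zeta_eq {f u : SF M} (hu : Lam u) (h : lap u + (2 - 6 * m * w) * u = f) :
    zeta f.val = u.val := by
  have hm : ∃ v ∈ LamM M, (fun u : Scal M => rad ^ 2 * zSlap u) v = f.val :=
    ⟨u.val, (mem_LamM_iff u).mpr hu, (rad_sq_mul_zSlap u).trans (congrArg SF.val h)⟩
  have h1 := Function.invFunOn_mem hm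
  have h2 := Function.invFunOn_eq hm
  change zeta f.val ∈ LamM M at h1
  change rad ^ 2 * zSlap (zeta f.val) = f.val at h2
  generalize zeta f.val = z at h1 h2
  obtain ⟨v, rfl⟩ : ∃ v : SF M, z = v.val := ⟨⟨z, h1.1⟩, rfl⟩
  rw [rad_sq_mul_zSlap] at h2
  have hv := (mem_LamM_iff v).mp h1
  have h3 : lap v + (2 - 6 * m * w) * v = f := SF.ext h2
  have h4 : v - u = 0 := eq_zero_of_lap_add radial_c abs_c_le (hv.sub hu) (by
    rw [lap_sub]; linear_combination h3 - h)
  rw [sub_eq_zero.mp h4]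

/-- The coefficient 2 − 6M/r depends on r, so ζ does not commute with d̃. The commutator is 6M/r²
times dr times ζ²Ψ, and this is how Ω enters the formulas for the components of τ̂. -/
theorem zeta_qGrad {Ψ χ Ω : SF M} (lχ : Lam χ) (lΩ : Lam Ω)
    (hχ : lap χ + (2 - 6 * m * w) * χ = Ψ) (hΩ : lap Ω + (2 - 6 * m * w) * Ω = χ) (a : Fin 2) :
    zeta (qGrad Ψ.val a) = (f1 ![K χ - 6 * m * w ^ 2 * Ω,
      N χ + 6 * m * w ^ 2 * (1 - 2 * m * w) * Ω] a).val := by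
  have r1 : Radial (6 * m * w ^ 2 : SF M) := ((radial_ofNat 6).mul radial_m).mul (radial_w.pow 2)
  have r2 := r1.mul (radial_mass_aspect (M := M))
  have l0 : Lam (K χ - 6 * m * w ^ 2 * Ω) := lχ.K.sub (lΩ.radial_mul r1)
  have l1 : Lam (N χ + 6 * m * w ^ 2 * (1 - 2 * m * w) * Ω) := lχ.N.add (lΩ.radial_mul r2)
  have hl : ∀ u : Fin 2 → SF M, Lam (u 0) → Lam (u 1) → Lam (f1 u a) := fun u h0 h1 => by
    rw [f1, mul_comm, mul_comm (u 1)]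
    exact (h0.radial_mul (radial_e _ _)).add (h1.radial_mul (radial_e _ _))
  rw [qGrad_eq]
  refine zeta_eq (hl _ l0 l1) ?_
  rw [lap_f1, mul_f1, f1_add]
  congr 1
  funext i
  fin_cases i
  · change lap (K χ - 6 * m * w ^ 2 * Ω) + (2 - 6 * m * w) * (K χ - 6 * m * w ^ 2 * Ω) = K Ψ
    rw [← hχ, lap_sub, lap_K, lap_mul_radial r1]
    simp only [map_add, map_sub, Derivation.leibniz, smul_eq_mul, deriv_m, deriv_ofNat, K_w]
    linear_combination -6 * m * w ^ 2 * hΩ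
  · change lap (N χ + 6 * m * w ^ 2 * (1 - 2 * m * w) * Ω)
      + (2 - 6 * m * w) * (N χ + 6 * m * w ^ 2 * (1 - 2 * m * w) * Ω) = N Ψ
    rw [← hχ, lap_add, lap_N, lap_mul_radial r2]
    simp only [map_add, map_sub, Derivation.leibniz, smul_eq_mul, deriv_m, deriv_ofNat, N_w]
    linear_combination 6 * m * w ^ 2 * (1 - 2 * m * w) * hΩ

/-! ### The potentials as scalar fields -/

theorem qGrad_val (f : SF M) : qGrad f.val = fun a => (f1 (df f) a).val := funext (qGrad_eq f)

theorem qStar_eq (v : Fin 2 → SF M) (b : Fin 2) :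
    qStar (fun a => (f1 v a).val) b = (f1 ![v 0, -v 1] b).val := by
  have h := two_hf (M := M)
  have e00 : (epsQ 0 0 : Scal M) = (0 : SF M).val := rfl
  have e01 : (epsQ 0 1 : Scal M) = (1 : SF M).val := rfl
  have e10 : (epsQ 1 0 : Scal M) = (-1 : SF M).val := rfl
  have e11 : (epsQ 1 1 : Scal M) = (0 : SF M).val := rfl
  fin_cases b <;>
    simp only [Fin.zero_eta, Fin.mk_one, qStar, Fin.sum_univ_two, e00, e01, e10, e11, gQinv_eq,
      pull_mul, pull_add] <;> congr 1 <;>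
    simp only [ginv, f1, e, Matrix.of_apply, Matrix.cons_val', Matrix.cons_val_zero,
      Matrix.cons_val_one, Matrix.cons_val_fin_one]
  · linear_combination (-2 * m * w * v 0) * h
  · linear_combination (-2 * m * w * v 0) * h

theorem isReggeWheeler_iff {Φ : SF M} (lΦ : Lam Φ) : IsReggeWheeler Φ.val ↔
    -K (N Φ) + w ^ 2 * lap Φ = -(6 * m * w ^ 3 * Φ) := by
  rw [IsReggeWheeler, mem_LamM_iff, and_iff_right lΦ, qBox0_eq, sLap0_eq]
  simp only [div_eq_mul_inv, ← inv_pow, pull_inv_rad, pull_mass, pull_ofNat,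
    pull_pow, pull_mul, pull_add, pull_neg, bx]
  constructor
  · intro h
    have h1 := SF.ext h
    linear_combination h1
  · intro h
    congr 1
    linear_combination h

theorem isZerilli_iff {Ψ χ Ω : SF M} (lΨ : Lam Ψ) (hχ : zeta Ψ.val = χ.val)
    (hΩ : zeta χ.val = Ω.val) : IsZerilli Ψ.val ↔
    -K (N Ψ) + w ^ 2 * lap Ψ = -(6 * m * w ^ 3 * Ψ) + 24 * m * w ^ 3 * (1 - 3 * m * w) * χ
      + 72 * m ^ 2 * w ^ 4 * (1 - 2 * m * w) * Ω := by
  have h1 := r_mul_w (M := M)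
  rw [IsZerilli, mem_LamM_iff, and_iff_right lΨ, qBox0_eq, sLap0_eq, hχ, hΩ]
  simp only [div_eq_mul_inv, ← inv_pow, pull_inv_rad]
  simp only [pull_rad, pull_mass, pull_ofNat, pull_pow, pull_mul, pull_add, pull_sub, pull_neg, bx]
  constructor
  · intro h
    have h2 := SF.ext h
    linear_combination h2 + (24 * m * w ^ 3 * χ + 72 * m ^ 2 * w ^ 4 * Ω) * h1
  · intro h
    congr 1
    linear_combination h - (24 * m * w ^ 3 * χ + 72 * m ^ 2 * w ^ 4 * Ω) * h1

theorem K_r_mul (f : SF M) : K (r * f) = r * K f - f := by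
  rw [Derivation.leibniz, K_r, smul_eq_mul, smul_eq_mul]; ring

theorem N_r_mul (f : SF M) : N (r * f) = r * N f + (1 - 2 * m * w) * f := by
  rw [Derivation.leibniz, N_r, smul_eq_mul, smul_eq_mul]; ring

theorem w_mul_inj {f g : SF M} : w * f = w * g ↔ f = g := by
  refine ⟨fun h => ?_, fun h => by rw [h]⟩
  linear_combination r * h - (f - g) * r_mul_w (M := M)

theorem forall_f1_iff {u v : Fin 2 → SF M} :
    (∀ a, (f1 u a).val = (f1 v a).val) ↔ u 0 = v 0 ∧ u 1 = v 1 := by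
  refine ⟨fun h => by rw [f1_inj h]; exact ⟨rfl, rfl⟩, fun h a => ?_⟩
  rw [f1, f1, h.1, h.2]

theorem forall_f2_dg_iff {a b a' b' : SF M} :
    (∀ i j, (f2 (dg a b) i j).val = (f2 (dg a' b') i j).val) ↔ a = a' ∧ b = b' := by
  refine ⟨fun h => ?_, fun h i j => by rw [h.1, h.2]⟩
  have h1 := f2_inj h
  exact ⟨congrFun (congrFun h1 0) 0, congrFun (congrFun h1 1) 1⟩

theorem oddRep_iff {u v Φ : SF M} (lΦ : Lam Φ) : OddRep u v Φ ↔
    IsReggeWheeler Φ.val ∧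
      ∀ a, (f1 ![u, v] a).val = -qStar (qGrad (rad * Φ.val)) a := by
  have e : ∀ a, -qStar (qGrad (rad * Φ.val)) a = (f1 ![-K (r * Φ), N (r * Φ)] a).val := fun a => by
    rw [pull_rad, pull_mul, qGrad_val, qStar_eq, pull_neg,
      f1_neg]
    congr 2
    funext i
    fin_cases i
    · rfl
    · exact neg_neg _
  have h1 := r_mul_w (M := M)
  simp only [isReggeWheeler_iff lΦ, e, forall_f1_iff, Matrix.cons_val_zero, Matrix.cons_val_one,
    Matrix.cons_val_fin_one, K_r_mul, N_r_mul]
  rw [← w_mul_inj (f := u), ← w_mul_inj (f := v)]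
  have e1 : w * -(r * K Φ - Φ) = w * Φ - K Φ := by linear_combination (-(K Φ)) * h1
  have e2 : w * (r * N Φ + (1 - 2 * m * w) * Φ) = N Φ + w * (1 - 2 * m * w) * Φ := by
    linear_combination (N Φ) * h1
  rw [e1, e2]
  exact ⟨fun h => ⟨h.1, h.2, h.3⟩, fun h => ⟨h.1, h.2.1, h.2.2⟩⟩

/-- The tensor equations are compared in the null frame after multiplication by w = 1/r, which turns
the second derivatives of rΨ into those of Ψ. The terms in Ω come from `zeta_qGrad`. -/
theorem evenRep_iff {a b s Ψ χ Ω : SF M} (lΨ : Lam Ψ) (lχ : Lam χ) (lΩ : Lam Ω)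
    (hχ : lap χ + (2 - 6 * m * w) * χ = Ψ) (hΩ : lap Ω + (2 - 6 * m * w) * Ω = χ) :
    EvenRep a b s Ψ χ Ω ↔ IsZerilli Ψ.val ∧
      (∀ i j, (f2 (dg a b) i j).val = qNablaHat (qGrad (rad * Ψ.val)) i j
        + 6 * mu * qHat dr (fun c => zeta (qGrad Ψ.val c)) i j) ∧
      s.val = -(2 * rad * sLap0 Ψ.val) + 4 * qNablaP0 Ψ.val
        + 12 * mu / rad * (1 - mu) * zeta Ψ.val := by
  have h1 := r_mul_w (M := M)
  have h2 := two_hf (M := M)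
  have zχ := zeta_eq lχ hχ
  have e : ∀ i j, qNablaHat (qGrad (rad * Ψ.val)) i j
      + 6 * mu * qHat dr (fun c => zeta (qGrad Ψ.val c)) i j
      = (f2 (dg (2 * K (K (r * Ψ)) - 24 * m * w * (K χ - 6 * m * w ^ 2 * Ω))
        (2 * (N (N (r * Ψ)) - 2 * (m * w ^ 2) * N (r * Ψ)) + 24 * m * w * ((1 - 2 * m * w)
          * (N χ + 6 * m * w ^ 2 * (1 - 2 * m * w) * Ω)))) i j).val := fun i j => by
    rw [pull_rad, pull_mul, qGrad_val (r * Ψ),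
      show (fun c => zeta (qGrad Ψ.val c)) = _ from funext (zeta_qGrad lχ lΩ hχ hΩ), qNablaHat_eq,
      qHat_dr_eq, mu_eq, pull_ofNat, pull_mul, pull_mul, pull_add, mul_f2, f2_add]
    congr 2
    funext i j
    fin_cases i <;> fin_cases j
    · change 2 * K (K (r * Ψ)) + 6 * (2 * m * w) * -(2 * (K χ - 6 * m * w ^ 2 * Ω)) = _ - _
      ring
    · change (0 : SF M) + _ * 0 = 0
      ring
    · change (0 : SF M) + _ * 0 = 0
      ring
    · change 2 * (N (N (r * Ψ)) - 2 * (m * w ^ 2) * N (r * Ψ)) + 6 * (2 * m * w)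
        * (2 * ((1 - 2 * m * w) * (N χ + 6 * m * w ^ 2 * (1 - 2 * m * w) * Ω))) = _ + _
      ring
  have e' : -(2 * rad * sLap0 Ψ.val) + 4 * qNablaP0 Ψ.val
        + 12 * mu / rad * (1 - mu) * zeta Ψ.val
      = (-(2 * w * lap Ψ) + 2 * (N Ψ - (1 - 2 * m * w) * K Ψ)
        + 24 * m * w ^ 2 * (1 - 2 * m * w) * χ).val := by
    rw [zχ, sLap0_eq, qNablaP0_eq, mu_eq]
    simp only [div_eq_mul_inv, pull_inv_rad]
    simp only [pull_rad, pull_ofNat, pull_one, pull_mul, pull_add, pull_sub, pull_neg, cP, df_zero,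
      df_one]
    congr 1
    linear_combination -2 * w * lap Ψ * h1 + 2 * (N Ψ - (1 - 2 * m * w) * K Ψ) * h2
  have e1 : w * (2 * K (K (r * Ψ)) - 24 * m * w * (K χ - 6 * m * w ^ 2 * Ω))
      = 2 * K (K Ψ) - 4 * w * K Ψ - 24 * m * w ^ 2 * (K χ - 6 * m * w ^ 2 * Ω) := by
    rw [K_r_mul, map_sub, K_r_mul]
    linear_combination 2 * K (K Ψ) * h1
  have e2 : w * (2 * (N (N (r * Ψ)) - 2 * (m * w ^ 2) * N (r * Ψ)) + 24 * m * w
        * ((1 - 2 * m * w) * (N χ + 6 * m * w ^ 2 * (1 - 2 * m * w) * Ω)))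
      = 2 * N (N Ψ) + 2 * w * (2 - 6 * m * w) * N Ψ
        + 24 * m * w ^ 2 * (1 - 2 * m * w) * (N χ + 6 * m * w ^ 2 * (1 - 2 * m * w) * Ω) := by
    simp only [map_add, map_sub, Derivation.leibniz, smul_eq_mul, deriv_m, deriv_ofNat,
      Derivation.map_one_eq_zero, N_w, N_r]
    linear_combination (2 * N (N Ψ) - 4 * m * w ^ 2 * N Ψ) * h1
  simp only [isZerilli_iff lΨ zχ (zeta_eq lΩ hΩ), e, forall_f2_dg_iff, e']
  rw [← w_mul_inj (f := a), ← w_mul_inj (f := b), e1, e2]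
  exact ⟨fun h => ⟨h.1, ⟨h.2, h.3⟩, congrArg SF.val h.4⟩,
    fun h => ⟨h.1, h.2.1.1, h.2.1.2, SF.ext h.2.2⟩⟩

end SF

end

end LinGrav

/-! ### Assembly: vanishing trace, odd potential, even potential. -/

open LinGrav LinGrav.SF in
theorem mainTheorem3 (M : ℝ) (hM : 0 < M) (S : LinGrav.Perturbation M)
    (hS : LinGrav.IsSmoothSolution S) :
    S.trTau = 0 ∧
    (∃! Φ : LinGrav.Scal M, LinGrav.IsReggeWheeler Φ ∧
      ∀ a, S.eta a = -LinGrav.qStar (LinGrav.qGrad (LinGrav.rad * Φ)) a) ∧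
    (∃! Ψ : LinGrav.Scal M, LinGrav.IsZerilli Ψ ∧
      (∀ a b, S.tauHat a b
        = LinGrav.qNablaHat (LinGrav.qGrad (LinGrav.rad * Ψ)) a b
          + 6 * LinGrav.mu
            * LinGrav.qHat LinGrav.dr (fun c => LinGrav.zeta (LinGrav.qGrad Ψ c)) a b) ∧
      S.sigma
        = -(2 * LinGrav.rad * LinGrav.sLap0 Ψ) + 4 * LinGrav.qNablaP0 Ψ
          + 12 * LinGrav.mu / LinGrav.rad * (1 - LinGrav.mu) * LinGrav.zeta Ψ) := by
  have := Fact.mk hM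
  obtain ⟨c, rfl⟩ := exists_comp hS
  have he := Comp.evenSystem hS
  have ho := Comp.oddSystem hS
  -- A competitor in the uniqueness claims is an arbitrary scalar field; membership in Λ includes
  -- smoothness and so makes it an element of the ring.
  have lift : ∀ {f : Scal M}, f ∈ LamM M → ∃ g : SF M, Lam g ∧ f = g.val := fun {f} hf =>
    ⟨⟨f, hf.1⟩, (mem_LamM_iff ⟨f, hf.1⟩).mp hf, rfl⟩
  refine ⟨?_, ?_, ?_⟩
  · rw [Comp.trTau_eq, pull_zero]
    congr 1
    linear_combination he.trTau
  · obtain ⟨Φ, lΦ, hΦ⟩ := ho.exists_rep rfl rfl ((c.lam_curl 0).hK c.lam_Cc)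
      ((c.lam_curl 1).hN c.lam_Cc)
    simp only [Comp.eta_eq]
    refine ⟨Φ.val, (oddRep_iff lΦ).mp hΦ, fun f hf => ?_⟩
    obtain ⟨Φ', lΦ', rfl⟩ := lift hf.1.1
    rw [((oddRep_iff lΦ').mpr hf).unique hΦ lΦ' lΦ]
  · have lC := c.lam_C
    have lp := (c.lam_div 0).hK lC
    have lq := (c.lam_div 1).hN lC
    have r2 : Radial (2 : SF M) := radial_ofNat 2
    obtain ⟨Ψ, χ, Ω, lΨ, lχ, lΩ, hχ, hΩ, hΨ⟩ := he.tauSystem.exists_rep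
      ((lam_Pi _).sub (lp.K.radial_mul r2))
      ((lam_Pi _).sub ((lq.N.sub (lq.radial_mul radial_two_n)).radial_mul r2))
      (((lam_Pi _).sub ((lq.sub (lp.radial_mul radial_mass_aspect)).radial_mul
        (r2.mul radial_w))).sub (lC.lap.radial_mul (r2.mul (radial_w.pow 2))))
    simp only [Comp.tauHat_eq, Comp.sigma_eq]
    refine ⟨Ψ.val, (evenRep_iff lΨ lχ lΩ hχ hΩ).mp hΨ, fun f hf => ?_⟩
    obtain ⟨Ψ', lΨ', rfl⟩ := lift hf.1.1
    -- The competing potential needs its own ζΨ′ and ζ²Ψ′ before its representation can be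
    -- translated to the null frame.
    obtain ⟨χ', lχ', hχ'⟩ := exists_lap_add radial_c abs_c_le lΨ'
    obtain ⟨Ω', lΩ', hΩ'⟩ := exists_lap_add radial_c abs_c_le lχ'
    rw [((evenRep_iff lΨ' lχ' lΩ' hχ' hΩ').mpr hf).unique hΨ hχ' hχ lΨ' lΨ]
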